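/- Let $(M^{2m},g,J)$ be a compact Kähler–Einstein manifold with $\mathrm{ric}^g=Eg$, $E<0$. Let $\nabla$ be the Levi-Civita connection, and identify vectors with $1$-forms, and bilinear forms with endomorphisms of $TM$, by means of $g$ (a $2$-form $\alpha$ corresponds to $K$ with $g(KX,Y)=\alpha(X,Y)$). Let $\{e_i\}$ be a local orthonormal frame, with summation over repeated indices. Let $\mathrm{Sym}^{2,\pm}TM$ be the bundle of $g$-symmetric endomorphisms $h$ of $TM$ with $hJ=\pm Jh$. Conventions: $R(X,Y)=\nabla^2_{Y,X}-\nabla^2_{X,Y}$, $\mathring{R}h=R(e_i,\cdot)\,h e_i$ and $\mathrm{Ric}=\mathring R\,\mathrm{id}$; $d_\nabla h(X,Y)=(\nabla_Xh)Y-(\nabla_Yh)X$; $\delta h=-(\nabla_{e_i}h)e_i$ for endomorphisms, and $(\delta\alpha)(X)=-(\nabla_{e_i}\alpha)(e_i,X)$ for $\alpha\in\Omega^2(M,TM)$; $\Delta_E=\nabla^*\nabla-2\mathring{R}$ with $\nabla^*\nabla=-\nabla^2_{e_i,e_i}$; $\delta^{*}\xi$ is the symmetric part of $\nabla\xi$,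 and $\delta^{*,\pm}\xi$ is the component of $\delta^*\xi$ in $\mathrm{Sym}^{2,\pm}TM$; $d^-\xi=\tfrac12\big(d\xi-d\xi(J\cdot,J\cdot)\big)$; $\overline\partial h=\tfrac12\big(d_\nabla h-d_\nabla h(J\cdot,J\cdot)\big)$; $(H\sharp\alpha)(X,Y)=\alpha(HX,Y)+\alpha(X,HY)$; $(h\circ\alpha)(X,Y)=h(\alpha(X,Y))$; $(\xi\wedge h)(Y,Z)=g(\xi,Y)hZ-g(\xi,Z)hY$; $\{A,B\}=AB+BA$ and $[A,B]=AB-BA$. The $L^2$ products integrate $\langle A,B\rangle=g(Ae_i,Be_i)$ on endomorphisms and $\langle\alpha,\beta\rangle=\tfrac12\,g(\alpha(e_i,e_j),\beta(e_i,e_j))$ on $\Omega^2(M,TM)$ against the Riemannian volume. For $h\in\Gamma(\mathrm{Sym}^{2,-}TM)$ put $$\mathbf{D}h=\{\mathring{R}h+\delta^{*,-}\delta h,\,h\}-\big(\tfrac12\Delta_E-\mathring{R}\big)h^2+\delta^{*,+}\big(2\,\delta(h^2)+\tfrac12\,d\,\mathrm{tr}(h^2)-2\,h\,\delta h\big)+\tfrac12[h,d^-\delta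 h].$$ Then for all smooth $h\in\Gamma(\mathrm{Sym}^{2,-}TM)$ and $H\in\Gamma(\mathrm{Sym}^{2,+}TM)$ $$\langle H\sharp d_\nabla h,d_\nabla h\rangle_{L^2}=\langle\mathbf{D}h,H\rangle_{L^2}+2\langle H\sharp\overline\partial h,\overline\partial h\rangle_{L^2}+2\langle\delta(h\circ\overline\partial h),H\rangle_{L^2}-2\langle\overline\partial h,\delta H\wedge h\rangle_{L^2}.$$ -/

import Mathlib

open scoped Manifold ContDiff Bundle
open Bundle MeasureTheory

noncomputable section

namespace KaehlerEinstein

section Fields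

variable (n : ℕ) (M : Type*) [TopologicalSpace M] [ChartedSpace (EuclideanSpace ℝ (Fin n)) M]

/-- Vector fields on `M` (not assumed to be smooth). By means of the metric, they are also used
for `1`-forms. -/
abbrev VField := (x : M) → TangentSpace (𝓡 n) x

/-- Fields of fibrewise maps `T_x M → T_x M`, used for sections of `End(TM)`. -/
abbrev EndField := (x : M) → TangentSpace (𝓡 n) x → TangentSpace (𝓡 n) x

/-- Fields of fibrewise maps `T_x M × T_x M → T_x M`, used for `TM`-valued `2`-tensors, in
particular for elements of `Ω²(M, TM)`. -/
abbrev BiField :=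
  (x : M) → TangentSpace (𝓡 n) x → TangentSpace (𝓡 n) x → TangentSpace (𝓡 n) x

end Fields

variable {n : ℕ} {M : Type*} [TopologicalSpace M] [ChartedSpace (EuclideanSpace ℝ (Fin n)) M]

section Smooth

variable [IsManifold (𝓡 n) ∞ M]

/-- The smooth vector field near `x` which extends `v ∈ T_x M` (it has constant coefficients in
the preferred chart at `x`, and is zero off the domain of that chart). -/
def extendVec {x : M} (v : TangentSpace (𝓡 n) x) : VField n M :=
  FiberBundle.extend (EuclideanSpace ℝ (Fin n)) v

/-- `A` is a smooth section of the bundle `End(TM)`: it is given by continuous linear maps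
`T_x M → T_x M` which form a smooth section of the bundle of homomorphisms. -/
def IsSmoothEnd (A : EndField n M) : Prop :=
  ∃ A₀ : (x : M) → TangentSpace (𝓡 n) x →L[ℝ] TangentSpace (𝓡 n) x,
    (∀ (x : M) (v : TangentSpace (𝓡 n) x), A x v = A₀ x v) ∧
    ContMDiff (𝓡 n)
      ((𝓡 n).prod 𝓘(ℝ, EuclideanSpace ℝ (Fin n) →L[ℝ] EuclideanSpace ℝ (Fin n))) ∞
      (fun x : M ↦ TotalSpace.mk' (EuclideanSpace ℝ (Fin n) →L[ℝ] EuclideanSpace ℝ (Fin n))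
        (E := fun x : M ↦ TangentSpace (𝓡 n) x →L[ℝ] TangentSpace (𝓡 n) x) x (A₀ x))

variable (n M) in
/-- A smooth partition of unity on `M`, indexed by the points of `M`, such that the support of its
`p`-th function lies in the domain of the preferred chart at `p`. -/
def chartPartition [SigmaCompactSpace M] [T2Space M] :
    SmoothPartitionOfUnity M (𝓡 n) M Set.univ :=
  Classical.choose (SmoothPartitionOfUnity.exists_isSubordinate_chartAt_source (𝓡 n) M)

end Smooth

/-! ### Algebraic operations which do not involve the metric -/

/-- `A ∘ B`. -/
def comp (A B : EndField n M) : EndField n M := fun x v ↦ A x (B x v)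

/-- The anticommutator `{A, B}`. -/
def anticomm (A B : EndField n M) : EndField n M := comp A B + comp B A

/-- The commutator `[A, B]`. -/
def comm (A B : EndField n M) : EndField n M := comp A B - comp B A

/-- The vector field `A ξ`. -/
def applyField (A : EndField n M) (ξ : VField n M) : VField n M := fun x ↦ A x (ξ x)

/-- The component of `A` which commutes with `J`. -/
def plusPart (J A : EndField n M) : EndField n M := (1 / 2 : ℝ) • (A - comp J (comp A J))

/-- The component of `A` which anticommutes with `J`. -/
def minusPart (J A : EndField n M) : EndField n M := (1 / 2 : ℝ) • (A + comp J (comp A J))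

/-- The algebraic action `(H ♯ α)(X, Y) = α(HX, Y) + α(X, HY)`. -/
def sharp (H : EndField n M) (α : BiField n M) : BiField n M :=
  fun x u v ↦ α x (H x u) v + α x u (H x v)

/-- The tensor `(X, Y) ↦ h(α(X, Y))`. -/
def compForm (h : EndField n M) (α : BiField n M) : BiField n M := fun x u v ↦ h x (α x u v)

section Metric

variable [RiemannianBundle (fun x : M ↦ TangentSpace (𝓡 n) x)]

/-- An orthonormal basis of `T_x M`. All expressions below in which it occurs are traces, and do
not depend on its choice. -/
def frame (x : M) :
    OrthonormalBasis (Fin (Module.finrank ℝ (TangentSpace (𝓡 n) x))) ℝ (TangentSpace (𝓡 n) x) :=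
  haveI : FiniteDimensional ℝ (TangentSpace (𝓡 n) x) :=
    inferInstanceAs (FiniteDimensional ℝ (EuclideanSpace ℝ (Fin n)))
  stdOrthonormalBasis ℝ (TangentSpace (𝓡 n) x)

/-- `A` is `g`-symmetric and commutes with `J`: a section of `Sym^{2,+} TM`. -/
def IsSymPlus (J A : EndField n M) : Prop :=
  (∀ (x : M) (u v : TangentSpace (𝓡 n) x), inner ℝ (A x u) v = inner ℝ u (A x v)) ∧
    ∀ (x : M) (v : TangentSpace (𝓡 n) x), A x (J x v) = J x (A x v)

/-- `A` is `g`-symmetric and anticommutes with `J`: a section of `Sym^{2,-} TM`. -/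
def IsSymMinus (J A : EndField n M) : Prop :=
  (∀ (x : M) (u v : TangentSpace (𝓡 n) x), inner ℝ (A x u) v = inner ℝ u (A x v)) ∧
    ∀ (x : M) (v : TangentSpace (𝓡 n) x), A x (J x v) = -J x (A x v)

/-- The transpose of `A` with respect to the metric. -/
def transp (A : EndField n M) : EndField n M :=
  fun x v ↦ ∑ i, (inner ℝ (A x (frame x i)) v) • frame x i

/-- The trace of `A`. -/
def trace (A : EndField n M) (x : M) : ℝ := ∑ i, inner ℝ (A x (frame x i)) (frame x i)

/-- The gradient of a function, that is, the vector field dual to `df`. -/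
def gradient (f : M → ℝ) : VField n M :=
  fun x ↦ ∑ i, (mvfderiv (𝓡 n) f x (frame x i)) • frame x i

/-- The wedge product `(ξ ∧ h)(Y, Z) = g(ξ, Y) hZ - g(ξ, Z) hY`. -/
def wedge (ξ : VField n M) (h : EndField n M) : BiField n M :=
  fun x u v ↦ (inner ℝ (ξ x) u) • h x v - (inner ℝ (ξ x) v) • h x u

/-! ### The Levi-Civita connection and the curvature -/

variable [IsManifold (𝓡 n) ∞ M]

/-- The right-hand side of the Koszul formula
`2 g(∇_X Y, Z) = X g(Y, Z) + Y g(X, Z) - Z g(X, Y) + g([X, Y], Z) - g([X, Z], Y) - g([Y, Z], X)`. -/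
def koszul (X Y Z : VField n M) (x : M) : ℝ :=
  mvfderiv (𝓡 n) (fun y ↦ inner ℝ (Y y) (Z y)) x (X x)
    + mvfderiv (𝓡 n) (fun y ↦ inner ℝ (X y) (Z y)) x (Y x)
    - mvfderiv (𝓡 n) (fun y ↦ inner ℝ (X y) (Y y)) x (Z x)
    + inner ℝ (VectorField.mlieBracket (𝓡 n) X Y x) (Z x)
    - inner ℝ (VectorField.mlieBracket (𝓡 n) X Z x) (Y x)
    - inner ℝ (VectorField.mlieBracket (𝓡 n) Y Z x) (X x)

/-- The Levi-Civita connection of the metric: `nabla Y x v` is `∇_v Y` for `v ∈ T_x M`, computed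
from the Koszul formula. -/
def nabla (Y : VField n M) : EndField n M :=
  fun x v ↦ ∑ i, ((1 / 2 : ℝ) * koszul (extendVec v) Y (extendVec (frame x i)) x) • frame x i

/-- The covariant derivative of a section of `End(TM)`: `nablaEnd A x u v` is `(∇_u A) v`. -/
def nablaEnd (A : EndField n M) : BiField n M :=
  fun x u v ↦ nabla (fun y ↦ A y (extendVec v y)) x u - A x (nabla (extendVec v) x u)

/-- The covariant derivative of a `TM`-valued `2`-tensor: `nablaBi α x u v w` is
`(∇_u α)(v, w)`. -/
def nablaBi (α : BiField n M) (x : M) (u v w : TangentSpace (𝓡 n) x) : TangentSpace (𝓡 n) x :=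
  nabla (fun y ↦ α y (extendVec v y) (extendVec w y)) x u
    - α x (nabla (extendVec v) x u) w - α x v (nabla (extendVec w) x u)

/-- The curvature tensor, with the convention `R(u, v) = ∇²_{v,u} - ∇²_{u,v}`. -/
def curv (x : M) (u v w : TangentSpace (𝓡 n) x) : TangentSpace (𝓡 n) x :=
  nablaEnd (nabla (extendVec w)) x v u - nablaEnd (nabla (extendVec w)) x u v

/-- The Ricci tensor `ric(v, w) = ∑ i, g(R(e_i, v) e_i, w)`. -/
def ricci (x : M) (v w : TangentSpace (𝓡 n) x) : ℝ :=
  ∑ i, inner ℝ (curv x (frame x i) v (frame x i)) w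

variable (n M) in
/-- The metric is Einstein with Einstein constant `E`. -/
def IsEinstein (E : ℝ) : Prop :=
  ∀ (x : M) (v w : TangentSpace (𝓡 n) x), ricci x v w = E * inner ℝ v w

/-- `J` is an orthogonal almost complex structure which is parallel for the Levi-Civita
connection; for smooth `J` this says that `(g, J)` is a Kähler structure. -/
structure IsKaehler (J : EndField n M) : Prop where
  sq : ∀ (x : M) (v : TangentSpace (𝓡 n) x), J x (J x v) = -v
  orthogonal : ∀ (x : M) (u v : TangentSpace (𝓡 n) x), inner ℝ (J x u) (J x v) = inner ℝ u v
  parallel : ∀ (x : M) (u v : TangentSpace (𝓡 n) x), nablaEnd J x u v = 0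

/-! ### Differential operators -/

/-- The curvature action `R̊ h = ∑ i, R(e_i, ·) h e_i`. -/
def curvAction (h : EndField n M) : EndField n M :=
  fun x v ↦ ∑ i, curv x (frame x i) v (h x (frame x i))

/-- The coupled exterior differential `(d_∇ h)(X, Y) = (∇_X h) Y - (∇_Y h) X`. -/
def dNabla (h : EndField n M) : BiField n M := fun x u v ↦ nablaEnd h x u v - nablaEnd h x v u

/-- The divergence `δ h = -∑ i, (∇_{e_i} h) e_i`, as a vector field. -/
def divEnd (h : EndField n M) : VField n M :=
  fun x ↦ -∑ i, nablaEnd h x (frame x i) (frame x i)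

/-- The divergence `(δ α)(X) = -∑ i, (∇_{e_i} α)(e_i, X)` of a `TM`-valued `2`-form. -/
def divForm (α : BiField n M) : EndField n M :=
  fun x v ↦ -∑ i, nablaBi α x (frame x i) (frame x i) v

/-- The rough Laplacian `∇^*∇ h = -∑ i, ∇²_{e_i, e_i} h`. -/
def roughLaplacian (h : EndField n M) : EndField n M :=
  fun x v ↦ -∑ i, nablaBi (nablaEnd h) x (frame x i) (frame x i) v

/-- The Einstein operator `Δ_E = ∇^*∇ - 2 R̊`. -/
def einsteinOp (h : EndField n M) : EndField n M :=
  roughLaplacian h - (2 : ℝ) • curvAction h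

/-- `δ^* ξ`, the symmetric part of `∇ ξ`. -/
def deltaStar (ξ : VField n M) : EndField n M := (1 / 2 : ℝ) • (nabla ξ + transp (nabla ξ))

/-- The exterior derivative of the `1`-form `ξ^♭`, as the skew-symmetric endomorphism `K` with
`g(KX, Y) = dξ^♭(X, Y) = g(∇_X ξ, Y) - g(∇_Y ξ, X)`; thus `∇ ξ = δ^* ξ + (1/2) d ξ`. -/
def extDeriv (ξ : VField n M) : EndField n M := nabla ξ - transp (nabla ξ)

/-- `δ^{*,+}`, the `J`-invariant part of `δ^*`. -/
def deltaStarPlus (J : EndField n M) (ξ : VField n M) : EndField n M := plusPart J (deltaStar ξ)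

/-- `δ^{*,-}`, the `J`-anti-invariant part of `δ^*`. -/
def deltaStarMinus (J : EndField n M) (ξ : VField n M) : EndField n M := minusPart J (deltaStar ξ)

/-- `d^- ξ = (dξ - dξ(J·, J·)) / 2`; in terms of skew-symmetric endomorphisms, `dξ(J·, J·)` is
`-J ∘ dξ ∘ J`. -/
def extDerivMinus (J : EndField n M) (ξ : VField n M) : EndField n M := minusPart J (extDeriv ξ)

/-- `∂̄ h = (d_∇ h - d_∇ h(J·, J·)) / 2`. -/
def dbar (J h : EndField n M) : BiField n M :=
  fun x u v ↦ (1 / 2 : ℝ) • (dNabla h x u v - dNabla h x (J x u) (J x v))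

/-- The second-order operator
`𝐃 h = {R̊ h + δ^{*,-} δ h, h} - (Δ_E / 2 - R̊) h² + δ^{*,+} (2 δ h² + (1/2) d tr h² - 2 h δ h)
  + (1/2) [h, d^- δ h]`. -/
def bfD (J h : EndField n M) : EndField n M :=
  anticomm (curvAction h + deltaStarMinus J (divEnd h)) h
    - ((1 / 2 : ℝ) • einsteinOp (comp h h) - curvAction (comp h h))
    + deltaStarPlus J (((2 : ℝ) • divEnd (comp h h) + (1 / 2 : ℝ) • gradient (trace (comp h h)))
        - (2 : ℝ) • applyField h (divEnd h))
    + (1 / 2 : ℝ) • comm h (extDerivMinus J (divEnd h))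

/-! ### Integration and `L²` products -/

/-- The pointwise inner product `tr(Aᵀ B)` of endomorphisms. -/
def innerEnd (A B : EndField n M) (x : M) : ℝ := ∑ i, inner ℝ (A x (frame x i)) (B x (frame x i))

/-- The pointwise inner product of `TM`-valued `2`-forms. -/
def innerForm (α β : BiField n M) (x : M) : ℝ :=
  (1 / 2) * ∑ i, ∑ j,
    inner ℝ (α x (frame x i) (frame x j)) (β x (frame x i) (frame x j))

/-- The density `√(det g_{ij})` of the Riemannian volume in the preferred chart at `p`, at the
point `y` of the target of that chart. -/
def chartDensity (p : M) (y : EuclideanSpace ℝ (Fin n)) : ℝ :=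
  let q : M := (extChartAt (𝓡 n) p).symm y
  let coordField : Fin n → TangentSpace (𝓡 n) q := fun i ↦
    mfderiv (𝓡 n) (𝓡 n) (extChartAt (𝓡 n) p).symm y (EuclideanSpace.single i (1 : ℝ))
  Real.sqrt (Matrix.det (Matrix.of fun i j : Fin n ↦ inner ℝ (coordField i) (coordField j)))

variable [SigmaCompactSpace M] [T2Space M]

variable (n) in
/-- The integral of `f` against the Riemannian volume: in charts, by a partition of unity. -/
def integralVol (f : M → ℝ) : ℝ :=
  ∑ᶠ p : M, ∫ y in (extChartAt (𝓡 n) p).target,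
    chartPartition n M p ((extChartAt (𝓡 n) p).symm y) * f ((extChartAt (𝓡 n) p).symm y)
      * chartDensity p y

/-- The `L²` inner product of sections of `End(TM)`. -/
def l2End (A B : EndField n M) : ℝ := integralVol n (innerEnd A B)

/-- The `L²` inner product of `TM`-valued `2`-forms. -/
def l2Form (α β : BiField n M) : ℝ := integralVol n (innerForm α β)

end Metric

end KaehlerEinstein

end

set_option linter.unusedSectionVars false

noncomputable section

namespace KaehlerEinstein

open Filter Topology VectorField

/-! ### Contractions over an orthonormal basis -/

section Contraction

variable {V : Type*} [NormedAddCommGroup V] [InnerProductSpace ℝ V] {ι κ : Type*} [Fintype ι]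
  [Fintype κ] (e : OrthonormalBasis ι ℝ V)

/-! The identity is a Weitzenböck formula. It holds pointwise up to the divergences of six explicit
vector fields (`innerForm_sharp_dNabla`), and these integrate to zero on a compact manifold
(`integralVol_trace_nabla`).

Write A = ∇h and B = ∇H. Because each A_u anticommutes with J, ∂̄h is the alternation of the
(0,1)-part C(u, v) = (A_u v + J A_{Ju} v)/2 of A. Expanding the quadratic expressions in A and C
(`sum_sharp_dbar`) shows that ⟨H♯d_∇h, d_∇h⟩ and 2⟨H♯∂̄h, ∂̄h⟩ differ by three quadratic sums: T = ∑
g(A_i e_j, A_j H e_i), with coefficient 2, and the two J-twisted sums X = ∑ g(A_i e_j, J A_{JH e_i}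
e_j) and X' = ∑ g(A_j e_i, J A_{J e_j} H e_i).

Each sum is integrated by parts, which moves one derivative off h. - In X the second derivative ∇²h
is contracted with JH. Since H commutes with J this is skew, so only the curvature part of ∇²h
survives; Bianchi and the J-invariance of R turn it into 2⟨R̊(h²), H⟩ (`sum_D_JH`). - In X' the
contraction is with J, and ∑ R(J e_i, e_i) = -2E J yields 2E⟨h, hH⟩ (`sum_D_J`). - In T the Ricci
identity exchanges the two derivatives and produces ∇δh, R̊h and another multiple of E⟨h, hH⟩
(`sum_D_sub_sum_D`). The two E-terms cancel.

The first-order remainders contain B. Those not contracted to δH, together with a term from the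
divergence that produces ∇^*∇h², assemble into the pairing of h ∘ ∂̄h with B, that is, into ⟨δ(h ∘
∂̄h), H⟩ (`sum_dbar_B`). Those containing δH assemble into ⟨∂̄h, δH ∧ h⟩ (`sum_dbar_wedge`),
provided that the one-form 2δh² + ½ d tr h² - 2hδh is paired with δH; this is the origin of the
δ^{*,+}-term in 𝐃. The anticommutator with δ^{*,-}δh and the commutator with d^-δh together are the
pairing of ∇δh with hH (`sum_anticomm_add_comm`).

The analytic background is derived from the Koszul formula: the Levi-Civita connection,
tensoriality, the curvature symmetries, the Ricci identity, and the divergence theorem through the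
coordinate formula div V √det g = ∑ ∂_k(√det g V^k). -/

/-- Expanding e in f and using Parseval for the coefficients leaves the diagonal terms. This lets
the arbitrary pointwise choice `frame` be traded for a smooth local frame wherever derivatives are
taken. -/
theorem sum_eq_of_isBilinearMap (f : OrthonormalBasis κ ℝ V) {W : Type*} [AddCommGroup W]
    [Module ℝ W] {Φ : V → V → W} (hΦ : IsBilinearMap ℝ Φ) :
    ∑ i, Φ (e i) (e i) = ∑ j, Φ (f j) (f j) := by
  have h1 : ∀ i, Φ (e i) (e i) = ∑ j, ∑ k, (inner ℝ (f j) (e i) * inner ℝ (e i) (f k)) •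
      Φ (f j) (f k) := by
    intro i
    have : hΦ.toLinearMap (e i) (e i)
        = hΦ.toLinearMap (∑ j, inner ℝ (f j) (e i) • f j) (∑ j, inner ℝ (f j) (e i) • f j) := by
      rw [f.sum_repr']
    simp only [map_sum, map_smul, LinearMap.sum_apply, LinearMap.smul_apply] at this
    refine this.trans ?_
    simp only [Finset.smul_sum, smul_smul]
    rw [Finset.sum_comm]
    refine Finset.sum_congr rfl fun j _ ↦ Finset.sum_congr rfl fun k _ ↦ ?_
    rw [real_inner_comm (f k) (e i), mul_comm]
    rfl
  simp_rw [h1]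
  rw [Finset.sum_comm]
  refine Finset.sum_congr rfl fun j _ ↦ ?_
  rw [Finset.sum_comm]
  classical
  simp_rw [← Finset.sum_smul, e.sum_inner_mul_inner, orthonormal_iff_ite.1 f.orthonormal]
  simp

/-- An adjoint pair can be moved through a contraction. -/
theorem sum_adjoint {W : Type*} [AddCommGroup W] [Module ℝ W] {Φ : V → V → W}
    (hΦ : IsBilinearMap ℝ Φ) {S T : V → V}
    (hST : ∀ u v, inner ℝ (S u) v = inner ℝ u (T v)) :
    ∑ i, Φ (S (e i)) (e i) = ∑ i, Φ (e i) (T (e i)) := by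
  have h1 : ∀ i, Φ (S (e i)) (e i) = ∑ j, inner ℝ (e j) (S (e i)) • Φ (e j) (e i) := by
    intro i
    have : hΦ.toLinearMap (S (e i)) (e i)
        = hΦ.toLinearMap (∑ j, inner ℝ (e j) (S (e i)) • e j) (e i) := by
      rw [e.sum_repr']
    simp only [map_sum, map_smul, LinearMap.sum_apply, LinearMap.smul_apply] at this
    exact this
  have h2 : ∀ i, Φ (e i) (T (e i)) = ∑ j, inner ℝ (e j) (T (e i)) • Φ (e i) (e j) := by
    intro i
    have : hΦ.toLinearMap (e i) (T (e i))
        = hΦ.toLinearMap (e i) (∑ j, inner ℝ (e j) (T (e i)) • e j) := by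
      rw [e.sum_repr']
    simp only [map_sum, map_smul] at this
    exact this
  simp_rw [h1, h2]
  rw [Finset.sum_comm]
  refine Finset.sum_congr rfl fun j _ ↦ Finset.sum_congr rfl fun k _ ↦ ?_
  rw [← hST, real_inner_comm]

theorem sum_symm {W : Type*} [AddCommGroup W] [Module ℝ W] {Φ : V → V → W}
    (hΦ : IsBilinearMap ℝ Φ) {S : V → V} (hS : ∀ u v, inner ℝ (S u) v = inner ℝ u (S v)) :
    ∑ i, Φ (S (e i)) (e i) = ∑ i, Φ (e i) (S (e i)) := sum_adjoint e hΦ hS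

theorem sum_inner_smul_eq {W : Type*} [AddCommGroup W] [Module ℝ W] (f : V →ₗ[ℝ] W) (v : V) :
    ∑ i, inner ℝ v (e i) • f (e i) = f v := by
  conv_rhs => rw [← e.sum_repr' v]
  simp only [map_sum, map_smul]
  simp_rw [real_inner_comm v]

/-- By skewness the two slots of H♯α contribute equally, which absorbs the factor 1/2 of the inner
product on forms. -/
theorem sum_inner_add_sharp (H : V → V) {α : V → V → V} (hα' : ∀ u v, α u v = -α v u) :
    (1 / 2) * ∑ i, ∑ j, inner ℝ (α (H (e i)) (e j) + α (e i) (H (e j))) (α (e i) (e j))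
      = ∑ i, ∑ j, inner ℝ (α (H (e i)) (e j)) (α (e i) (e j)) := by
  simp_rw [inner_add_left, Finset.sum_add_distrib]
  have : ∑ i, ∑ j, inner ℝ (α (e i) (H (e j))) (α (e i) (e j))
      = ∑ i, ∑ j, inner ℝ (α (H (e i)) (e j)) (α (e i) (e j)) := by
    rw [Finset.sum_comm]
    refine Finset.sum_congr rfl fun i _ ↦ Finset.sum_congr rfl fun j _ ↦ ?_
    rw [hα', hα' (e j), inner_neg_neg]
  rw [this]
  ring

end Contraction

/-- The algebraic relations between the values at a point of a Kähler structure `J`, sections `h`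
and `H` of `Sym^{2,-} TM` and `Sym^{2,+} TM`, the derivatives `A = ∇h`, `B = ∇H`, `D = ∇²h` and
the curvature `R` of an Einstein metric with Einstein constant `E`. -/
structure KaehlerJet {V : Type*} [NormedAddCommGroup V] [InnerProductSpace ℝ V] {ι : Type*}
    [Fintype ι] (e : OrthonormalBasis ι ℝ V) (E : ℝ) (J h H : V →ₗ[ℝ] V)
    (A B : V →ₗ[ℝ] V →ₗ[ℝ] V) (D R : V →ₗ[ℝ] V →ₗ[ℝ] V →ₗ[ℝ] V) : Prop where
  J_sq : ∀ v, J (J v) = -v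
  J_skew : ∀ u v, inner ℝ (J u) v = -inner ℝ u (J v)
  h_symm : ∀ u v, inner ℝ (h u) v = inner ℝ u (h v)
  H_symm : ∀ u v, inner ℝ (H u) v = inner ℝ u (H v)
  h_J : ∀ v, h (J v) = -J (h v)
  H_J : ∀ v, H (J v) = J (H v)
  A_symm : ∀ u v w, inner ℝ (A u v) w = inner ℝ v (A u w)
  B_symm : ∀ u v w, inner ℝ (B u v) w = inner ℝ v (B u w)
  A_J : ∀ u v, A u (J v) = -J (A u v)
  B_J : ∀ u v, B u (J v) = J (B u v)
  ricci_identity : ∀ u v w, D v u w - D u v w = R u v (h w) - h (R u v w)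
  R_skew : ∀ u v w, R u v w = -R v u w
  R_metric : ∀ u v w z, inner ℝ (R u v w) z = -inner ℝ w (R u v z)
  R_bianchi : ∀ u v w, R u v w + R v w u + R w u v = 0
  R_J : ∀ u v w, R u v (J w) = J (R u v w)
  einstein : ∀ v, ∑ i, R (e i) v (e i) = E • v

/-! ### Pointwise algebra of a Kähler–Einstein jet -/

namespace KaehlerJet

variable {V : Type*} [NormedAddCommGroup V] [InnerProductSpace ℝ V] {ι : Type*}
    [Fintype ι] {e : OrthonormalBasis ι ℝ V} {E : ℝ} {J h H : V →ₗ[ℝ] V}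
    {A B : V →ₗ[ℝ] V →ₗ[ℝ] V} {D R : V →ₗ[ℝ] V →ₗ[ℝ] V →ₗ[ℝ] V}

/-- The vectors J eᵢ form another orthonormal basis. Almost every cancellation below comes from this
rotation of the frame combined with the way J passes through h, H, A, B and R. -/
theorem sum_J (K : KaehlerJet e E J h H A B D R) {W : Type*} [AddCommGroup W] [Module ℝ W]
    {Φ : V → V → W} (hΦ : IsBilinearMap ℝ Φ) :
    ∑ i, Φ (J (e i)) (J (e i)) = ∑ i, Φ (e i) (e i) := by
  have hΨ : IsBilinearMap ℝ fun u v ↦ Φ u (J v) := by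
    constructor <;> intros <;>
      simp [hΦ.add_left, hΦ.add_right, hΦ.smul_left, hΦ.smul_right]
  refine (sum_adjoint e hΨ (S := J) (T := fun v ↦ -J v) fun u v ↦ ?_).trans ?_
  · rw [inner_neg_right, K.J_skew]
  · simp [K.J_sq]

/-- The octahedron argument: the four Bianchi sums that omit one vector in turn from the last slot
are combined with skewness in each pair. -/
theorem R_pair (K : KaehlerJet e E J h H A B D R) (x y z w : V) :
    inner ℝ (R x y z) w = inner ℝ (R z w x) y := by
  have h1 : ∀ x y z w, inner ℝ (R x y z) w + inner ℝ (R y z x) w + inner ℝ (R z x y) w = 0 := by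
    intro x y z w
    rw [← inner_add_left, ← inner_add_left, K.R_bianchi, inner_zero_left]
  have h2 : ∀ x y z w, inner ℝ (R x y z) w = -inner ℝ (R x y w) z := by
    intro x y z w
    rw [K.R_metric, real_inner_comm]
  have h3 : ∀ x y z w, inner ℝ (R x y z) w = -inner ℝ (R y x z) w := by
    intro x y z w
    rw [K.R_skew, inner_neg_left]
  have e1 := h1 x y z w
  have e2 := h1 y z w x
  have e3 := h1 z w x y
  have e4 := h1 w x y z
  have a1 := h2 x y z w
  have a2 := h2 y z x w
  have a3 := h2 z x y w
  have a4 := h2 y z w x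
  have a5 := h2 z w y x
  have a6 := h2 w y z x
  have a7 := h2 z w x y
  have a8 := h2 w x z y
  have a9 := h2 x z w y
  have a10 := h2 w x y z
  have a11 := h2 x y w z
  have a12 := h2 y w x z
  have b1 := h3 x z w y
  have b2 := h3 w y z x
  have b3 := h3 x z y w
  have b4 := h3 y w x z
  have b5 := h3 z x w y
  linarith

/-- `∑ i k, g(J R(J H eᵢ, eᵢ) eₖ, h² eₖ) = 2 ∑ k, g(R̊(h²) eₖ, H eₖ)`. -/
theorem sum_R_JH (K : KaehlerJet e E J h H A B D R) :
    ∑ i, ∑ k, inner ℝ (J (R (J (H (e i))) (e i) (e k))) (h (h (e k)))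
      = 2 * ∑ k, ∑ i, inner ℝ (R (e i) (e k) (h (h (e i)))) (H (e k)) := by
  have hb : ∀ i k, inner ℝ (J (R (J (H (e i))) (e i) (e k))) (h (h (e k)))
      = -inner ℝ (J (R (e i) (e k) (J (H (e i))))) (h (h (e k)))
        - inner ℝ (J (R (e k) (J (H (e i))) (e i))) (h (h (e k))) := by
    -- Bianchi splits R(JHeᵢ, eᵢ)eₖ into two terms; they turn out to contribute equally, which
    -- explains the factor 2.
    intro i k
    have := K.R_bianchi (J (H (e i))) (e i) (e k)
    rw [eq_neg_of_add_eq_zero_left ((add_assoc _ _ _).symm.trans this)]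
    simp only [map_neg, map_add, inner_neg_left, inner_add_left]
    ring
  have hswap : ∑ i, ∑ k, inner ℝ (R (e i) (e k) (H (e i))) (h (h (e k)))
      = ∑ k, ∑ i, inner ℝ (R (e i) (e k) (h (h (e i)))) (H (e k)) := by
    refine Finset.sum_congr rfl fun i _ ↦ Finset.sum_congr rfl fun k _ ↦ ?_
    rw [K.R_metric, K.R_skew, inner_neg_right, neg_neg, real_inner_comm]
  have h1 : ∀ i k, inner ℝ (J (R (e i) (e k) (J (H (e i))))) (h (h (e k)))
      = -inner ℝ (R (e i) (e k) (H (e i))) (h (h (e k))) := by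
    intro i k
    rw [K.R_J, K.J_sq, inner_neg_left]
  have h2 : ∀ k, ∑ i, inner ℝ (J (R (e k) (J (H (e i))) (e i))) (h (h (e k)))
      = -∑ i, inner ℝ (R (e i) (e k) (H (e i))) (h (h (e k))) := by
    intro k
    -- H moves to the last slot by symmetry; rotating the frame by J then removes both occurrences
    -- of J.
    have hΦ : IsBilinearMap ℝ fun u v ↦ inner ℝ (J (R (e k) (J u) v)) (h (h (e k))) := by
      constructor <;> intros <;> simp [inner_add_left, real_inner_smul_left]
    have hΨ : IsBilinearMap ℝ fun u v ↦ inner ℝ (J (R (e k) (J u) (H v))) (h (h (e k))) := by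
      constructor <;> intros <;> simp [inner_add_left, real_inner_smul_left]
    rw [sum_symm e hΦ K.H_symm, ← K.sum_J hΨ, ← Finset.sum_neg_distrib]
    refine Finset.sum_congr rfl fun i _ ↦ ?_
    rw [K.J_sq, K.H_J, K.R_J, K.J_sq, K.R_skew]
    simp
  simp_rw [hb, h1, Finset.sum_sub_distrib, neg_neg]
  rw [Finset.sum_comm (f := fun i k ↦ inner ℝ (J (R (e k) (J (H (e i))) (e i))) (h (h (e k))))]
  simp_rw [h2]
  rw [Finset.sum_neg_distrib, Finset.sum_comm (γ := ι) (f := fun k i ↦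
    inner ℝ (R (e i) (e k) (H (e i))) (h (h (e k)))), hswap]
  ring

theorem inner_J_J (K : KaehlerJet e E J h H A B D R) (u v : V) :
    inner ℝ (J u) (J v) = inner ℝ u v := by
  rw [K.J_skew, K.J_sq, inner_neg_right, neg_neg]

/-- `∑ i, R(J eᵢ, eᵢ) = -2 E J`. -/
theorem sum_R_J (K : KaehlerJet e E J h H A B D R) (v : V) :
    ∑ i, R (J (e i)) (e i) v = -(2 * E) • J v := by
  have h1 : ∑ i, R (e i) v (J (e i)) = E • J v := by
    simp_rw [K.R_J, ← map_sum, K.einstein, map_smul]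
  have hΦ : IsBilinearMap ℝ fun u w ↦ R v (J u) w := by
    constructor <;> intros <;> simp
  have h2 : ∑ i, R v (J (e i)) (e i) = E • J v := by
    rw [← K.sum_J hΦ, ← h1]
    refine Finset.sum_congr rfl fun i _ ↦ ?_
    rw [K.J_sq, K.R_skew]
    simp
  have h3 : ∀ i, R (J (e i)) (e i) v = -R (e i) v (J (e i)) - R v (J (e i)) (e i) := by
    intro i
    have := K.R_bianchi (J (e i)) (e i) v
    rw [eq_neg_of_add_eq_zero_left ((add_assoc _ _ _).symm.trans this)]
    abel
  simp_rw [h3, Finset.sum_sub_distrib, Finset.sum_neg_distrib, h1, h2]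
  module

/-- Pair symmetry of R exchanges u and v at the cost of moving h to the other contracted slot, which
its symmetry permits. -/
theorem curvAction_symm (K : KaehlerJet e E J h H A B D R) (u v : V) :
    inner ℝ (∑ i, R (e i) u (h (e i))) v = inner ℝ u (∑ i, R (e i) v (h (e i))) := by
  have hΦ : IsBilinearMap ℝ fun a b ↦ inner ℝ (R a v b) u := by
    constructor <;> intros <;> simp [inner_add_left, real_inner_smul_left]
  rw [real_inner_comm _ u, sum_inner, sum_inner, ← sum_symm e hΦ K.h_symm]
  exact Finset.sum_congr rfl fun i _ ↦ K.R_pair _ _ _ _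

/-- A contraction of the second derivative against `J H` is a curvature term. -/
theorem sum_D_JH (K : KaehlerJet e E J h H A B D R) :
    ∑ i, ∑ k, inner ℝ (h (J (D (e i) (J (H (e i))) (e k)))) (e k)
      = 2 * ∑ k, ∑ i, inner ℝ (R (e i) (e k) (h (h (e i)))) (H (e k)) := by
  rw [← K.sum_R_JH]
  have hΦ : IsBilinearMap ℝ fun u v ↦ ∑ k, inner ℝ (h (J (D u v (e k)))) (e k) := by
    constructor <;> intros <;>
      simp [inner_add_left, real_inner_smul_left, Finset.sum_add_distrib, Finset.mul_sum]
  -- JH is skew-adjoint, because H is symmetric and commutes with J. The contraction therefore sees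
  -- only the part of D that is skew in its first two slots.
  have h1 : ∑ i, ∑ k, inner ℝ (h (J (D (J (H (e i))) (e i) (e k)))) (e k)
      = -∑ i, ∑ k, inner ℝ (h (J (D (e i) (J (H (e i))) (e k)))) (e k) := by
    rw [sum_adjoint e hΦ (S := fun v ↦ J (H v)) (T := fun v ↦ -J (H v)), ← Finset.sum_neg_distrib]
    · simp
    · intro u v
      rw [K.J_skew, K.H_symm, inner_neg_right, K.H_J]
  -- The two terms of the commutator of R with h give the same trace against hJ, since h is
  -- symmetric and anticommutes with J.
  have h2 : ∀ i, ∑ k, inner ℝ (h (J (D (e i) (J (H (e i))) (e k)))) (e k)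
      - ∑ k, inner ℝ (h (J (D (J (H (e i))) (e i) (e k)))) (e k)
      = 2 * ∑ k, inner ℝ (J (R (J (H (e i))) (e i) (e k))) (h (h (e k))) := by
    intro i
    have hΨ : IsBilinearMap ℝ fun u v ↦ inner ℝ (J (R (J (H (e i))) (e i) u)) (h v) := by
      constructor <;> intros <;> simp [inner_add_left, real_inner_smul_left, inner_add_right,
        real_inner_smul_right]
    have h3 := sum_symm e hΨ K.h_symm
    rw [← Finset.sum_sub_distrib, two_mul]
    nth_rewrite 1 [← h3]
    rw [← Finset.sum_add_distrib]
    refine Finset.sum_congr rfl fun k _ ↦ ?_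
    rw [← inner_sub_left, ← map_sub, ← map_sub, K.ricci_identity, K.h_symm, map_sub,
      inner_sub_left, sub_eq_add_neg, ← K.h_symm _ (h (e k)), ← inner_neg_left, K.h_J]
  have h4 := Finset.sum_congr rfl fun i (_ : i ∈ Finset.univ) ↦ h2 i
  rw [Finset.sum_sub_distrib, h1, ← Finset.mul_sum] at h4
  linarith

/-- Skewness of J again leaves only the commutator of the derivatives. By the Ricci identity it is
the commutator of ∑ R(J eᵢ, eᵢ) = -2E J with h, and its two terms add up because h anticommutes with
J. -/
theorem sum_D_J (K : KaehlerJet e E J h H A B D R) :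
    ∑ i, ∑ k, inner ℝ (H (h (J (D (e i) (J (e i)) (e k))))) (e k)
      = 2 * E * ∑ k, inner ℝ (h (e k)) (h (H (e k))) := by
  have hΦ : IsBilinearMap ℝ fun u v ↦ ∑ k, inner ℝ (H (h (J (D u v (e k))))) (e k) := by
    constructor <;> intros <;>
      simp [inner_add_left, real_inner_smul_left, Finset.sum_add_distrib, Finset.mul_sum]
  have h1 : ∑ i, ∑ k, inner ℝ (H (h (J (D (J (e i)) (e i) (e k))))) (e k)
      = -∑ i, ∑ k, inner ℝ (H (h (J (D (e i) (J (e i)) (e k))))) (e k) := by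
    rw [sum_adjoint e hΦ (S := fun v ↦ J v) (T := fun v ↦ -J v), ← Finset.sum_neg_distrib]
    · simp
    · intro u v
      rw [K.J_skew, inner_neg_right]
  have h2 : ∑ i, ∑ k, inner ℝ (H (h (J (D (e i) (J (e i)) (e k))))) (e k)
      - ∑ i, ∑ k, inner ℝ (H (h (J (D (J (e i)) (e i) (e k))))) (e k)
      = 4 * E * ∑ k, inner ℝ (h (e k)) (h (H (e k))) := by
    rw [← Finset.sum_sub_distrib, Finset.mul_sum]
    simp_rw [← Finset.sum_sub_distrib]
    rw [Finset.sum_comm]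
    refine Finset.sum_congr rfl fun k _ ↦ ?_
    simp_rw [← inner_sub_left, ← map_sub, K.ricci_identity]
    rw [← sum_inner, ← map_sum, ← map_sum, ← map_sum, Finset.sum_sub_distrib, ← map_sum,
      K.sum_R_J, K.sum_R_J, K.H_symm, K.h_symm]
    simp only [map_sub, map_smul, K.h_J, K.J_sq, inner_sub_left, real_inner_smul_left,
      inner_neg_left, map_neg]
    ring
  linarith

/-- The traced Ricci identity: the first curvature term is R̊h, and the second is a Ricci
contraction, hence -E h. -/
theorem sum_D_sub_sum_D (K : KaehlerJet e E J h H A B D R) :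
    ∑ i, ∑ k, inner ℝ (D (e k) (e i) (e i) - D (e i) (e k) (e i)) (h (H (e k)))
      = ∑ k, inner ℝ (∑ i, R (e i) (e k) (h (e i))) (h (H (e k)))
        - E * ∑ k, inner ℝ (h (e k)) (h (H (e k))) := by
  rw [Finset.sum_comm, Finset.mul_sum, ← Finset.sum_sub_distrib]
  refine Finset.sum_congr rfl fun k _ ↦ ?_
  rw [← sum_inner]
  simp_rw [K.ricci_identity]
  rw [Finset.sum_sub_distrib, ← map_sum, K.einstein, map_smul, inner_sub_left,
    real_inner_smul_left]

/-- Symmetry of H identifies the two mixed products. No symmetry of C is used, so this applies both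
to ∇h and to its (0,1)-part. -/
theorem sum_sharp_alternation (K : KaehlerJet e E J h H A B D R) {C : V → V → V}
    (hC : IsBilinearMap ℝ C) :
    ∑ i, ∑ j, inner ℝ (C (H (e i)) (e j) - C (e j) (H (e i))) (C (e i) (e j) - C (e j) (e i))
      = ∑ i, ∑ j, inner ℝ (C (e i) (e j)) (C (H (e i)) (e j))
        - 2 * ∑ i, ∑ j, inner ℝ (C (e i) (e j)) (C (e j) (H (e i)))
        + ∑ i, ∑ j, inner ℝ (C (e j) (e i)) (C (e j) (H (e i))) := by
  have hΦ : IsBilinearMap ℝ fun u v ↦ ∑ j, inner ℝ (C u (e j)) (C (e j) v) := by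
    constructor <;> intros <;>
      simp [hC.add_left, hC.add_right, hC.smul_left, hC.smul_right, inner_add_left,
        real_inner_smul_left, inner_add_right, real_inner_smul_right, Finset.sum_add_distrib,
        Finset.mul_sum]
  have := sum_symm e hΦ K.H_symm
  simp_rw [inner_sub_left, inner_sub_right, Finset.sum_sub_distrib]
  rw [this]
  simp_rw [real_inner_comm]
  ring

/-- The `(0,2)`-part of the derivative, before alternation. -/
theorem sum_sharp_dbar (K : KaehlerJet e E J h H A B D R) :
    2 * ((1 / 2) * ∑ i, ∑ j, inner ℝ
      ((1 / 2 : ℝ) • (A (H (e i)) (e j) - A (e j) (H (e i))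
          - (A (J (H (e i))) (J (e j)) - A (J (e j)) (J (H (e i)))))
        + (1 / 2 : ℝ) • (A (e i) (H (e j)) - A (H (e j)) (e i)
          - (A (J (e i)) (J (H (e j))) - A (J (H (e j))) (J (e i)))))
      ((1 / 2 : ℝ) • (A (e i) (e j) - A (e j) (e i)
          - (A (J (e i)) (J (e j)) - A (J (e j)) (J (e i))))))
      = (1 / 2) * ∑ i, ∑ j, inner ℝ (A (H (e i)) (e j) - A (e j) (H (e i))
          + (A (e i) (H (e j)) - A (H (e j)) (e i))) (A (e i) (e j) - A (e j) (e i))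
        - 2 * ∑ i, ∑ j, inner ℝ (A (e i) (e j)) (A (e j) (H (e i)))
        + ∑ i, ∑ j, inner ℝ (A (e i) (e j)) (J (A (J (H (e i))) (e j)))
        + ∑ i, ∑ j, inner ℝ (A (e j) (e i)) (J (A (J (e j)) (H (e i)))) := by
  have hA : IsBilinearMap ℝ fun u v ↦ A u v := by
    constructor <;> intros <;> simp
  -- The (0,1)-part of A in the direction of differentiation. Since A_u anticommutes with J, -A(Ju,
  -- Jv) = J A(Ju, v), so the alternation of C is ∂̄h.
  set C : V → V → V := fun u v ↦ (1 / 2 : ℝ) • (A u v + J (A (J u) v)) with hCdef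
  have hC : IsBilinearMap ℝ C := by
    constructor <;> intros <;> simp [hCdef] <;> module
  have hβ : ∀ u v, (1 / 2 : ℝ) • (A u v - A v u - (A (J u) (J v) - A (J v) (J u)))
      = C u v - C v u := by
    intro u v
    simp only [hCdef, K.A_J]
    module
  simp_rw [hβ]
  rw [sum_inner_add_sharp e H (α := fun u v ↦ A u v - A v u) (by simp),
    sum_inner_add_sharp e H (α := fun u v ↦ C u v - C v u) (by simp), K.sum_sharp_alternation hA,
    K.sum_sharp_alternation hC]
  -- For the two unmixed products (`e1` to `e4`), rotating the differentiated slot yields one half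
  -- of the untwisted sum and one half of a J-twisted sum.
  have e1 : ∑ i, ∑ j, inner ℝ (J (A (J (e i)) (e j))) (A (H (e i)) (e j))
      = ∑ i, ∑ j, inner ℝ (A (e i) (e j)) (J (A (J (H (e i))) (e j))) := by
    rw [← K.sum_J (Φ := fun u v ↦ ∑ j, inner ℝ (J (A (J u) (e j))) (A (H v) (e j)))]
    · refine Finset.sum_congr rfl fun i _ ↦ Finset.sum_congr rfl fun j _ ↦ ?_
      rw [K.J_sq, K.J_skew, K.H_J]
      simp
    · constructor <;> intros <;>
        simp [inner_add_left, inner_add_right, real_inner_smul_left, real_inner_smul_right,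
          Finset.sum_add_distrib, Finset.mul_sum]
  have e2 : ∑ i, ∑ j, inner ℝ (A (J (e i)) (e j)) (A (J (H (e i))) (e j))
      = ∑ i, ∑ j, inner ℝ (A (e i) (e j)) (A (H (e i)) (e j)) := by
    rw [← K.sum_J (Φ := fun u v ↦ ∑ j, inner ℝ (A u (e j)) (A (H v) (e j)))]
    · simp_rw [K.H_J]
    · constructor <;> intros <;>
        simp [inner_add_left, inner_add_right, real_inner_smul_left, real_inner_smul_right,
          Finset.sum_add_distrib, Finset.mul_sum]
  have e3 : ∑ i, ∑ j, inner ℝ (J (A (J (e j)) (e i))) (A (e j) (H (e i)))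
      = ∑ i, ∑ j, inner ℝ (A (e j) (e i)) (J (A (J (e j)) (H (e i)))) := by
    refine Finset.sum_congr rfl fun i _ ↦ ?_
    rw [← K.sum_J (Φ := fun u v ↦ inner ℝ (J (A (J u) (e i))) (A v (H (e i))))]
    · refine Finset.sum_congr rfl fun j _ ↦ ?_
      rw [K.J_sq, K.J_skew]
      simp
    · constructor <;> intros <;>
        simp [inner_add_left, inner_add_right, real_inner_smul_left, real_inner_smul_right]
  have e4 : ∑ i, ∑ j, inner ℝ (A (J (e j)) (e i)) (A (J (e j)) (H (e i)))
      = ∑ i, ∑ j, inner ℝ (A (e j) (e i)) (A (e j) (H (e i))) := by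
    refine Finset.sum_congr rfl fun i _ ↦ ?_
    rw [← K.sum_J (Φ := fun u v ↦ inner ℝ (A u (e i)) (A v (H (e i))))]
    constructor <;> intros <;>
      simp [inner_add_left, inner_add_right, real_inner_smul_left, real_inner_smul_right]
  -- For the mixed product all four cross terms coincide, so it is not halved. This asymmetry leaves
  -- the extra mixed term with coefficient -2.
  have e5 : ∑ i, ∑ j, inner ℝ (A (e i) (e j)) (J (A (J (e j)) (H (e i))))
      = ∑ i, ∑ j, inner ℝ (A (e i) (e j)) (A (e j) (H (e i))) := by
    refine Finset.sum_congr rfl fun i _ ↦ ?_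
    rw [← K.sum_J (Φ := fun u v ↦ inner ℝ (A (e i) u) (J (A (J v) (H (e i)))))]
    · refine Finset.sum_congr rfl fun j _ ↦ ?_
      rw [K.J_sq, K.A_J]
      simp [K.inner_J_J]
    · constructor <;> intros <;>
        simp [inner_add_left, inner_add_right, real_inner_smul_left, real_inner_smul_right]
  have e6 : ∑ i, ∑ j, inner ℝ (J (A (J (e i)) (e j))) (A (e j) (H (e i)))
      = ∑ i, ∑ j, inner ℝ (A (e i) (e j)) (A (e j) (H (e i))) := by
    rw [← K.sum_J (Φ := fun u v ↦ ∑ j, inner ℝ (J (A (J u) (e j))) (A (e j) (H v)))]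
    · refine Finset.sum_congr rfl fun i _ ↦ Finset.sum_congr rfl fun j _ ↦ ?_
      rw [K.J_sq, K.H_J, K.A_J]
      simp [K.inner_J_J]
    · constructor <;> intros <;>
        simp [inner_add_left, inner_add_right, real_inner_smul_left, real_inner_smul_right,
          Finset.sum_add_distrib, Finset.mul_sum]
  have e7 : ∑ i, ∑ j, inner ℝ (A (J (e i)) (e j)) (A (J (e j)) (H (e i)))
      = ∑ i, ∑ j, inner ℝ (A (e i) (e j)) (A (e j) (H (e i))) := by
    rw [← e6]
    refine Finset.sum_congr rfl fun i _ ↦ ?_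
    rw [← K.sum_J (Φ := fun u v ↦ inner ℝ (A (J (e i)) u) (A (J v) (H (e i))))]
    · refine Finset.sum_congr rfl fun j _ ↦ ?_
      rw [K.J_sq, K.A_J]
      simp
    · constructor <;> intros <;>
        simp [inner_add_left, inner_add_right, real_inner_smul_left, real_inner_smul_right]
  simp only [hCdef, real_inner_smul_left, real_inner_smul_right, inner_add_left, inner_add_right,
    K.inner_J_J, ← Finset.mul_sum, Finset.sum_add_distrib]
  rw [e1, e2, e3, e4, e5, e6, e7]
  ring

/-- Both orders of S and h have the same trace against H, because all three maps are symmetric. -/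
theorem sum_anticomm (K : KaehlerJet e E J h H A B D R) {S : V →ₗ[ℝ] V}
    (hS : ∀ u v, inner ℝ (S u) v = inner ℝ u (S v)) :
    ∑ k, inner ℝ (S (h (e k)) + h (S (e k))) (H (e k))
      = 2 * ∑ k, inner ℝ (S (e k)) (h (H (e k))) := by
  have hΦ : IsBilinearMap ℝ fun u v ↦ inner ℝ (h u) (S v) := by
    constructor <;> intros <;>
      simp [inner_add_left, real_inner_smul_left, inner_add_right, real_inner_smul_right]
  simp_rw [inner_add_left, Finset.sum_add_distrib]
  have h1 : ∑ k, inner ℝ (S (h (e k))) (H (e k)) = ∑ k, inner ℝ (S (e k)) (h (H (e k))) :=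
    (Finset.sum_congr rfl fun k _ ↦ hS _ _).trans ((sum_symm e hΦ K.H_symm).symm.trans
      (Finset.sum_congr rfl fun k _ ↦ real_inner_comm _ _))
  rw [h1]
  simp_rw [K.h_symm]
  ring

/-- The terms `δ^{*,-} ξ` and `d^- ξ` combine to `∇ ξ`. -/
theorem sum_anticomm_add_comm (K : KaehlerJet e E J h H A B D R) (P : V →ₗ[ℝ] V) {T : V → V}
    (hT : ∀ u v, inner ℝ (T u) v = inner ℝ u (P v)) :
    ∑ k, inner ℝ
        ((1 / 2 : ℝ) • ((1 / 2 : ℝ) • (P (h (e k)) + T (h (e k)))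
            + J ((1 / 2 : ℝ) • (P (J (h (e k))) + T (J (h (e k))))))
          + h ((1 / 2 : ℝ) • ((1 / 2 : ℝ) • (P (e k) + T (e k))
            + J ((1 / 2 : ℝ) • (P (J (e k)) + T (J (e k))))))) (H (e k))
      + (1 / 2) * ∑ k, inner ℝ
        (h ((1 / 2 : ℝ) • (P (e k) - T (e k) + J (P (J (e k)) - T (J (e k)))))
          - (1 / 2 : ℝ) • (P (h (e k)) - T (h (e k)) + J (P (J (h (e k))) - T (J (h (e k))))))
        (H (e k))
      = 2 * ∑ k, inner ℝ (P (e k)) (h (H (e k))) := by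
  -- `Q` and `Q'` are the J-anti-invariant parts of P and of its transpose. Then {(Q + Q')/2, h} +
  -- [h, Q - Q']/2 = Q'h + hQ, whose two terms pair equally with H.
  set Q : V → V := fun v ↦ (1 / 2 : ℝ) • (P v + J (P (J v))) with hQ
  set Q' : V → V := fun v ↦ (1 / 2 : ℝ) • (T v + J (T (J v))) with hQ'
  have hQQ : ∀ u v, inner ℝ (Q' u) v = inner ℝ u (Q v) := by
    intro u v
    have : inner ℝ (J (T (J u))) v = inner ℝ u (J (P (J v))) := by
      rw [K.J_skew, hT, K.J_skew, neg_neg]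
    simp only [hQ, hQ', real_inner_smul_left, real_inner_smul_right, inner_add_left,
      inner_add_right, hT u, this]
  have hΦ : IsBilinearMap ℝ fun u v ↦ inner ℝ (h u) (Q v) := by
    constructor <;> intros <;>
      simp [hQ, inner_add_left, real_inner_smul_left, inner_add_right, real_inner_smul_right] <;>
      ring
  have h1 : ∑ k, inner ℝ (Q' (h (e k))) (H (e k)) = ∑ k, inner ℝ (Q (e k)) (h (H (e k))) :=
    (Finset.sum_congr rfl fun k _ ↦ hQQ _ _).trans ((sum_symm e hΦ K.H_symm).symm.trans
      (Finset.sum_congr rfl fun k _ ↦ real_inner_comm _ _))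
  -- hH anticommutes with J, so it pairs only with the anti-invariant part of P, and Q may be
  -- replaced by P.
  have h2 : ∑ k, inner ℝ (J (P (J (e k)))) (h (H (e k)))
      = ∑ k, inner ℝ (P (e k)) (h (H (e k))) := by
    rw [← K.sum_J (Φ := fun u v ↦ inner ℝ (J (P (J u))) (h (H v)))]
    · simp_rw [K.J_sq, K.H_J, K.h_J, map_neg, inner_neg_neg, K.inner_J_J]
    · constructor <;> intros <;>
        simp [inner_add_left, inner_add_right, real_inner_smul_left, real_inner_smul_right]
  have h3 : ∑ k, inner ℝ (Q (e k)) (h (H (e k))) = ∑ k, inner ℝ (P (e k)) (h (H (e k))) := by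
    simp_rw [hQ, real_inner_smul_left, inner_add_left, ← Finset.mul_sum, Finset.sum_add_distrib]
    rw [h2]
    ring
  rw [Finset.mul_sum, ← Finset.sum_add_distrib, ← h3, two_mul]
  nth_rewrite 1 [← h1]
  rw [← Finset.sum_add_distrib]
  refine Finset.sum_congr rfl fun k _ ↦ ?_
  rw [← K.h_symm, ← inner_add_left, ← real_inner_smul_left, ← inner_add_left]
  congr 1
  simp only [hQ, hQ', map_smul, map_add, map_sub]
  module

/-- For fixed i, Ah and hA are transposes of each other, hence have the same trace against the
symmetric map Bᵢ. -/
theorem sum_derivative_sq (K : KaehlerJet e E J h H A B D R) :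
    ∑ i, ∑ k, inner ℝ (B (e i) (A (e i) (h (e k)) + h (A (e i) (e k)))) (e k)
      = 2 * ∑ i, ∑ k, inner ℝ (A (e i) (e k)) (h (B (e i) (e k))) := by
  rw [Finset.mul_sum]
  refine Finset.sum_congr rfl fun i _ ↦ ?_
  have hΦ : IsBilinearMap ℝ fun u v ↦ inner ℝ (h u) (A (e i) v) := by
    constructor <;> intros <;>
      simp [inner_add_left, real_inner_smul_left, inner_add_right, real_inner_smul_right]
  simp_rw [K.B_symm, inner_add_left, Finset.sum_add_distrib]
  have h1 : ∑ k, inner ℝ (A (e i) (h (e k))) (B (e i) (e k))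
      = ∑ k, inner ℝ (A (e i) (e k)) (h (B (e i) (e k))) :=
    (Finset.sum_congr rfl fun k _ ↦ K.A_symm _ _ _).trans
      ((sum_symm e hΦ (K.B_symm (e i))).symm.trans
      (Finset.sum_congr rfl fun k _ ↦ real_inner_comm _ _))
  rw [h1]
  simp_rw [K.h_symm]
  ring

/-- The pairing of `∂̄ h` with `h ∇H`. -/
theorem sum_dbar_B (K : KaehlerJet e E J h H A B D R) :
    2 * ∑ i, ∑ k, inner ℝ (B (e i) (h ((1 / 2 : ℝ) • (A (e i) (e k) - A (e k) (e i)
          - (A (J (e i)) (J (e k)) - A (J (e k)) (J (e i))))))) (e k)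
      = ∑ i, ∑ k, inner ℝ (A (e i) (e k)) (h (B (e i) (e k)))
        - 2 * ∑ i, ∑ k, inner ℝ (A (e k) (e i)) (h (B (e i) (e k)))
        + ∑ i, ∑ k, inner ℝ (J (A (J (e i)) (e k))) (h (B (e i) (e k))) := by
  -- Rotating eₖ absorbs the twisted term into the untwisted one; hence the coefficient 2 on the
  -- right-hand side.
  have h1 : ∑ i, ∑ k, inner ℝ (J (A (J (e k)) (e i))) (h (B (e i) (e k)))
      = ∑ i, ∑ k, inner ℝ (A (e k) (e i)) (h (B (e i) (e k))) := by
    refine Finset.sum_congr rfl fun i _ ↦ ?_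
    rw [← K.sum_J (Φ := fun u v ↦ inner ℝ (J (A (J u) (e i))) (h (B (e i) v)))]
    · simp_rw [K.J_sq, K.B_J, K.h_J, map_neg, LinearMap.neg_apply, map_neg, inner_neg_neg,
        K.inner_J_J]
    · constructor <;> intros <;>
        simp [inner_add_left, inner_add_right, real_inner_smul_left, real_inner_smul_right]
  have h2 : ∀ i k, 2 * inner ℝ (B (e i) (h ((1 / 2 : ℝ) • (A (e i) (e k) - A (e k) (e i)
        - (A (J (e i)) (J (e k)) - A (J (e k)) (J (e i))))))) (e k)
      = inner ℝ (A (e i) (e k)) (h (B (e i) (e k))) - inner ℝ (A (e k) (e i)) (h (B (e i) (e k)))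
        + inner ℝ (J (A (J (e i)) (e k))) (h (B (e i) (e k)))
        - inner ℝ (J (A (J (e k)) (e i))) (h (B (e i) (e k))) := by
    intro i k
    rw [K.B_symm, K.h_symm, real_inner_smul_left, K.A_J, K.A_J]
    simp only [inner_sub_left, inner_neg_left]
    ring
  have h3 := Finset.sum_congr rfl fun i (_ : i ∈ Finset.univ) ↦
    Finset.sum_congr rfl fun k (_ : k ∈ Finset.univ) ↦ h2 i k
  simp only [← Finset.mul_sum, Finset.sum_add_distrib, Finset.sum_sub_distrib] at h3
  rw [h1] at h3
  linarith

/-- The pairing of `∂̄ h` with `δ H ∧ h`. -/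
theorem sum_dbar_wedge (K : KaehlerJet e E J h H A B D R) (d : V) :
    -2 * ((1 / 2) * ∑ i, ∑ j, inner ℝ
        ((1 / 2 : ℝ) • (A (e i) (e j) - A (e j) (e i)
          - (A (J (e i)) (J (e j)) - A (J (e j)) (J (e i)))))
        (inner ℝ (-d) (e i) • h (e j) - inner ℝ (-d) (e j) • h (e i)))
      = ∑ k, inner ℝ (A d (e k)) (h (e k)) - 2 * ∑ i, inner ℝ (A (e i) (h (e i))) d
        + ∑ k, inner ℝ (h (J (A (J d) (e k)))) (e k) := by
  set β : V → V → V := fun u v ↦ (1 / 2 : ℝ) • (A u v - A v u - (A (J u) (J v) - A (J v) (J u)))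
    with hβ
  have h1 : ∀ j, ∑ i, inner ℝ (-d) (e i) • inner ℝ (β (e i) (e j)) (h (e j))
      = inner ℝ (β (-d) (e j)) (h (e j)) := fun j ↦
    sum_inner_smul_eq e
      { toFun := fun u ↦ inner ℝ (β u (e j)) (h (e j))
        map_add' := by intros; simp [hβ, inner_add_left, inner_sub_left, real_inner_smul_left]; ring
        map_smul' := by intros; simp [hβ, inner_sub_left, real_inner_smul_left]; ring } (-d)
  -- The two terms of the wedge product contribute equally because β is skew; summation over the
  -- scalar factor inserts -d into β.
  have h2 : ∑ i, ∑ j, inner ℝ (β (e i) (e j))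
        (inner ℝ (-d) (e i) • h (e j) - inner ℝ (-d) (e j) • h (e i))
      = 2 * ∑ j, inner ℝ (β (-d) (e j)) (h (e j)) := by
    have h3 : ∀ i j, inner ℝ (β (e i) (e j))
          (inner ℝ (-d) (e i) • h (e j) - inner ℝ (-d) (e j) • h (e i))
        = inner ℝ (-d) (e i) • inner ℝ (β (e i) (e j)) (h (e j))
          + inner ℝ (-d) (e j) • inner ℝ (β (e j) (e i)) (h (e i)) := by
      intro i j
      have : β (e j) (e i) = -β (e i) (e j) := by simp only [hβ]; module
      simp only [this, inner_sub_right, inner_neg_left (β (e i) (e j)), real_inner_smul_right,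
        smul_eq_mul]
      ring
    simp_rw [h3, Finset.sum_add_distrib, h1]
    rw [Finset.sum_comm]
    simp_rw [h1]
    ring
  -- Of the two twisted terms only the one differentiated along Jd survives as such; this one is
  -- rotated back, which doubles the divergence-type term.
  have h4 : ∑ k, inner ℝ (J (A (J (e k)) d)) (h (e k)) = ∑ i, inner ℝ (A (e i) (h (e i))) d := by
    rw [← K.sum_J (Φ := fun u v ↦ inner ℝ (J (A (J u) d)) (h v))]
    · simp_rw [K.J_sq, K.h_J, map_neg, LinearMap.neg_apply, map_neg, inner_neg_neg, K.inner_J_J]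
      exact Finset.sum_congr rfl fun i _ ↦ by rw [K.A_symm, real_inner_comm]
    · constructor <;> intros <;>
        simp [inner_add_left, inner_add_right, real_inner_smul_left, real_inner_smul_right]
  have h5 : ∀ k, inner ℝ (β (-d) (e k)) (h (e k))
      = (1 / 2) * (-inner ℝ (A d (e k)) (h (e k)) + inner ℝ (A (e k) (h (e k))) d
        - inner ℝ (h (J (A (J d) (e k)))) (e k) + inner ℝ (J (A (J (e k)) d)) (h (e k))) := by
    intro k
    have : inner ℝ (A (e k) d) (h (e k)) = inner ℝ (A (e k) (h (e k))) d := by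
      rw [K.A_symm, real_inner_comm]
    rw [K.h_symm (J _), ← this]
    simp only [hβ, map_neg, LinearMap.neg_apply, K.A_J, inner_sub_left, inner_neg_left,
      real_inner_smul_left]
    ring
  have h6 := Finset.sum_congr rfl fun k (_ : k ∈ Finset.univ) ↦ h5 k
  simp only [← Finset.mul_sum, Finset.sum_add_distrib, Finset.sum_sub_distrib,
    Finset.sum_neg_distrib, h4] at h6
  rw [h2, h6]
  ring

end KaehlerJet

theorem isManifold_minSmoothness_two {n : ℕ} {M : Type*} [TopologicalSpace M]
    [ChartedSpace (EuclideanSpace ℝ (Fin n)) M] [IsManifold (𝓡 n) ∞ M] :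
    IsManifold (𝓡 n) (minSmoothness ℝ 2) M := by
  rw [minSmoothness_of_isRCLikeNormedField]
  infer_instance

theorem isManifold_minSmoothness_three {n : ℕ} {M : Type*} [TopologicalSpace M]
    [ChartedSpace (EuclideanSpace ℝ (Fin n)) M] [IsManifold (𝓡 n) ∞ M] :
    IsManifold (𝓡 n) (minSmoothness ℝ 3) M := by
  rw [minSmoothness_of_isRCLikeNormedField]
  exact IsManifold.of_le (n := ∞) ENat.LEInfty.out

attribute [local instance] isManifold_minSmoothness_two isManifold_minSmoothness_three

/-! ### Germs of smooth functions and vector fields, and orthonormal frames -/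

section SmoothGerms

variable {n : ℕ} {M : Type*} [TopologicalSpace M] [ChartedSpace (EuclideanSpace ℝ (Fin n)) M]

/-- The function `f` is differentiable at `x`. -/
abbrev DiffFunAt (n : ℕ) {M : Type*} [TopologicalSpace M]
    [ChartedSpace (EuclideanSpace ℝ (Fin n)) M] (f : M → ℝ) (x : M) : Prop :=
  MDifferentiableAt (𝓡 n) 𝓘(ℝ, ℝ) f x

/-- The function `f` is smooth near `x₀`. -/
def SmoothFun (n : ℕ) {M : Type*} [TopologicalSpace M]
    [ChartedSpace (EuclideanSpace ℝ (Fin n)) M] (x₀ : M) (f : M → ℝ) : Prop :=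
  ∀ᶠ x in 𝓝 x₀, ContMDiffAt (𝓡 n) 𝓘(ℝ, ℝ) ∞ f x

namespace SmoothFun

variable {x₀ : M} {f g : M → ℝ}

theorem mdifferentiableAt (hf : SmoothFun n x₀ f) : DiffFunAt n f x₀ :=
  hf.self_of_nhds.mdifferentiableAt (by simp)

theorem contMDiffAt (hf : SmoothFun n x₀ f) : ContMDiffAt (𝓡 n) 𝓘(ℝ, ℝ) ∞ f x₀ := hf.self_of_nhds

theorem eventually (hf : SmoothFun n x₀ f) : ∀ᶠ x in 𝓝 x₀, SmoothFun n x f :=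
  eventually_eventually_nhds.2 hf

theorem congr (hf : SmoothFun n x₀ f) (h : g =ᶠ[𝓝 x₀] f) : SmoothFun n x₀ g := by
  filter_upwards [hf, eventually_eventually_nhds.2 h] with x h1 h2
  exact h1.congr_of_eventuallyEq h2

theorem const (c : ℝ) : SmoothFun n x₀ (fun _ : M ↦ c) :=
  Eventually.of_forall fun _ ↦ contMDiffAt_const

theorem add (hf : SmoothFun n x₀ f) (hg : SmoothFun n x₀ g) : SmoothFun n x₀ (fun x ↦ f x + g x) :=
  hf.mp (hg.mono fun _ h1 h2 ↦ h2.add h1)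

theorem sub (hf : SmoothFun n x₀ f) (hg : SmoothFun n x₀ g) : SmoothFun n x₀ (fun x ↦ f x - g x) :=
  hf.mp (hg.mono fun _ h1 h2 ↦ h2.sub h1)

theorem mul (hf : SmoothFun n x₀ f) (hg : SmoothFun n x₀ g) : SmoothFun n x₀ (fun x ↦ f x * g x) :=
  hf.mp (hg.mono fun _ h1 h2 ↦ h2.mul h1)

theorem sum {ι : Type*} {s : Finset ι} {f : ι → M → ℝ} (hf : ∀ i ∈ s, SmoothFun n x₀ (f i)) :
    SmoothFun n x₀ (fun x ↦ ∑ i ∈ s, f i x) := by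
  filter_upwards [(Finset.eventually_all s).2 hf] with x hx
  exact contMDiffAt_finsetSum hx

end SmoothFun

theorem finiteDimensional_tangentSpace (x : M) : FiniteDimensional ℝ (TangentSpace (𝓡 n) x) :=
  inferInstanceAs (FiniteDimensional ℝ (EuclideanSpace ℝ (Fin n)))

theorem finrank_tangentSpace (x : M) : Module.finrank ℝ (TangentSpace (𝓡 n) x) = n :=
  finrank_euclideanSpace_fin (𝕜 := ℝ) (n := n)

variable [IsManifold (𝓡 n) ∞ M]

/-- The vector field `X` is differentiable at `x`. -/
abbrev DiffVecAt (X : VField n M) (x : M) : Prop :=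
  MDifferentiableAt (𝓡 n) ((𝓡 n).prod 𝓘(ℝ, EuclideanSpace ℝ (Fin n)))
    (fun y ↦ TotalSpace.mk' (EuclideanSpace ℝ (Fin n)) y (X y)) x

/-- The vector field `X` is smooth near `x₀`. -/
def SmoothVec (x₀ : M) (X : VField n M) : Prop :=
  ∀ᶠ x in 𝓝 x₀, ContMDiffAt (𝓡 n) ((𝓡 n).prod 𝓘(ℝ, EuclideanSpace ℝ (Fin n))) ∞
    (fun y ↦ TotalSpace.mk' (EuclideanSpace ℝ (Fin n)) y (X y)) x

theorem smoothVec_extendVec {x : M} (v : TangentSpace (𝓡 n) x) : SmoothVec x (extendVec v) := by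
  set t := trivializationAt (EuclideanSpace ℝ (Fin n)) (TangentSpace (𝓡 n) : M → Type _) x
  filter_upwards [t.open_baseSet.mem_nhds (FiberBundle.mem_baseSet_trivializationAt' x)] with y hy
  rw [t.contMDiffAt_section_iff hy]
  refine contMDiffAt_const (c := (t ⟨x, v⟩).2) |>.congr_of_eventuallyEq ?_
  filter_upwards [t.open_baseSet.mem_nhds hy] with z hz
  simp [extendVec, FiberBundle.extend, t, t.apply_mk_symm hz]

@[simp]
theorem extendVec_self {x : M} (v : TangentSpace (𝓡 n) x) : extendVec v x = v :=
  FiberBundle.extend_apply_self _ v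

namespace SmoothVec

variable {x₀ : M} {X Y : VField n M} {f : M → ℝ}

theorem mdifferentiableAt (hX : SmoothVec x₀ X) : DiffVecAt X x₀ :=
  hX.self_of_nhds.mdifferentiableAt (by simp)

theorem eventually (hX : SmoothVec x₀ X) : ∀ᶠ x in 𝓝 x₀, SmoothVec x X :=
  eventually_eventually_nhds.2 hX

theorem congr (hX : SmoothVec x₀ X) (h : ∀ᶠ x in 𝓝 x₀, Y x = X x) : SmoothVec x₀ Y := by
  filter_upwards [hX, eventually_eventually_nhds.2 h] with x h1 h2
  exact h1.congr_of_eventuallyEq (h2.mono fun y hy ↦ by simp [hy])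

theorem add (hX : SmoothVec x₀ X) (hY : SmoothVec x₀ Y) : SmoothVec x₀ (fun x ↦ X x + Y x) :=
  hX.mp (hY.mono fun _ h1 h2 ↦ h2.add_section h1)

theorem sub (hX : SmoothVec x₀ X) (hY : SmoothVec x₀ Y) : SmoothVec x₀ (fun x ↦ X x - Y x) :=
  hX.mp (hY.mono fun _ h1 h2 ↦ h2.sub_section h1)

theorem neg (hX : SmoothVec x₀ X) : SmoothVec x₀ (fun x ↦ -X x) :=
  hX.mono fun _ h1 ↦ h1.neg_section

theorem smul (hf : SmoothFun n x₀ f) (hX : SmoothVec x₀ X) : SmoothVec x₀ (fun x ↦ f x • X x) :=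
  hf.mp (hX.mono fun _ h1 h2 ↦ h2.smul_section h1)

theorem const_smul (c : ℝ) (hX : SmoothVec x₀ X) : SmoothVec x₀ (fun x ↦ c • X x) :=
  smul (.const c) hX

theorem sum {ι : Type*} {s : Finset ι} {X : ι → VField n M}
    (hX : ∀ i ∈ s, SmoothVec x₀ (X i)) : SmoothVec x₀ (fun x ↦ ∑ i ∈ s, X i x) := by
  filter_upwards [(Finset.eventually_all s).2 hX] with x hx
  exact ContMDiffAt.sum_section hx

theorem lieBracket (hX : SmoothVec x₀ X) (hY : SmoothVec x₀ Y) :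
    SmoothVec x₀ (mlieBracket (𝓡 n) X Y) := by
  filter_upwards [hX, hY] with x h1 h2
  have : IsManifold (𝓡 n) (((⊤ : ℕ∞) : WithTop ℕ∞) + 1) M := inferInstanceAs (IsManifold (𝓡 n) ∞ M)
  exact ContMDiffAt.mlieBracket_vectorField (m := ⊤) (n := ⊤) h1 h2
    (by rw [minSmoothness_of_isRCLikeNormedField]; rfl)

variable [RiemannianBundle (fun x : M ↦ TangentSpace (𝓡 n) x)]
    [IsContMDiffRiemannianBundle (𝓡 n) ∞ (EuclideanSpace ℝ (Fin n))
      (fun x : M ↦ TangentSpace (𝓡 n) x)]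

theorem inner (hX : SmoothVec x₀ X) (hY : SmoothVec x₀ Y) :
    SmoothFun n x₀ (fun x ↦ inner ℝ (X x) (Y x)) :=
  hX.mp (hY.mono fun _ h1 h2 ↦ h2.inner_bundle h1)

end SmoothVec

section Frame

variable [RiemannianBundle (fun x : M ↦ TangentSpace (𝓡 n) x)]
    [IsContMDiffRiemannianBundle (𝓡 n) ∞ (EuclideanSpace ℝ (Fin n))
      (fun x : M ↦ TangentSpace (𝓡 n) x)]

/-- Smooth local orthonormal frames exist. -/
theorem exists_orthonormal_frame (x₀ : M) :
    ∃ e : Fin n → VField n M, (∀ i, SmoothVec x₀ (e i)) ∧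
      ∀ᶠ x in 𝓝 x₀, ∃ b : OrthonormalBasis (Fin n) ℝ (TangentSpace (𝓡 n) x), ∀ i, b i = e i x := by
  set t := trivializationAt (EuclideanSpace ℝ (Fin n)) (TangentSpace (𝓡 n) : M → Type _) x₀
  set F : Fin n → VField n M := t.localFrame (EuclideanSpace.basisFun (Fin n) ℝ).toBasis
  have hF : IsLocalFrameOn (𝓡 n) (EuclideanSpace ℝ (Fin n)) ∞ F t.baseSet :=
    t.isLocalFrameOn_localFrame_baseSet (𝓡 n) ∞ (EuclideanSpace.basisFun (Fin n) ℝ).toBasis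
  have ht : t.baseSet ∈ 𝓝 x₀ :=
    t.open_baseSet.mem_nhds (FiberBundle.mem_baseSet_trivializationAt' x₀)
  have hFs : ∀ i, SmoothVec x₀ (F i) := fun i ↦ by
    filter_upwards [ht] with y hy using hF.contMDiffAt t.open_baseSet hy i
  have hli : ∀ᶠ x in 𝓝 x₀, LinearIndependent ℝ (fun i ↦ F i x) := by
    filter_upwards [ht] with y hy using hF.linearIndependent hy
  have hne : ∀ i, ∀ᶠ x in 𝓝 x₀,
      InnerProductSpace.gramSchmidt ℝ (fun j ↦ F j x) i ≠ 0 := fun i ↦ by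
    filter_upwards [hli] with x hx using InnerProductSpace.gramSchmidt_ne_zero i hx
  -- Strong induction along the Gram–Schmidt recursion. The denominators do not vanish near x₀,
  -- since the coordinate frame stays linearly independent.
  have hG : ∀ i, SmoothVec x₀ (fun x ↦ InnerProductSpace.gramSchmidt ℝ (fun j ↦ F j x) i) := by
    intro i
    induction i using WellFoundedLT.induction with
    | ind i ih =>
      refine ((hFs i).sub (SmoothVec.sum (s := Finset.Iio i)
        (X := fun j x ↦ (inner ℝ (InnerProductSpace.gramSchmidt ℝ (fun j ↦ F j x) j) (F i x)
          / ‖InnerProductSpace.gramSchmidt ℝ (fun j ↦ F j x) j‖ ^ 2)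
            • InnerProductSpace.gramSchmidt ℝ (fun j ↦ F j x) j) fun j hj ↦ ?_)).congr
        (Eventually.of_forall fun x ↦ ?_)
      · have hj' := ih j (Finset.mem_Iio.1 hj)
        refine SmoothVec.smul ?_ hj'
        filter_upwards [hj'.inner (hFs i), hj'.inner hj', hne j] with y h1 h2 h3
        simp_rw [← real_inner_self_eq_norm_sq]
        exact h1.div₀ h2 (by simpa using h3)
      · rw [eq_sub_iff_add_eq]
        exact (InnerProductSpace.gramSchmidt_def'' ℝ (fun j ↦ F j x) i).symm
  refine ⟨fun i x ↦ InnerProductSpace.gramSchmidtNormed ℝ (fun j ↦ F j x) i, fun i ↦ ?_, ?_⟩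
  · refine SmoothVec.smul (X := fun x ↦ InnerProductSpace.gramSchmidt ℝ (fun j ↦ F j x) i)
      (f := fun x ↦ (‖InnerProductSpace.gramSchmidt ℝ (fun j ↦ F j x) i‖)⁻¹) ?_ (hG i)
    filter_upwards [(hG i).inner (hG i), hne i] with y h2 h3
    simp_rw [norm_eq_sqrt_real_inner]
    have h4 : inner ℝ (InnerProductSpace.gramSchmidt ℝ (fun j ↦ F j y) i)
        (InnerProductSpace.gramSchmidt ℝ (fun j ↦ F j y) i) ≠ 0 := by simpa using h3
    have h5 : ContMDiffAt (𝓡 n) 𝓘(ℝ, ℝ) ∞ (fun x ↦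
        √(inner ℝ (InnerProductSpace.gramSchmidt ℝ (fun j ↦ F j x) i)
        (InnerProductSpace.gramSchmidt ℝ (fun j ↦ F j x) i))) y :=
      (Real.contDiffAt_sqrt h4).contMDiffAt.comp y h2
    refine h5.inv₀ ?_
    rw [← norm_eq_sqrt_real_inner]
    simpa using h3
  · filter_upwards [hli] with x hx
    have ho := InnerProductSpace.gramSchmidtNormed_orthonormal hx
    have := finiteDimensional_tangentSpace (n := n) x
    have hsp := ho.linearIndependent.span_eq_top_of_card_eq_finrank'
      (by rw [finrank_tangentSpace, Fintype.card_fin])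
    exact ⟨OrthonormalBasis.mk ho hsp.ge, fun i ↦ by simp⟩

end Frame

end SmoothGerms

/-! ### The Levi-Civita connection from the Koszul formula -/

section Connection

variable {n : ℕ} {M : Type*} [TopologicalSpace M] [ChartedSpace (EuclideanSpace ℝ (Fin n)) M]

theorem mvfderiv_congr {f g : M → ℝ} {x : M} (h : f =ᶠ[𝓝 x] g) (v : TangentSpace (𝓡 n) x) :
    mvfderiv (𝓡 n) f x v = mvfderiv (𝓡 n) g x v :=
  DFunLike.congr_fun (h.mfderiv_eq (I := 𝓡 n) (I' := 𝓘(ℝ, ℝ))) v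

theorem inner_field_comm [RiemannianBundle (fun x : M ↦ TangentSpace (𝓡 n) x)] (X Y : VField n M) :
    (fun y ↦ inner ℝ (X y) (Y y)) = fun y ↦ inner ℝ (Y y) (X y) :=
  funext fun _ ↦ real_inner_comm _ _

variable [IsManifold (𝓡 n) ∞ M]

theorem diffVecAt_extendVec {x : M} (v : TangentSpace (𝓡 n) x) : DiffVecAt (extendVec v) x :=
  (smoothVec_extendVec v).mdifferentiableAt

variable [RiemannianBundle (fun x : M ↦ TangentSpace (𝓡 n) x)]
  [IsContMDiffRiemannianBundle (𝓡 n) ∞ (EuclideanSpace ℝ (Fin n))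
    (fun x : M ↦ TangentSpace (𝓡 n) x)]

theorem DiffVecAt.inner {X Y : VField n M} {x : M} (hX : DiffVecAt X x) (hY : DiffVecAt Y x) :
    DiffFunAt n (fun y ↦ inner ℝ (X y) (Y y)) x :=
  have : IsContMDiffRiemannianBundle (𝓡 n) 1 (EuclideanSpace ℝ (Fin n))
    (fun x : M ↦ TangentSpace (𝓡 n) x) := .of_le (n := ∞) ENat.LEInfty.out
  MDifferentiableAt.inner_bundle hX hY

theorem mvfderiv_inner_smul {X Y : VField n M} {f : M → ℝ} {x : M} (hf : DiffFunAt n f x)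
    (hX : DiffVecAt X x) (hY : DiffVecAt Y x) (v : TangentSpace (𝓡 n) x) :
    mvfderiv (𝓡 n) (fun y ↦ inner ℝ ((f • X) y) (Y y)) x v
      = f x * mvfderiv (𝓡 n) (fun y ↦ inner ℝ (X y) (Y y)) x v
        + mvfderiv (𝓡 n) f x v * inner ℝ (X x) (Y x) := by
  have : (fun y ↦ inner ℝ ((f • X) y) (Y y)) = f * fun y ↦ inner ℝ (X y) (Y y) := by
    ext y
    simp [real_inner_smul_left]
  rw [this, mvfderiv_mul hf (hX.inner hY)]
  simp [mul_comm]

theorem mvfderiv_inner_add {X X' Y : VField n M} {x : M}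
    (hX : DiffVecAt X x) (hX' : DiffVecAt X' x) (hY : DiffVecAt Y x) (v : TangentSpace (𝓡 n) x) :
    mvfderiv (𝓡 n) (fun y ↦ inner ℝ ((X + X') y) (Y y)) x v
      = mvfderiv (𝓡 n) (fun y ↦ inner ℝ (X y) (Y y)) x v
        + mvfderiv (𝓡 n) (fun y ↦ inner ℝ (X' y) (Y y)) x v := by
  have : (fun y ↦ inner ℝ ((X + X') y) (Y y))
      = (fun y ↦ inner ℝ (X y) (Y y)) + fun y ↦ inner ℝ (X' y) (Y y) := by
    ext y
    simp [inner_add_left]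
  rw [this, mvfderiv_add (hX.inner hY) (hX'.inner hY)]
  simp

/-- The derivatives of f in the metric terms cancel those in the brackets. -/
theorem koszul_smul_left {X Y Z : VField n M} {f : M → ℝ} {x : M} (hf : DiffFunAt n f x)
    (hX : DiffVecAt X x) (hY : DiffVecAt Y x) (hZ : DiffVecAt Z x) :
    koszul (f • X) Y Z x = f x * koszul X Y Z x := by
  simp only [koszul, mvfderiv_inner_smul hf hX hZ, mvfderiv_inner_smul hf hX hY]
  simp only [mlieBracket_smul_left hf hX, Pi.smul_apply', map_smul, smul_eq_mul, inner_add_left,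
    real_inner_smul_left, real_inner_smul_right, inner_neg_left, neg_smul]
  ring

theorem koszul_smul_right {X Y Z : VField n M} {f : M → ℝ} {x : M} (hf : DiffFunAt n f x)
    (hX : DiffVecAt X x) (hY : DiffVecAt Y x) (hZ : DiffVecAt Z x) :
    koszul X Y (f • Z) x = f x * koszul X Y Z x := by
  simp only [koszul, inner_field_comm Y (f • Z), inner_field_comm X (f • Z),
    mvfderiv_inner_smul hf hZ hX, mvfderiv_inner_smul hf hZ hY]
  simp only [mlieBracket_smul_right hf hZ, Pi.smul_apply', map_smul,
    smul_eq_mul, inner_add_left, real_inner_smul_left, real_inner_smul_right]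
  rw [inner_field_comm Z X, inner_field_comm Z Y,
    real_inner_comm (Y x) (Z x), real_inner_comm (X x) (Z x)]
  ring

/-- The derivative of f along Z cancels, but the one along X occurs both in X g(Y, Z) and in the
bracket [X, Y]. The resulting factor 2 gives the Leibniz rule. -/
theorem koszul_smul_middle {X Y Z : VField n M} {f : M → ℝ} {x : M} (hf : DiffFunAt n f x)
    (hX : DiffVecAt X x) (hY : DiffVecAt Y x) (hZ : DiffVecAt Z x) :
    koszul X (f • Y) Z x
      = f x * koszul X Y Z x + 2 * (mvfderiv (𝓡 n) f x (X x) * inner ℝ (Y x) (Z x)) := by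
  simp only [koszul, inner_field_comm X (f • Y), mvfderiv_inner_smul hf hY hX,
    mvfderiv_inner_smul hf hY hZ]
  simp only [mlieBracket_smul_right hf hY, mlieBracket_smul_left hf hY,
    Pi.smul_apply', map_smul, smul_eq_mul, inner_add_left, real_inner_smul_left,
    real_inner_smul_right, neg_smul, inner_neg_left]
  rw [inner_field_comm Y X, real_inner_comm (X x) (Y x)]
  ring

theorem koszul_add_left {X X' Y Z : VField n M} {x : M} (hX : DiffVecAt X x)
    (hX' : DiffVecAt X' x) (hY : DiffVecAt Y x) (hZ : DiffVecAt Z x) :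
    koszul (X + X') Y Z x = koszul X Y Z x + koszul X' Y Z x := by
  simp only [koszul, mvfderiv_inner_add hX hX' hZ, mvfderiv_inner_add hX hX' hY]
  simp only [mlieBracket_add_left hX hX', Pi.add_apply, map_add, inner_add_left, inner_add_right]
  ring

theorem koszul_add_right {X Y Z Z' : VField n M} {x : M} (hX : DiffVecAt X x)
    (hY : DiffVecAt Y x) (hZ : DiffVecAt Z x) (hZ' : DiffVecAt Z' x) :
    koszul X Y (Z + Z') x = koszul X Y Z x + koszul X Y Z' x := by
  simp only [koszul, inner_field_comm Y (Z + Z'), inner_field_comm X (Z + Z'),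
    mvfderiv_inner_add hZ hZ' hX, mvfderiv_inner_add hZ hZ' hY]
  simp only [mlieBracket_add_right hZ hZ', Pi.add_apply, map_add, inner_add_left, inner_add_right]
  rw [inner_field_comm Z X, inner_field_comm Z' X, inner_field_comm Z Y, inner_field_comm Z' Y]
  ring

theorem koszul_add_middle {X Y Y' Z : VField n M} {x : M} (hX : DiffVecAt X x)
    (hY : DiffVecAt Y x) (hY' : DiffVecAt Y' x) (hZ : DiffVecAt Z x) :
    koszul X (Y + Y') Z x = koszul X Y Z x + koszul X Y' Z x := by
  simp only [koszul, inner_field_comm X (Y + Y'), mvfderiv_inner_add hY hY' hX,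
    mvfderiv_inner_add hY hY' hZ]
  simp only [mlieBracket_add_left hY hY',
    mlieBracket_add_right hY hY', Pi.add_apply, map_add, inner_add_left, inner_add_right]
  rw [inner_field_comm Y X, inner_field_comm Y' X]
  ring

theorem tensorialAt_koszul_left {Y Z : VField n M} {x : M} (hY : DiffVecAt Y x)
    (hZ : DiffVecAt Z x) :
    TensorialAt (𝓡 n) (EuclideanSpace ℝ (Fin n)) (fun X : VField n M ↦ koszul X Y Z x) x where
  smul hf hX := koszul_smul_left hf hX hY hZ
  add hX hX' := koszul_add_left hX hX' hY hZ

theorem tensorialAt_koszul_right {X Y : VField n M} {x : M} (hX : DiffVecAt X x)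
    (hY : DiffVecAt Y x) :
    TensorialAt (𝓡 n) (EuclideanSpace ℝ (Fin n)) (fun Z : VField n M ↦ koszul X Y Z x) x where
  smul hf hZ := koszul_smul_right hf hX hY hZ
  add hZ hZ' := koszul_add_right hX hY hZ hZ'

/-- The Koszul formula determines `∇_X Y`. -/
theorem inner_nabla {X Y Z : VField n M} {x : M} (hX : DiffVecAt X x) (hY : DiffVecAt Y x)
    (hZ : DiffVecAt Z x) :
    inner ℝ (nabla Y x (X x)) (Z x) = (1 / 2) * koszul X Y Z x := by
  have h1 := tensorialAt_koszul_right (diffVecAt_extendVec (X x)) hY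
  have h2 : ∀ v : TangentSpace (𝓡 n) x, koszul (extendVec (X x)) Y (extendVec v) x
      = TensorialAt.mkHom _ x h1 v := fun v ↦ rfl
  have h3 := sum_inner_smul_eq (frame x) (TensorialAt.mkHom _ x h1).toLinearMap (Z x)
  simp only [nabla, sum_inner, real_inner_smul_left, h2]
  rw [← (tensorialAt_koszul_left hY hZ).pointwise (diffVecAt_extendVec (X x)) hX (by simp),
    ← TensorialAt.mkHom_apply h1 hZ]
  refine Eq.trans ?_ (congrArg (fun t ↦ (1 / 2 : ℝ) * t) h3)
  rw [Finset.mul_sum]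
  refine Finset.sum_congr rfl fun i _ ↦ ?_
  rw [real_inner_comm]
  simp only [ContinuousLinearMap.coe_coe, smul_eq_mul]
  ring

theorem ext_inner_extendVec {x : M} {v w : TangentSpace (𝓡 n) x}
    (h : ∀ Z : VField n M, DiffVecAt Z x → inner ℝ v (Z x) = inner ℝ w (Z x)) : v = w := by
  refine ext_inner_right ℝ fun z ↦ ?_
  simpa using h (extendVec z) (diffVecAt_extendVec z)

theorem nabla_add_right {Y : VField n M} {x : M} (hY : DiffVecAt Y x)
    (u v : TangentSpace (𝓡 n) x) : nabla Y x (u + v) = nabla Y x u + nabla Y x v := by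
  refine ext_inner_extendVec fun Z hZ ↦ ?_
  have h := inner_nabla (mdifferentiableAt_add_section (diffVecAt_extendVec u)
    (diffVecAt_extendVec v)) hY hZ
  rw [koszul_add_left (diffVecAt_extendVec u) (diffVecAt_extendVec v) hY hZ, mul_add,
    ← inner_nabla (diffVecAt_extendVec u) hY hZ, ← inner_nabla (diffVecAt_extendVec v) hY hZ] at h
  simpa [inner_add_left] using h

theorem nabla_smul_right {Y : VField n M} {x : M} (hY : DiffVecAt Y x) (c : ℝ)
    (v : TangentSpace (𝓡 n) x) : nabla Y x (c • v) = c • nabla Y x v := by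
  refine ext_inner_extendVec fun Z hZ ↦ ?_
  have hc : DiffFunAt n (fun _ : M ↦ c) x := mdifferentiableAt_const
  have h := inner_nabla (hc.smul_section (diffVecAt_extendVec v)) hY hZ
  rw [koszul_smul_left hc (diffVecAt_extendVec v) hY hZ, mul_left_comm,
    ← inner_nabla (diffVecAt_extendVec v) hY hZ] at h
  simpa [real_inner_smul_left] using h

theorem nabla_add {Y Y' : VField n M} {x : M} (hY : DiffVecAt Y x) (hY' : DiffVecAt Y' x)
    (v : TangentSpace (𝓡 n) x) :
    nabla (fun y ↦ Y y + Y' y) x v = nabla Y x v + nabla Y' x v := by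
  refine ext_inner_extendVec fun Z hZ ↦ ?_
  have h := inner_nabla (diffVecAt_extendVec v) (mdifferentiableAt_add_section hY hY') hZ
  rw [koszul_add_middle (diffVecAt_extendVec v) hY hY' hZ, mul_add,
    ← inner_nabla (diffVecAt_extendVec v) hY hZ, ← inner_nabla (diffVecAt_extendVec v) hY' hZ,
    ← inner_add_left] at h
  rw [extendVec_self] at h
  exact h

theorem nabla_smul {Y : VField n M} {f : M → ℝ} {x : M} (hf : DiffFunAt n f x)
    (hY : DiffVecAt Y x) (v : TangentSpace (𝓡 n) x) :
    nabla (fun y ↦ f y • Y y) x v = f x • nabla Y x v + mvfderiv (𝓡 n) f x v • Y x := by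
  refine ext_inner_extendVec fun Z hZ ↦ ?_
  have h := inner_nabla (diffVecAt_extendVec v) (hf.smul_section hY) hZ
  rw [koszul_smul_middle hf (diffVecAt_extendVec v) hY hZ, mul_add, mul_left_comm,
    ← inner_nabla (diffVecAt_extendVec v) hY hZ] at h
  rw [inner_add_left, real_inner_smul_left, real_inner_smul_left]
  rw [extendVec_self] at h
  refine Eq.trans h ?_
  ring

/-- Locality follows from the Leibniz rule alone, although Y' is arbitrary away from x. -/
theorem nabla_congr {Y Y' : VField n M} {x : M} (hY : DiffVecAt Y x)
    (h : ∀ᶠ y in 𝓝 x, Y' y = Y y) (v : TangentSpace (𝓡 n) x) : nabla Y' x v = nabla Y x v := by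
  have hY' : DiffVecAt Y' x := hY.congr_of_eventuallyEq (h.mono fun y hy ↦ by simp [hy])
  -- The cutoff need not be smooth: this indicator is 1 near x, so its derivative at x vanishes, and
  -- ψY' = ψY holds everywhere.
  let ψ : M → ℝ := Set.indicator {y | Y' y = Y y} 1
  have hψ : ψ =ᶠ[𝓝 x] fun _ ↦ 1 := h.mono fun y hy ↦ by
    simp [ψ, hy]
  have hψ' : DiffFunAt n ψ x := (mdifferentiableAt_const (c := (1 : ℝ))).congr_of_eventuallyEq hψ
  have hd : mvfderiv (𝓡 n) ψ x v = 0 := by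
    rw [mvfderiv_congr hψ, mvfderiv_const]
    simp
  have h1 := nabla_smul hψ' hY v
  have h2 := nabla_smul hψ' hY' v
  have h3 : (fun y ↦ ψ y • Y' y) = fun y ↦ ψ y • Y y := by
    ext1 y
    by_cases hy : Y' y = Y y
    · rw [hy]
    · simp [ψ, hy]
  rw [h3, h1, hd, hψ.self_of_nhds] at h2
  simpa using h2.symm

/-- Symmetrizing the Koszul expression in Y and Z leaves only twice its first term. -/
theorem nabla_inner {Y Z : VField n M} {x : M} (hY : DiffVecAt Y x) (hZ : DiffVecAt Z x)
    (v : TangentSpace (𝓡 n) x) :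
    mvfderiv (𝓡 n) (fun y ↦ inner ℝ (Y y) (Z y)) x v
      = inner ℝ (nabla Y x v) (Z x) + inner ℝ (Y x) (nabla Z x v) := by
  have h1 := inner_nabla (diffVecAt_extendVec v) hY hZ
  have h2 := inner_nabla (diffVecAt_extendVec v) hZ hY
  rw [real_inner_comm] at h2
  rw [extendVec_self] at h1 h2
  rw [h1, h2]
  simp only [koszul, extendVec_self]
  rw [inner_field_comm Z Y, mlieBracket_swap_apply (V := Z) (W := Y), inner_neg_left]
  ring

/-- Skew-symmetrizing the Koszul expression in X and Y leaves only twice the bracket term. -/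
theorem nabla_torsion {X Y : VField n M} {x : M} (hX : DiffVecAt X x) (hY : DiffVecAt Y x) :
    nabla Y x (X x) - nabla X x (Y x) = mlieBracket (𝓡 n) X Y x := by
  refine ext_inner_extendVec fun Z hZ ↦ ?_
  rw [inner_sub_left, inner_nabla hX hY hZ, inner_nabla hY hX hZ]
  simp only [koszul]
  rw [inner_field_comm Y X, mlieBracket_swap_apply (V := Y) (W := X), inner_neg_left]
  ring

end Connection

/-! ### Covariant derivatives of tensor fields -/

section TensorCalculus

variable {n : ℕ} {M : Type*} [TopologicalSpace M] [ChartedSpace (EuclideanSpace ℝ (Fin n)) M]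
  [IsManifold (𝓡 n) ∞ M] [RiemannianBundle (fun x : M ↦ TangentSpace (𝓡 n) x)]
  [IsContMDiffRiemannianBundle (𝓡 n) ∞ (EuclideanSpace ℝ (Fin n))
    (fun x : M ↦ TangentSpace (𝓡 n) x)]

/-- The derivative of a smooth function along a smooth vector field is smooth. -/
theorem SmoothFun.mvfderiv {f : M → ℝ} {X : VField n M} {x₀ : M} (hf : SmoothFun n x₀ f)
    (hX : SmoothVec x₀ X) : SmoothFun n x₀ (fun x ↦ mvfderiv (𝓡 n) f x (X x)) := by
  obtain ⟨e, he, hb⟩ := exists_orthonormal_frame (n := n) x₀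
  -- The argument needs a unit vector field, so dimension zero is treated separately.
  rcases Nat.eq_zero_or_pos n with h0 | h0
  · refine (SmoothFun.const 0).congr (Eventually.of_forall fun x ↦ ?_)
    have : X x = 0 := by
      have := finiteDimensional_tangentSpace (n := n) x
      have := Module.finrank_zero_iff.1 ((finrank_tangentSpace (n := n) x).trans h0)
      exact Subsingleton.elim _ _
    show _root_.mvfderiv (𝓡 n) f x (X x) = 0
    rw [this, map_zero]
  · have h1 := (hX.lieBracket (SmoothVec.smul hf (he ⟨0, h0⟩))).sub
      (SmoothVec.smul hf (hX.lieBracket (he ⟨0, h0⟩)))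
    refine (h1.inner (he ⟨0, h0⟩)).congr ?_
    filter_upwards [hf.eventually, (he ⟨0, h0⟩).eventually, hb] with x hfx hex ⟨b, hb⟩
    have h2 := mlieBracket_smul_right (V := X) hfx.mdifferentiableAt hex.mdifferentiableAt
    have h3 : inner ℝ (e ⟨0, h0⟩ x) (e ⟨0, h0⟩ x) = 1 := by
      rw [← hb, real_inner_self_eq_norm_sq]
      simp
    change _ = inner ℝ (mlieBracket (𝓡 n) X (f • e ⟨0, h0⟩) x - _) _
    rw [h2, add_sub_cancel_right, real_inner_smul_left, h3, mul_one]

/-- The Lie bracket acts on functions as the commutator. -/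
theorem mvfderiv_mlieBracket {f : M → ℝ} {U V : VField n M} {x : M} (hf : SmoothFun n x f)
    (hU : SmoothVec x U) (hV : SmoothVec x V) :
    mvfderiv (𝓡 n) f x (mlieBracket (𝓡 n) U V x)
      = mvfderiv (𝓡 n) (fun y ↦ mvfderiv (𝓡 n) f y (V y)) x (U x)
        - mvfderiv (𝓡 n) (fun y ↦ mvfderiv (𝓡 n) f y (U y)) x (V x) := by
  obtain ⟨e, he, hb⟩ := exists_orthonormal_frame (n := n) x
  rcases Nat.eq_zero_or_pos n with h0 | h0
  · have hz : ∀ v : TangentSpace (𝓡 n) x, v = 0 := fun v ↦ by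
      have := finiteDimensional_tangentSpace (n := n) x
      have := Module.finrank_zero_iff.1 ((finrank_tangentSpace (n := n) x).trans h0)
      exact Subsingleton.elim _ _
    rw [hz (mlieBracket (𝓡 n) U V x), hz (U x), hz (V x)]
    simp
  · set W := e ⟨0, h0⟩
    have hW : SmoothVec x W := he _
    have hfW : SmoothVec x (f • W) := SmoothVec.smul hf hW
    have key : ∀ {U V : VField n M}, SmoothVec x U → SmoothVec x V →
        mlieBracket (𝓡 n) U (mlieBracket (𝓡 n) V (f • W)) x
          = mvfderiv (𝓡 n) (fun y ↦ mvfderiv (𝓡 n) f y (V y)) x (U x) • W x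
            + mvfderiv (𝓡 n) f x (V x) • mlieBracket (𝓡 n) U W x
            + (mvfderiv (𝓡 n) f x (U x) • mlieBracket (𝓡 n) V W x
            + f x • mlieBracket (𝓡 n) U (mlieBracket (𝓡 n) V W) x) := by
      intro U V hU hV
      have h1 : mlieBracket (𝓡 n) V (f • W) =ᶠ[𝓝 x]
          (fun y ↦ mvfderiv (𝓡 n) f y (V y)) • W + f • mlieBracket (𝓡 n) V W := by
        filter_upwards [hf.eventually, hW.eventually] with y h2 h3
        exact mlieBracket_smul_right h2.mdifferentiableAt h3.mdifferentiableAt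
      have hd := hf.mvfderiv hV
      rw [EventuallyEq.rfl.mlieBracket_vectorField_eq h1,
        mlieBracket_add_right
          (show DiffVecAt ((fun y ↦ mvfderiv (𝓡 n) f y (V y)) • W) x from
            (SmoothVec.smul hd hW).mdifferentiableAt)
          (show DiffVecAt (f • mlieBracket (𝓡 n) V W) x from
            (SmoothVec.smul hf (hV.lieBracket hW)).mdifferentiableAt),
        mlieBracket_smul_right hd.mdifferentiableAt hW.mdifferentiableAt,
        mlieBracket_smul_right hf.mdifferentiableAt (hV.lieBracket hW).mdifferentiableAt]
    have h2 : ∀ {Z : VField n M}, SmoothVec x Z → ContMDiffAt (𝓡 n)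
        ((𝓡 n).prod 𝓘(ℝ, EuclideanSpace ℝ (Fin n))) (minSmoothness ℝ 2)
        (fun y ↦ TotalSpace.mk' (EuclideanSpace ℝ (Fin n)) y (Z y)) x := fun hZ ↦
      hZ.self_of_nhds.of_le (by
        rw [minSmoothness_of_isRCLikeNormedField]; exact ENat.LEInfty.out)
    -- Comparing the Jacobi identity for (U, V, fW) with that for (U, V, W) leaves ([U, V]f - UVf +
    -- VUf) W = 0, and W does not vanish.
    have j1 := leibniz_identity_mlieBracket_apply (h2 hU) (h2 hV) (h2 hfW)
    have j2 := leibniz_identity_mlieBracket_apply (h2 hU) (h2 hV) (h2 hW)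
    rw [key hU hV, key hV hU, mlieBracket_smul_right hf.mdifferentiableAt hW.mdifferentiableAt,
      j2] at j1
    have h3 : (mvfderiv (𝓡 n) f x (mlieBracket (𝓡 n) U V x)
        - (mvfderiv (𝓡 n) (fun y ↦ mvfderiv (𝓡 n) f y (V y)) x (U x)
        - mvfderiv (𝓡 n) (fun y ↦ mvfderiv (𝓡 n) f y (U y)) x (V x))) • W x = 0 := by
      rw [← sub_eq_zero] at j1
      rw [← neg_eq_zero, ← j1]
      module
    obtain ⟨b, hb⟩ := hb.self_of_nhds
    have h4 : W x ≠ 0 := by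
      change e ⟨0, h0⟩ x ≠ 0
      rw [← hb]
      exact b.orthonormal.ne_zero _
    exact sub_eq_zero.1 ((smul_eq_zero.1 h3).resolve_right h4)

theorem SmoothVec.koszul {X Y Z : VField n M} {x₀ : M} (hX : SmoothVec x₀ X)
    (hY : SmoothVec x₀ Y) (hZ : SmoothVec x₀ Z) : SmoothFun n x₀ (koszul X Y Z) :=
  ((((((hY.inner hZ).mvfderiv hX).add ((hX.inner hZ).mvfderiv hY)).sub
    ((hX.inner hY).mvfderiv hZ)).add ((hX.lieBracket hY).inner hZ)).sub
    ((hX.lieBracket hZ).inner hY)).sub ((hY.lieBracket hZ).inner hX)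

/-- `∇_X Y` is smooth. -/
theorem SmoothVec.nabla {X Y : VField n M} {x₀ : M} (hY : SmoothVec x₀ Y)
    (hX : SmoothVec x₀ X) : SmoothVec x₀ (fun x ↦ nabla Y x (X x)) := by
  obtain ⟨e, he, hb⟩ := exists_orthonormal_frame (n := n) x₀
  have h1 : SmoothVec x₀ fun x ↦
      ∑ i, ((1 / 2 : ℝ) * KaehlerEinstein.koszul X Y (e i) x) • e i x :=
    SmoothVec.sum fun i _ ↦ SmoothVec.smul ((SmoothFun.const _).mul (hX.koszul hY (he i))) (he i)
  refine h1.congr ?_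
  filter_upwards [hX.eventually, hY.eventually, eventually_all.2 fun i ↦ (he i).eventually, hb]
    with x hXx hYx hex ⟨b, hb⟩
  rw [← b.sum_repr' (KaehlerEinstein.nabla Y x (X x))]
  refine Finset.sum_congr rfl fun i _ ↦ ?_
  rw [hb, real_inner_comm, inner_nabla hXx.mdifferentiableAt hYx.mdifferentiableAt
    (hex i).mdifferentiableAt]

theorem nabla_zero (x : M) (v : TangentSpace (𝓡 n) x) : nabla (fun _ ↦ 0) x v = 0 := by
  have h : DiffVecAt (extendVec (0 : TangentSpace (𝓡 n) x)) x := diffVecAt_extendVec _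
  have h1 := nabla_smul (mdifferentiableAt_const (c := (0 : ℝ))) h v
  rw [mvfderiv_const] at h1
  simpa using h1

theorem nabla_sum_smul {ι : Type*} {s : Finset ι} {f : ι → M → ℝ} {X : ι → VField n M} {x : M}
    (hf : ∀ i, SmoothFun n x (f i)) (hX : ∀ i, SmoothVec x (X i)) (v : TangentSpace (𝓡 n) x) :
    nabla (fun y ↦ ∑ i ∈ s, f i y • X i y) x v
      = ∑ i ∈ s, (f i x • nabla (X i) x v + mvfderiv (𝓡 n) (f i) x v • X i x) := by
  classical
  induction s using Finset.induction_on with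
  | empty => simpa using nabla_zero x v
  | insert a s ha ih =>
    simp only [Finset.sum_insert ha, ← ih]
    rw [← nabla_smul (hf a).mdifferentiableAt (hX a).mdifferentiableAt]
    exact nabla_add (SmoothVec.smul (hf a) (hX a)).mdifferentiableAt
      (SmoothVec.sum fun i _ ↦ SmoothVec.smul (hf i) (hX i)).mdifferentiableAt v

/-- `A` is, near `x₀`, given by linear maps and maps smooth vector fields to smooth vector
fields. -/
def SmoothEndAt (x₀ : M) (A : EndField n M) : Prop :=
  ∀ᶠ x in 𝓝 x₀, IsLinearMap ℝ (A x) ∧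
    ∀ Y : VField n M, SmoothVec x Y → SmoothVec x (fun y ↦ A y (Y y))

/-- `α` is, near `x₀`, given by bilinear maps and maps pairs of smooth vector fields to smooth
vector fields. -/
def SmoothBiAt (x₀ : M) (α : BiField n M) : Prop :=
  ∀ᶠ x in 𝓝 x₀, IsBilinearMap ℝ (α x) ∧
    ∀ Y Z : VField n M, SmoothVec x Y → SmoothVec x Z → SmoothVec x (fun y ↦ α y (Y y) (Z y))

namespace SmoothEndAt

variable {x : M} {A B : EndField n M} {X Y : VField n M}

theorem eventually (hA : SmoothEndAt x A) : ∀ᶠ y in 𝓝 x, SmoothEndAt y A :=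
  eventually_eventually_nhds.2 hA

theorem isLinearMap (hA : SmoothEndAt x A) : IsLinearMap ℝ (A x) := hA.self_of_nhds.1

theorem apply (hA : SmoothEndAt x A) (hY : SmoothVec x Y) : SmoothVec x (fun y ↦ A y (Y y)) :=
  hA.self_of_nhds.2 Y hY

theorem comp (hA : SmoothEndAt x A) (hB : SmoothEndAt x B) :
    SmoothEndAt x (KaehlerEinstein.comp A B) := by
  filter_upwards [hA, hB] with y h1 h2
  refine ⟨⟨fun u v ↦ ?_, fun d u ↦ ?_⟩, fun Y hY ↦ h1.2 _ (h2.2 Y hY)⟩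
  · simp only [KaehlerEinstein.comp, h1.1.map_add, h2.1.map_add]
  · simp only [KaehlerEinstein.comp, h1.1.map_smul, h2.1.map_smul]

end SmoothEndAt

theorem IsSmoothEnd.smoothEndAt {A : EndField n M} (hA : IsSmoothEnd A) (x : M) :
    SmoothEndAt x A := by
  obtain ⟨A₀, h1, h2⟩ := hA
  refine Eventually.of_forall fun y ↦ ⟨⟨fun u v ↦ by simp [h1], fun c u ↦ by simp [h1]⟩,
    fun Y hY ↦ ?_⟩
  filter_upwards [hY] with z hz
  simp only [h1]
  exact h2.contMDiffAt.clm_bundle_apply hz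

namespace SmoothBiAt

variable {x : M} {α β : BiField n M} {A : EndField n M} {X Y : VField n M}

theorem eventually (hα : SmoothBiAt x α) : ∀ᶠ y in 𝓝 x, SmoothBiAt y α :=
  eventually_eventually_nhds.2 hα

theorem isBilinearMap (hα : SmoothBiAt x α) : IsBilinearMap ℝ (α x) := hα.self_of_nhds.1

theorem apply (hα : SmoothBiAt x α) (hX : SmoothVec x X) (hY : SmoothVec x Y) :
    SmoothVec x (fun y ↦ α y (X y) (Y y)) :=
  hα.self_of_nhds.2 X Y hX hY

theorem congr (hα : SmoothBiAt x α) (h : ∀ᶠ y in 𝓝 x, β y = α y) : SmoothBiAt x β := by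
  filter_upwards [hα, h.eventually_nhds] with y h1 h2
  refine ⟨h2.self_of_nhds ▸ h1.1, fun Y Z hY hZ ↦
    (h1.2 Y Z hY hZ).congr (h2.mono fun z hz ↦ by rw [hz])⟩

theorem add (hα : SmoothBiAt x α) (hβ : SmoothBiAt x β) : SmoothBiAt x (α + β) := by
  filter_upwards [hα, hβ] with y h1 h2
  refine ⟨⟨?_, ?_, ?_, ?_⟩, fun Y Z hY hZ ↦ (h1.2 Y Z hY hZ).add (h2.2 Y Z hY hZ)⟩ <;> intros <;>
    simp only [Pi.add_apply, h1.1.add_left, h2.1.add_left, h1.1.add_right, h2.1.add_right,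
      h1.1.smul_left, h2.1.smul_left, h1.1.smul_right, h2.1.smul_right] <;> module

theorem smul (c : ℝ) (hα : SmoothBiAt x α) : SmoothBiAt x (c • α) := by
  filter_upwards [hα] with y h1
  refine ⟨⟨?_, ?_, ?_, ?_⟩, fun Y Z hY hZ ↦ (h1.2 Y Z hY hZ).const_smul c⟩ <;> intros <;>
    simp only [Pi.smul_apply, h1.1.add_left, h1.1.add_right,
      h1.1.smul_left, h1.1.smul_right] <;> module

theorem sub (hα : SmoothBiAt x α) (hβ : SmoothBiAt x β) : SmoothBiAt x (α - β) :=
  (hα.add (hβ.smul (-1))).congr (Eventually.of_forall fun y ↦ by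
    ext1 v; simp [sub_eq_add_neg])

theorem swap (hα : SmoothBiAt x α) : SmoothBiAt x (fun y u v ↦ α y v u) := by
  filter_upwards [hα] with y h1
  exact ⟨⟨fun _ _ _ ↦ h1.1.add_right _ _ _, fun _ _ _ ↦ h1.1.smul_right _ _ _,
    fun _ _ _ ↦ h1.1.add_left _ _ _, fun _ _ _ ↦ h1.1.smul_left _ _ _⟩,
    fun Y Z hY hZ ↦ h1.2 Z Y hZ hY⟩

theorem compForm (hA : SmoothEndAt x A) (hα : SmoothBiAt x α) :
    SmoothBiAt x (KaehlerEinstein.compForm A α) := by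
  filter_upwards [hα, hA] with y h1 h2
  refine ⟨⟨?_, ?_, ?_, ?_⟩, fun Y Z hY hZ ↦ h2.2 _ (h1.2 Y Z hY hZ)⟩ <;> intros <;>
    simp only [KaehlerEinstein.compForm, h1.1.add_left, h1.1.add_right,
      h1.1.smul_left, h1.1.smul_right, h2.1.map_add, h2.1.map_smul]

theorem precomp (hA : SmoothEndAt x A) (hα : SmoothBiAt x α) :
    SmoothBiAt x (fun y u v ↦ α y (A y u) v) := by
  filter_upwards [hα, hA] with y h1 h2
  refine ⟨⟨?_, ?_, ?_, ?_⟩, fun Y Z hY hZ ↦ h1.2 _ _ (h2.2 Y hY) hZ⟩ <;> intros <;>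
    simp only [h1.1.add_left, h1.1.add_right,
      h1.1.smul_left, h1.1.smul_right, h2.1.map_add, h2.1.map_smul]

theorem applyRight (hα : SmoothBiAt x α) (hY : SmoothVec x Y) :
    SmoothEndAt x (fun y u ↦ α y u (Y y)) := by
  filter_upwards [hα, hY.eventually] with y h1 h2
  exact ⟨⟨fun _ _ ↦ h1.1.add_left _ _ _, fun _ _ ↦ h1.1.smul_left _ _ _⟩,
    fun Z hZ ↦ h1.2 _ _ hZ h2⟩

theorem applyLeft (hα : SmoothBiAt x α) (hY : SmoothVec x Y) :
    SmoothEndAt x (fun y u ↦ α y (Y y) u) := hα.swap.applyRight hY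

end SmoothBiAt

/-- `(∇_u A) v` may be computed with any extension of `v`. -/
theorem nablaEnd_apply {A : EndField n M} {Y : VField n M} {x : M} (hA : SmoothEndAt x A)
    (hY : SmoothVec x Y) (u : TangentSpace (𝓡 n) x) :
    nablaEnd A x u (Y x) = nabla (fun y ↦ A y (Y y)) x u - A x (nabla Y x u) := by
  obtain ⟨e, he, hb⟩ := exists_orthonormal_frame (n := n) x
  -- When Z is expanded in a local frame, the derivatives of its coefficients cancel between the two
  -- terms, so the expression depends only on Z(x).
  have key : ∀ Z : VField n M, SmoothVec x Z →
      nabla (fun y ↦ A y (Z y)) x u - A x (nabla Z x u)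
        = ∑ i, inner ℝ (e i x) (Z x) • (nabla (fun y ↦ A y (e i y)) x u
          - A x (nabla (e i) x u)) := by
    intro Z hZ
    have h1 : ∀ᶠ y in 𝓝 x, Z y = ∑ i, inner ℝ (e i y) (Z y) • e i y := by
      filter_upwards [hb] with y ⟨b, hb⟩
      conv_lhs => rw [← b.sum_repr' (Z y)]
      simp [hb]
    have h2 : ∀ᶠ y in 𝓝 x, A y (Z y) = ∑ i, inner ℝ (e i y) (Z y) • A y (e i y) := by
      filter_upwards [hA, h1] with y h3 h4
      have := congrArg (h3.1.mk' (A y)) h4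
      simp only [map_sum, map_smul] at this
      exact this
    have hf : ∀ i, SmoothFun n x fun y ↦ inner ℝ (e i y) (Z y) := fun i ↦ (he i).inner hZ
    have hAe : ∀ i, SmoothVec x fun y ↦ A y (e i y) := fun i ↦ hA.apply (he i)
    have h3 := nabla_congr (SmoothVec.sum (s := Finset.univ) fun i _ ↦
      SmoothVec.smul (hf i) (he i)).mdifferentiableAt h1 u
    have h4 := nabla_congr (SmoothVec.sum (s := Finset.univ) fun i _ ↦
      SmoothVec.smul (hf i) (hAe i)).mdifferentiableAt h2 u
    rw [nabla_sum_smul hf he] at h3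
    rw [nabla_sum_smul hf hAe] at h4
    rw [h3, h4]
    have h5 : ∀ v, A x v = (hA.isLinearMap.mk' (A x)) v := fun v ↦ rfl
    simp only [h5, map_sum, map_add, map_smul]
    rw [← Finset.sum_sub_distrib]
    refine Finset.sum_congr rfl fun i _ ↦ ?_
    module
  rw [nablaEnd, key Y hY]
  have := key _ (smoothVec_extendVec (Y x))
  rwa [extendVec_self] at this

theorem isBilinearMap_nablaEnd {A : EndField n M} {x : M} (hA : SmoothEndAt x A) :
    IsBilinearMap ℝ (nablaEnd A x) where
  add_left u v w := by
    simp only [nablaEnd]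
    rw [nabla_add_right (hA.apply (smoothVec_extendVec w)).mdifferentiableAt,
      nabla_add_right (diffVecAt_extendVec w), hA.isLinearMap.map_add]
    abel
  smul_left c u w := by
    simp only [nablaEnd]
    rw [nabla_smul_right (hA.apply (smoothVec_extendVec w)).mdifferentiableAt,
      nabla_smul_right (diffVecAt_extendVec w), hA.isLinearMap.map_smul, smul_sub]
  add_right u v w := by
    have h1 := smoothVec_extendVec v
    have h2 := smoothVec_extendVec w
    have h := nablaEnd_apply hA (h1.add h2) u
    rw [extendVec_self, extendVec_self, nabla_add h1.mdifferentiableAt h2.mdifferentiableAt,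
      nabla_congr ((hA.apply h1).add (hA.apply h2)).mdifferentiableAt
        (hA.mono fun y hy ↦ hy.1.map_add _ _),
      nabla_add (hA.apply h1).mdifferentiableAt (hA.apply h2).mdifferentiableAt,
      hA.isLinearMap.map_add] at h
    rw [h]
    simp only [nablaEnd]
    abel
  smul_right c u v := by
    have h1 := smoothVec_extendVec v
    have h := nablaEnd_apply hA (h1.const_smul c) u
    have hc : DiffFunAt n (fun _ : M ↦ c) x := mdifferentiableAt_const
    rw [extendVec_self, nabla_smul hc h1.mdifferentiableAt,
      nabla_congr ((hA.apply h1).const_smul c).mdifferentiableAt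
        (hA.mono fun y hy ↦ hy.1.map_smul _ _),
      nabla_smul hc (hA.apply h1).mdifferentiableAt, mvfderiv_const] at h
    simp only [zero_apply, zero_smul, add_zero] at h
    rw [h, hA.isLinearMap.map_smul, ← smul_sub]
    rfl

theorem SmoothEndAt.nablaEnd {A : EndField n M} {x : M} (hA : SmoothEndAt x A) :
    SmoothBiAt x (nablaEnd A) := by
  filter_upwards [hA.eventually] with y hy
  refine ⟨isBilinearMap_nablaEnd hy, fun X Y hX hY ↦ ?_⟩
  refine (((hy.apply hY).nabla hX).sub (hy.apply (hY.nabla hX))).congr ?_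
  filter_upwards [hy.eventually, hY.eventually] with z h1 h2
  exact nablaEnd_apply h1 h2 _

theorem SmoothVec.smoothEndAt_nabla {Y : VField n M} {x : M} (hY : SmoothVec x Y) :
    SmoothEndAt x (KaehlerEinstein.nabla Y) := by
  filter_upwards [hY.eventually] with y hy
  exact ⟨⟨nabla_add_right hy.mdifferentiableAt, nabla_smul_right hy.mdifferentiableAt⟩,
    fun X hX ↦ hy.nabla hX⟩

/-- Freezing one argument along an extension reduces tensoriality and linearity of ∇α to the case of
endomorphism fields, one slot at a time. -/
theorem nablaBi_eq_nablaEnd_right {α : BiField n M} {x : M}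
    (u v w : TangentSpace (𝓡 n) x) :
    nablaBi α x u v w = nablaEnd (fun y z ↦ α y z (extendVec w y)) x u v
      - α x v (nabla (extendVec w) x u) := by
  simp [nablaBi, nablaEnd]

theorem nablaBi_eq_nablaEnd_left {α : BiField n M} {x : M}
    (u v w : TangentSpace (𝓡 n) x) :
    nablaBi α x u v w = nablaEnd (fun y z ↦ α y (extendVec v y) z) x u w
      - α x (nabla (extendVec v) x u) w := by
  simp only [nablaBi, nablaEnd, extendVec_self]
  abel

/-- `(∇_u α)(v, w)` may be computed with any extensions of `v` and `w`. -/
theorem nablaBi_apply {α : BiField n M} {Y Z : VField n M} {x : M} (hα : SmoothBiAt x α)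
    (hY : SmoothVec x Y) (hZ : SmoothVec x Z) (u : TangentSpace (𝓡 n) x) :
    nablaBi α x u (Y x) (Z x) = nabla (fun y ↦ α y (Y y) (Z y)) x u
      - α x (nabla Y x u) (Z x) - α x (Y x) (nabla Z x u) := by
  have h1 := smoothVec_extendVec (Z x)
  have h2 := nablaEnd_apply (hα.applyRight h1) hY u
  have h3 := nablaEnd_apply (hα.applyLeft hY) hZ u
  have h4 := nablaEnd_apply (hα.applyLeft hY) h1 u
  rw [extendVec_self] at h4 h2
  rw [h4] at h3
  rw [nablaBi_eq_nablaEnd_right, h2, sub_right_comm, h3, sub_right_comm]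

theorem isBilinearMap_nablaBi {α : BiField n M} {x : M} (hα : SmoothBiAt x α)
    (u : TangentSpace (𝓡 n) x) : IsBilinearMap ℝ (nablaBi α x u) where
  add_left v v' w := by
    simp only [nablaBi_eq_nablaEnd_right]
    rw [(isBilinearMap_nablaEnd (hα.applyRight (smoothVec_extendVec w))).add_right,
      hα.isBilinearMap.add_left]
    abel
  smul_left c v w := by
    simp only [nablaBi_eq_nablaEnd_right]
    rw [(isBilinearMap_nablaEnd (hα.applyRight (smoothVec_extendVec w))).smul_right,
      hα.isBilinearMap.smul_left, smul_sub]
  add_right v w w' := by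
    simp only [nablaBi_eq_nablaEnd_left]
    rw [(isBilinearMap_nablaEnd (hα.applyLeft (smoothVec_extendVec v))).add_right,
      hα.isBilinearMap.add_right]
    abel
  smul_right c v w := by
    simp only [nablaBi_eq_nablaEnd_left]
    rw [(isBilinearMap_nablaEnd (hα.applyLeft (smoothVec_extendVec v))).smul_right,
      hα.isBilinearMap.smul_right, smul_sub]

theorem isLinearMap_nablaBi {α : BiField n M} {x : M} (hα : SmoothBiAt x α)
    (v w : TangentSpace (𝓡 n) x) : IsLinearMap ℝ fun u ↦ nablaBi α x u v w where
  map_add u u' := by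
    simp only [nablaBi_eq_nablaEnd_right]
    rw [(isBilinearMap_nablaEnd (hα.applyRight (smoothVec_extendVec w))).add_left,
      nabla_add_right (diffVecAt_extendVec w), hα.isBilinearMap.add_right]
    abel
  map_smul c u := by
    simp only [nablaBi_eq_nablaEnd_right]
    rw [(isBilinearMap_nablaEnd (hα.applyRight (smoothVec_extendVec w))).smul_left,
      nabla_smul_right (diffVecAt_extendVec w), hα.isBilinearMap.smul_right, smul_sub]

/-! ### Product rules -/

theorem nabla_applyField {A : EndField n M} {Y : VField n M} {x : M} (hA : SmoothEndAt x A)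
    (hY : SmoothVec x Y) (u : TangentSpace (𝓡 n) x) :
    nabla (fun y ↦ A y (Y y)) x u = nablaEnd A x u (Y x) + A x (nabla Y x u) := by
  rw [nablaEnd_apply hA hY, sub_add_cancel]

theorem nabla_applyBi {α : BiField n M} {Y Z : VField n M} {x : M} (hα : SmoothBiAt x α)
    (hY : SmoothVec x Y) (hZ : SmoothVec x Z) (u : TangentSpace (𝓡 n) x) :
    nabla (fun y ↦ α y (Y y) (Z y)) x u = nablaBi α x u (Y x) (Z x)
      + α x (nabla Y x u) (Z x) + α x (Y x) (nabla Z x u) := by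
  rw [nablaBi_apply hα hY hZ]
  abel

theorem nablaEnd_comp {A B : EndField n M} {x : M} (hA : SmoothEndAt x A)
    (hB : SmoothEndAt x B) (u v : TangentSpace (𝓡 n) x) :
    nablaEnd (comp A B) x u v = nablaEnd A x u (B x v) + A x (nablaEnd B x u v) := by
  have h1 := smoothVec_extendVec v
  have h2 := nablaEnd_apply (hA.comp hB) h1 u
  simp only [comp] at h2
  rw [nabla_applyField hA (hB.apply h1), nabla_applyField hB h1, hA.isLinearMap.map_add] at h2
  simp only [extendVec_self] at h2
  rw [show nablaEnd (comp A B) x u v = _ from h2]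
  abel

theorem nablaBi_compForm {A : EndField n M} {α : BiField n M} {x : M} (hA : SmoothEndAt x A)
    (hα : SmoothBiAt x α) (u v w : TangentSpace (𝓡 n) x) :
    nablaBi (compForm A α) x u v w = nablaEnd A x u (α x v w) + A x (nablaBi α x u v w) := by
  have h1 := smoothVec_extendVec v
  have h2 := smoothVec_extendVec w
  have h3 := nablaBi_apply (hα.compForm hA) h1 h2 u
  simp only [compForm] at h3
  rw [nabla_applyField hA (hα.apply h1 h2), nabla_applyBi hα h1 h2, hA.isLinearMap.map_add,
    hA.isLinearMap.map_add] at h3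
  simp only [extendVec_self] at h3
  rw [show nablaBi (compForm A α) x u v w = _ from h3]
  abel

theorem nablaBi_precomp {A : EndField n M} {α : BiField n M} {x : M} (hA : SmoothEndAt x A)
    (hα : SmoothBiAt x α) (u v w : TangentSpace (𝓡 n) x) :
    nablaBi (fun y a b ↦ α y (A y a) b) x u v w
      = nablaBi α x u (A x v) w + α x (nablaEnd A x u v) w := by
  have h1 := smoothVec_extendVec v
  have h2 := smoothVec_extendVec w
  have h3 := nablaBi_apply (hα.precomp hA) h1 h2 u
  rw [nabla_applyBi hα (hA.apply h1) h2, nabla_applyField hA h1, hα.isBilinearMap.add_left] at h3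
  simp only [extendVec_self] at h3
  rw [h3]
  abel

theorem nablaBi_swap {α : BiField n M} {x : M} (u v w : TangentSpace (𝓡 n) x) :
    nablaBi (fun y a b ↦ α y b a) x u v w = nablaBi α x u w v := by
  simp only [nablaBi]
  abel

/-- Differentiate g(AV, W) = g(V, AW) with a metric connection. -/
theorem nablaEnd_symm {A : EndField n M} {x : M} (hA : SmoothEndAt x A)
    (hs : ∀ (y : M) (v w : TangentSpace (𝓡 n) y), inner ℝ (A y v) w = inner ℝ v (A y w))
    (u v w : TangentSpace (𝓡 n) x) :
    inner ℝ (nablaEnd A x u v) w = inner ℝ v (nablaEnd A x u w) := by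
  have h1 := smoothVec_extendVec v
  have h2 := smoothVec_extendVec w
  have h3 := nabla_inner (hA.apply h1).mdifferentiableAt h2.mdifferentiableAt u
  have h4 := nabla_inner h1.mdifferentiableAt (hA.apply h2).mdifferentiableAt u
  simp_rw [hs] at h3
  rw [h4, nabla_applyField hA h1, nabla_applyField hA h2] at h3
  simp only [extendVec_self, inner_add_left, inner_add_right, hs] at h3
  linarith

end TensorCalculus

/-! ### Curvature symmetries and the Ricci identity -/

section Curvature

variable {n : ℕ} {M : Type*} [TopologicalSpace M] [ChartedSpace (EuclideanSpace ℝ (Fin n)) M]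
  [IsManifold (𝓡 n) ∞ M] [RiemannianBundle (fun x : M ↦ TangentSpace (𝓡 n) x)]
  [IsContMDiffRiemannianBundle (𝓡 n) ∞ (EuclideanSpace ℝ (Fin n))
    (fun x : M ↦ TangentSpace (𝓡 n) x)]

/-- The curvature as a differential operator on the last argument. -/
def curvOp (W : VField n M) (x : M) (u v : TangentSpace (𝓡 n) x) : TangentSpace (𝓡 n) x :=
  nablaEnd (nabla W) x v u - nablaEnd (nabla W) x u v

theorem nablaEnd_nabla {W U : VField n M} {x : M} (hW : SmoothVec x W) (hU : SmoothVec x U)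
    (v : TangentSpace (𝓡 n) x) :
    nablaEnd (nabla W) x v (U x)
      = nabla (fun y ↦ nabla W y (U y)) x v - nabla W x (nabla U x v) :=
  nablaEnd_apply hW.smoothEndAt_nabla hU v

theorem curvOp_eq {W U V : VField n M} {x : M} (hW : SmoothVec x W) (hU : SmoothVec x U)
    (hV : SmoothVec x V) :
    curvOp W x (U x) (V x) = nabla (fun y ↦ nabla W y (U y)) x (V x)
      - nabla (fun y ↦ nabla W y (V y)) x (U x) - nabla W x (mlieBracket (𝓡 n) V U x) := by
  rw [curvOp, nablaEnd_nabla hW hU, nablaEnd_nabla hW hV,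
    ← nabla_torsion hV.mdifferentiableAt hU.mdifferentiableAt,
    hW.smoothEndAt_nabla.isLinearMap.map_sub]
  abel

/-- Equivalent to the absence of torsion, since [V, U] acts on f as a commutator. -/
theorem hessian_symm {f : M → ℝ} {U V : VField n M} {x : M} (hf : SmoothFun n x f)
    (hU : SmoothVec x U) (hV : SmoothVec x V) :
    mvfderiv (𝓡 n) (fun y ↦ mvfderiv (𝓡 n) f y (U y)) x (V x)
        - mvfderiv (𝓡 n) f x (nabla U x (V x))
      = mvfderiv (𝓡 n) (fun y ↦ mvfderiv (𝓡 n) f y (V y)) x (U x)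
        - mvfderiv (𝓡 n) f x (nabla V x (U x)) := by
  have h := mvfderiv_mlieBracket hf hV hU
  rw [← nabla_torsion hV.mdifferentiableAt hU.mdifferentiableAt, map_sub] at h
  linarith

/-- In ∇²(fW) the mixed first-order terms and the Hessian of f are symmetric in the two directions,
so they disappear on skew-symmetrization. -/
theorem curvOp_smul {W : VField n M} {f : M → ℝ} {x : M} (hf : SmoothFun n x f)
    (hW : SmoothVec x W) (u v : TangentSpace (𝓡 n) x) :
    curvOp (fun y ↦ f y • W y) x u v = f x • curvOp W x u v := by
  have key : ∀ {U V : VField n M}, SmoothVec x U → SmoothVec x V →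
      nablaEnd (nabla fun y ↦ f y • W y) x (V x) (U x) = f x • nablaEnd (nabla W) x (V x) (U x)
        + mvfderiv (𝓡 n) f x (V x) • nabla W x (U x)
        + mvfderiv (𝓡 n) f x (U x) • nabla W x (V x)
        + (mvfderiv (𝓡 n) (fun y ↦ mvfderiv (𝓡 n) f y (U y)) x (V x)
        - mvfderiv (𝓡 n) f x (nabla U x (V x))) • W x := by
    intro U V hU hV
    have h1 : ∀ᶠ y in 𝓝 x, nabla (fun z ↦ f z • W z) y (U y)
        = f y • nabla W y (U y) + mvfderiv (𝓡 n) f y (U y) • W y := by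
      filter_upwards [hf.eventually, hW.eventually] with y h2 h3
      exact nabla_smul h2.mdifferentiableAt h3.mdifferentiableAt _
    have h4 := SmoothVec.smul hf (hW.nabla hU)
    have h5 := SmoothVec.smul (hf.mvfderiv hU) hW
    rw [nablaEnd_nabla (SmoothVec.smul hf hW) hU, nablaEnd_nabla hW hU,
      nabla_congr (h4.add h5).mdifferentiableAt h1,
      nabla_add h4.mdifferentiableAt h5.mdifferentiableAt,
      nabla_smul hf.mdifferentiableAt (hW.nabla hU).mdifferentiableAt,
      nabla_smul (hf.mvfderiv hU).mdifferentiableAt hW.mdifferentiableAt,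
      nabla_smul hf.mdifferentiableAt hW.mdifferentiableAt]
    module
  have hU := smoothVec_extendVec u
  have hV := smoothVec_extendVec v
  have h1 := key hU hV
  have h2 := key hV hU
  rw [hessian_symm hf hU hV] at h1
  rw [extendVec_self, extendVec_self] at h1 h2
  rw [curvOp, curvOp, h1, h2]
  module

theorem curvOp_add {W W' : VField n M} {x : M} (hW : SmoothVec x W) (hW' : SmoothVec x W')
    (u v : TangentSpace (𝓡 n) x) :
    curvOp (fun y ↦ W y + W' y) x u v = curvOp W x u v + curvOp W' x u v := by
  have key : ∀ {U V : VField n M}, SmoothVec x U → SmoothVec x V →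
      nablaEnd (nabla fun y ↦ W y + W' y) x (V x) (U x) = nablaEnd (nabla W) x (V x) (U x)
        + nablaEnd (nabla W') x (V x) (U x) := by
    intro U V hU hV
    have h1 : ∀ᶠ y in 𝓝 x, nabla (fun z ↦ W z + W' z) y (U y)
        = nabla W y (U y) + nabla W' y (U y) := by
      filter_upwards [hW.eventually, hW'.eventually] with y h2 h3
      exact nabla_add h2.mdifferentiableAt h3.mdifferentiableAt _
    rw [nablaEnd_nabla (hW.add hW') hU, nablaEnd_nabla hW hU, nablaEnd_nabla hW' hU,
      nabla_congr ((hW.nabla hU).add (hW'.nabla hU)).mdifferentiableAt h1,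
      nabla_add (hW.nabla hU).mdifferentiableAt (hW'.nabla hU).mdifferentiableAt,
      nabla_add hW.mdifferentiableAt hW'.mdifferentiableAt]
    abel
  have hU := smoothVec_extendVec u
  have hV := smoothVec_extendVec v
  have h1 := key hU hV
  have h2 := key hV hU
  rw [extendVec_self, extendVec_self] at h1 h2
  rw [curvOp, curvOp, curvOp, h1, h2]
  abel

theorem curvOp_congr {W W' : VField n M} {x : M} (hW : SmoothVec x W)
    (h : ∀ᶠ y in 𝓝 x, W' y = W y) (u v : TangentSpace (𝓡 n) x) :
    curvOp W' x u v = curvOp W x u v := by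
  have key : ∀ {U V : VField n M}, SmoothVec x U → SmoothVec x V →
      nablaEnd (nabla W') x (V x) (U x) = nablaEnd (nabla W) x (V x) (U x) := by
    intro U V hU hV
    have h1 : ∀ᶠ y in 𝓝 x, nabla W' y (U y) = nabla W y (U y) := by
      filter_upwards [hW.eventually, h.eventually_nhds] with y h2 h3
      exact nabla_congr h2.mdifferentiableAt h3 _
    rw [nablaEnd_nabla (hW.congr h) hU, nablaEnd_nabla hW hU,
      nabla_congr (hW.nabla hU).mdifferentiableAt h1, nabla_congr hW.mdifferentiableAt h]
  have hU := smoothVec_extendVec u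
  have hV := smoothVec_extendVec v
  have h1 := key hU hV
  have h2 := key hV hU
  rw [extendVec_self, extendVec_self] at h1 h2
  rw [curvOp, curvOp, h1, h2]

theorem curvOp_sum_smul {ι : Type*} {s : Finset ι} {f : ι → M → ℝ} {X : ι → VField n M} {x : M}
    (hf : ∀ i, SmoothFun n x (f i)) (hX : ∀ i, SmoothVec x (X i)) (u v : TangentSpace (𝓡 n) x) :
    curvOp (fun y ↦ ∑ i ∈ s, f i y • X i y) x u v = ∑ i ∈ s, f i x • curvOp (X i) x u v := by
  classical
  induction s using Finset.induction_on with
  | empty =>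
    have h := curvOp_smul (SmoothFun.const (0 : ℝ)) (smoothVec_extendVec u) u v
    simpa using h
  | insert a s ha ih =>
    simp only [Finset.sum_insert ha, ← ih]
    rw [← curvOp_smul (hf a) (hX a)]
    exact curvOp_add (SmoothVec.smul (hf a) (hX a))
      (SmoothVec.sum fun i _ ↦ SmoothVec.smul (hf i) (hX i)) u v

/-- The curvature is tensorial in its last argument. -/
theorem curv_apply {W : VField n M} {x : M} (hW : SmoothVec x W) (u v : TangentSpace (𝓡 n) x) :
    curv x u v (W x) = curvOp W x u v := by
  obtain ⟨e, he, hb⟩ := exists_orthonormal_frame (n := n) x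
  have key : ∀ Z : VField n M, SmoothVec x Z →
      curvOp Z x u v = ∑ i, inner ℝ (e i x) (Z x) • curvOp (e i) x u v := by
    intro Z hZ
    have h1 : ∀ᶠ y in 𝓝 x, Z y = ∑ i, inner ℝ (e i y) (Z y) • e i y := by
      filter_upwards [hb] with y ⟨b, hb⟩
      conv_lhs => rw [← b.sum_repr' (Z y)]
      simp [hb]
    have hf : ∀ i, SmoothFun n x fun y ↦ inner ℝ (e i y) (Z y) := fun i ↦ (he i).inner hZ
    rw [curvOp_congr (SmoothVec.sum (s := Finset.univ) fun i _ ↦ SmoothVec.smul (hf i) (he i)) h1,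
      curvOp_sum_smul hf he]
  have h2 := key _ (smoothVec_extendVec (W x))
  rw [extendVec_self, ← key W hW] at h2
  exact h2

theorem curv_eq {W U V : VField n M} {x : M} (hW : SmoothVec x W) (hU : SmoothVec x U)
    (hV : SmoothVec x V) :
    curv x (U x) (V x) (W x) = nabla (fun y ↦ nabla W y (U y)) x (V x)
      - nabla (fun y ↦ nabla W y (V y)) x (U x) - nabla W x (mlieBracket (𝓡 n) V U x) := by
  rw [curv_apply hW, curvOp_eq hW hU hV]

theorem isBilinearMap_nabla₂ {W : VField n M} {x : M} (hW : SmoothVec x W) :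
    IsBilinearMap ℝ (nablaEnd (nabla W) x) := isBilinearMap_nablaEnd hW.smoothEndAt_nabla

theorem curv_add_left {x : M} (u u' v w : TangentSpace (𝓡 n) x) :
    curv x (u + u') v w = curv x u v w + curv x u' v w := by
  have h := isBilinearMap_nabla₂ (smoothVec_extendVec w)
  simp only [curv, h.add_left, h.add_right]
  abel

theorem curv_smul_left {x : M} (c : ℝ) (u v w : TangentSpace (𝓡 n) x) :
    curv x (c • u) v w = c • curv x u v w := by
  have h := isBilinearMap_nabla₂ (smoothVec_extendVec w)
  simp only [curv, h.smul_left, h.smul_right, smul_sub]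

theorem curv_skew {x : M} (u v w : TangentSpace (𝓡 n) x) : curv x u v w = -curv x v u w := by
  simp only [curv, neg_sub]

theorem curv_add_right {x : M} (u v w w' : TangentSpace (𝓡 n) x) :
    curv x u v (w + w') = curv x u v w + curv x u v w' := by
  have h1 := smoothVec_extendVec w
  have h2 := smoothVec_extendVec w'
  have h3 := curv_apply (h1.add h2) u v
  rw [curvOp_add h1 h2, extendVec_self, extendVec_self] at h3
  exact h3

theorem curv_smul_right {x : M} (c : ℝ) (u v w : TangentSpace (𝓡 n) x) :
    curv x u v (c • w) = c • curv x u v w := by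
  have h1 := smoothVec_extendVec w
  have h3 := curv_apply (h1.const_smul c) u v
  rw [curvOp_smul (SmoothFun.const c) h1, extendVec_self] at h3
  exact h3

/-- The Hessian of the function g(W, Z) is symmetric. Expanded by metric compatibility, it consists
of the ∇²-terms and of products of first derivatives that are themselves symmetric. -/
theorem curv_metric {x : M} (u v w z : TangentSpace (𝓡 n) x) :
    inner ℝ (curv x u v w) z = -inner ℝ w (curv x u v z) := by
  have hW := smoothVec_extendVec w
  have hZ := smoothVec_extendVec z
  have key : ∀ {U V : VField n M}, SmoothVec x U → SmoothVec x V →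
      mvfderiv (𝓡 n) (fun y ↦ mvfderiv (𝓡 n) (fun y ↦ inner ℝ (extendVec w y) (extendVec z y))
          y (U y)) x (V x)
        - mvfderiv (𝓡 n) (fun y ↦ inner ℝ (extendVec w y) (extendVec z y)) x (nabla U x (V x))
      = inner ℝ (nablaEnd (nabla (extendVec w)) x (V x) (U x)) z
        + inner ℝ w (nablaEnd (nabla (extendVec z)) x (V x) (U x))
        + (inner ℝ (nabla (extendVec w) x (U x)) (nabla (extendVec z) x (V x))
        + inner ℝ (nabla (extendVec w) x (V x)) (nabla (extendVec z) x (U x))) := by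
    intro U V hU hV
    have h1 : (fun y ↦ mvfderiv (𝓡 n) (fun y ↦ inner ℝ (extendVec w y) (extendVec z y)) y (U y))
        =ᶠ[𝓝 x] (fun y ↦ inner ℝ (nabla (extendVec w) y (U y)) (extendVec z y))
          + fun y ↦ inner ℝ (extendVec w y) (nabla (extendVec z) y (U y)) := by
      filter_upwards [hW.eventually, hZ.eventually] with y h2 h3
      exact nabla_inner h2.mdifferentiableAt h3.mdifferentiableAt _
    rw [mvfderiv_congr h1, mvfderiv_add ((hW.nabla hU).inner hZ).mdifferentiableAt
      (hW.inner (hZ.nabla hU)).mdifferentiableAt, nablaEnd_nabla hW hU, nablaEnd_nabla hZ hU,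
      nabla_inner hW.mdifferentiableAt hZ.mdifferentiableAt]
    simp only [add_apply]
    rw [nabla_inner (hW.nabla hU).mdifferentiableAt hZ.mdifferentiableAt,
      nabla_inner hW.mdifferentiableAt (hZ.nabla hU).mdifferentiableAt]
    simp only [extendVec_self, inner_sub_left, inner_sub_right]
    ring
  have hU := smoothVec_extendVec u
  have hV := smoothVec_extendVec v
  have h1 := key hU hV
  have h2 := key hV hU
  rw [hessian_symm (hW.inner hZ) hU hV, h2] at h1
  simp only [extendVec_self] at h1
  simp only [curv, inner_sub_left, inner_sub_right]
  linarith

theorem curv_bianchi {x : M} (u v w : TangentSpace (𝓡 n) x) :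
    curv x u v w + curv x v w u + curv x w u v = 0 := by
  have hU := smoothVec_extendVec u
  have hV := smoothVec_extendVec v
  have hW := smoothVec_extendVec w
  -- Two applications of torsion-freeness turn a difference of second derivatives into an iterated
  -- bracket. The cyclic sum of these vanishes by Jacobi.
  have key : ∀ {U V W : VField n M}, SmoothVec x U → SmoothVec x V → SmoothVec x W →
      nabla (fun y ↦ nabla W y (U y)) x (V x) - nabla (fun y ↦ nabla U y (W y)) x (V x)
        - nabla V x (mlieBracket (𝓡 n) U W x)
        = mlieBracket (𝓡 n) V (mlieBracket (𝓡 n) U W) x := by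
    intro U V W hU hV hW
    rw [← nabla_torsion hV.mdifferentiableAt (hU.lieBracket hW).mdifferentiableAt]
    have h1 : ∀ᶠ y in 𝓝 x, nabla W y (U y)
        = nabla U y (W y) + mlieBracket (𝓡 n) U W y := by
      filter_upwards [hU.eventually, hW.eventually] with y h2 h3
      rw [← nabla_torsion h2.mdifferentiableAt h3.mdifferentiableAt]
      abel
    rw [nabla_congr ((hU.nabla hW).add (hU.lieBracket hW)).mdifferentiableAt h1,
      nabla_add (hU.nabla hW).mdifferentiableAt (hU.lieBracket hW).mdifferentiableAt]
    abel
  have h2 : ∀ {Z : VField n M}, SmoothVec x Z → ContMDiffAt (𝓡 n)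
      ((𝓡 n).prod 𝓘(ℝ, EuclideanSpace ℝ (Fin n))) (minSmoothness ℝ 2)
      (fun y ↦ TotalSpace.mk' (EuclideanSpace ℝ (Fin n)) y (Z y)) x := fun hZ ↦
    hZ.self_of_nhds.of_le (by
      rw [minSmoothness_of_isRCLikeNormedField]; exact ENat.LEInfty.out)
  have j := leibniz_identity_mlieBracket_apply (h2 hU) (h2 hV) (h2 hW)
  have h1 := curv_eq hW hU hV
  have h3 := curv_eq hU hV hW
  have h4 := curv_eq hV hW hU
  have k1 := key hU hV hW
  have k2 := key hV hW hU
  have k3 := key hW hU hV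
  have s1 : mlieBracket (𝓡 n) (mlieBracket (𝓡 n) (extendVec u) (extendVec v)) (extendVec w) x
      = - mlieBracket (𝓡 n) (extendVec w) (mlieBracket (𝓡 n) (extendVec u) (extendVec v)) x :=
    mlieBracket_swap_apply
  have hneg : ∀ {U V W : VField n M}, SmoothVec x U → SmoothVec x V → SmoothVec x W →
      mlieBracket (𝓡 n) W (mlieBracket (𝓡 n) V U) x
        = -mlieBracket (𝓡 n) W (mlieBracket (𝓡 n) U V) x := by
    intro U V W hU hV hW
    have h5 : mlieBracket (𝓡 n) V U = (-1 : ℝ) • mlieBracket (𝓡 n) U V := by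
      rw [mlieBracket_swap, neg_one_smul]
    rw [h5, mlieBracket_const_smul_right (hU.lieBracket hV).mdifferentiableAt, neg_one_smul]
  rw [hneg hU hV hW] at k2
  rw [hneg hV hW hU] at k3
  rw [s1] at j
  rw [j] at k3
  have h5 := congrArg₂ (· + ·) (congrArg₂ (· + ·) k1 k2) k3
  simp only [extendVec_self] at h1 h3 h4 h5
  rw [h1, h3, h4]
  refine Eq.trans ?_ (h5.trans ?_) <;> abel

/-- The Ricci identity for endomorphism fields. -/
theorem ricci_identity {A : EndField n M} {x : M} (hA : SmoothEndAt x A)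
    (u v w : TangentSpace (𝓡 n) x) :
    nablaBi (nablaEnd A) x v u w - nablaBi (nablaEnd A) x u v w
      = curv x u v (A x w) - A x (curv x u v w) := by
  have hW := smoothVec_extendVec w
  -- The second derivative of AW by the product rule; the last bracket is symmetric in U and V and
  -- drops out of the commutator.
  have key : ∀ {U V : VField n M}, SmoothVec x U → SmoothVec x V →
      nablaEnd (nabla fun y ↦ A y (extendVec w y)) x (V x) (U x)
        = nablaBi (nablaEnd A) x (V x) (U x) w + A x (nablaEnd (nabla (extendVec w)) x (V x) (U x))
          + (nablaEnd A x (U x) (nabla (extendVec w) x (V x))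
          + nablaEnd A x (V x) (nabla (extendVec w) x (U x))) := by
    intro U V hU hV
    have h1 : ∀ᶠ y in 𝓝 x, nabla (fun z ↦ A z (extendVec w z)) y (U y)
        = nablaEnd A y (U y) (extendVec w y) + A y (nabla (extendVec w) y (U y)) := by
      filter_upwards [hA.eventually, hW.eventually] with y h2 h3
      exact nabla_applyField h2 h3 _
    have h4 := hA.nablaEnd.apply hU hW
    have h5 := hA.apply (hW.nabla hU)
    rw [nablaEnd_nabla (hA.apply hW) hU, nabla_congr (h4.add h5).mdifferentiableAt h1,
      nabla_add h4.mdifferentiableAt h5.mdifferentiableAt,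
      nabla_applyBi hA.nablaEnd hU hW, nabla_applyField hA (hW.nabla hU),
      nabla_applyField hA hW, nablaEnd_nabla hW hU, hA.isLinearMap.map_sub, extendVec_self]
    abel
  have hU := smoothVec_extendVec u
  have hV := smoothVec_extendVec v
  have h1 := key hU hV
  have h2 := key hV hU
  have h3 := curv_apply (hA.apply hW) u v
  rw [extendVec_self, extendVec_self] at h1 h2
  rw [extendVec_self] at h3
  rw [h3, curvOp, h1, h2, curv, hA.isLinearMap.map_sub]
  abel

/-- The left-hand side of the Ricci identity vanishes when ∇A = 0. For A = J this is the Kähler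
symmetry of the curvature. -/
theorem curv_comm_of_parallel {A : EndField n M} {x : M} (hA : SmoothEndAt x A)
    (hp : ∀ (y : M) (u v : TangentSpace (𝓡 n) y), nablaEnd A y u v = 0)
    (u v w : TangentSpace (𝓡 n) x) : curv x u v (A x w) = A x (curv x u v w) := by
  have h := ricci_identity hA u v w
  have h0 : nablaEnd A = fun _ _ _ ↦ 0 := by
    ext1 y; ext1 a; ext1 b; exact hp y a b
  simp only [h0, nablaBi, nabla_zero, sub_zero] at h
  exact (sub_eq_zero.1 h.symm)

theorem sum_curv_of_isEinstein {E : ℝ} (hE : IsEinstein n M E) (x : M)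
    (v : TangentSpace (𝓡 n) x) : ∑ i, curv x (frame x i) v (frame x i) = E • v := by
  refine ext_inner_right ℝ fun w ↦ ?_
  rw [sum_inner, real_inner_smul_left]
  exact hE x v w

end Curvature

/-! ### Coordinate fields and the volume density -/

section Coordinates

variable {n : ℕ} {M : Type*} [TopologicalSpace M] [ChartedSpace (EuclideanSpace ℝ (Fin n)) M]
  [IsManifold (𝓡 n) ∞ M]

/-- The vector field on the domain of the preferred chart at `p` which has the constant
components `a` in that chart. -/
def coordField (p : M) (a : EuclideanSpace ℝ (Fin n)) : VField n M :=
  mpullback (𝓡 n) 𝓘(ℝ, EuclideanSpace ℝ (Fin n)) (extChartAt (𝓡 n) p) fun _ ↦ a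

theorem smoothVec_coordField {p q : M} (hq : q ∈ (extChartAt (𝓡 n) p).source)
    (a : EuclideanSpace ℝ (Fin n)) : SmoothVec q (coordField p a) := by
  filter_upwards [(isOpen_extChartAt_source p).mem_nhds hq] with x hx
  refine ContMDiffAt.mpullback_vectorField_preimage (n := ∞) ?_
    (contMDiffAt_extChartAt' (by simpa using hx)) (isInvertible_mfderiv_extChartAt hx) le_rfl
  exact (contMDiffAt_vectorSpace_iff_contDiffAt).2 contDiffAt_const

theorem coordField_eq_inverse (p q : M) (a : EuclideanSpace ℝ (Fin n)) :
    coordField p a q = (mfderiv (𝓡 n) (𝓡 n) (extChartAt (𝓡 n) p) q).inverse a := rfl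

theorem mfderiv_extChartAt_symm_apply {p : M} {y : EuclideanSpace ℝ (Fin n)}
    (hy : y ∈ (extChartAt (𝓡 n) p).target) (a : EuclideanSpace ℝ (Fin n)) :
    mfderiv (𝓡 n) (𝓡 n) (extChartAt (𝓡 n) p).symm y a
      = coordField p a ((extChartAt (𝓡 n) p).symm y) := by
  have h1 := mfderiv_extChartAt_comp_mfderivWithin_extChartAt_symm hy
  have h2 := mfderivWithin_extChartAt_symm_comp_mfderiv_extChartAt hy
  rw [ModelWithCorners.range_eq_univ, mfderivWithin_univ] at h1 h2
  exact (DFunLike.congr_fun (ContinuousLinearMap.inverse_eq h1 h2) a).symm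

theorem coordField_mfderiv {p q : M} (hq : q ∈ (extChartAt (𝓡 n) p).source)
    (v : TangentSpace (𝓡 n) q) :
    coordField p (mfderiv (𝓡 n) (𝓡 n) (extChartAt (𝓡 n) p) q v) q = v := by
  obtain ⟨f, hf⟩ := isInvertible_mfderiv_extChartAt (I := 𝓡 n) hq
  have h : (mfderiv (𝓡 n) (𝓡 n) (extChartAt (𝓡 n) p) q).inverse
      (mfderiv (𝓡 n) (𝓡 n) (extChartAt (𝓡 n) p) q v) = v := by
    rw [← hf, ContinuousLinearMap.inverse_equiv]
    exact f.symm_apply_apply v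
  exact h

/-- Pullback by the chart respects brackets, and constant fields commute. -/
theorem mlieBracket_coordField {p q : M} (hq : q ∈ (extChartAt (𝓡 n) p).source)
    (a b : EuclideanSpace ℝ (Fin n)) :
    mlieBracket (𝓡 n) (coordField p a) (coordField p b) q = 0 := by
  have hc : ∀ a : EuclideanSpace ℝ (Fin n), MDifferentiableAt 𝓘(ℝ, EuclideanSpace ℝ (Fin n))
      (𝓘(ℝ, EuclideanSpace ℝ (Fin n)).prod 𝓘(ℝ, EuclideanSpace ℝ (Fin n)))
      (fun y ↦ TotalSpace.mk' (E := fun y ↦ TangentSpace 𝓘(ℝ, EuclideanSpace ℝ (Fin n)) y)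
        (EuclideanSpace ℝ (Fin n)) y a) (extChartAt (𝓡 n) p q) := fun a ↦
    (contMDiffAt_vectorSpace_iff_contDiffAt (n := ∞).2 contDiffAt_const).mdifferentiableAt
      (by simp)
  rw [coordField, coordField, ← mpullback_mlieBracket (n := ∞) (hc a) (hc b)
    (contMDiffAt_extChartAt' (by simpa using hq))
    (by rw [minSmoothness_of_isRCLikeNormedField]; exact ENat.LEInfty.out)]
  have h : mlieBracket 𝓘(ℝ, EuclideanSpace ℝ (Fin n)) (fun _ ↦ a) (fun _ ↦ b)
      (extChartAt (𝓡 n) p q) = 0 :=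
    (congrFun (mlieBracketWithin_eq_lieBracketWithin (𝕜 := ℝ) (E := EuclideanSpace ℝ (Fin n))
      (V := fun _ ↦ a) (W := fun _ ↦ b) (s := Set.univ)) _).trans (by simp [lieBracketWithin]; rfl)
  exact (congrArg (mfderiv (𝓡 n) (𝓡 n) (extChartAt (𝓡 n) p) q).inverse h).trans (map_zero _)

/-- In the chart at `p`, coordinate fields act on functions as directional derivatives. -/
theorem mvfderiv_coordField {p : M} {y : EuclideanSpace ℝ (Fin n)} {f : M → ℝ}
    (hy : y ∈ (extChartAt (𝓡 n) p).target)
    (hf : DiffFunAt n f ((extChartAt (𝓡 n) p).symm y)) (a : EuclideanSpace ℝ (Fin n)) :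
    mvfderiv (𝓡 n) f ((extChartAt (𝓡 n) p).symm y) (coordField p a ((extChartAt (𝓡 n) p).symm y))
      = fderiv ℝ (fun z ↦ f ((extChartAt (𝓡 n) p).symm z)) y a := by
  have h1 := mdifferentiableWithinAt_extChartAt_symm (I := 𝓡 n) hy
  rw [ModelWithCorners.range_eq_univ, mdifferentiableWithinAt_univ] at h1
  rw [← mfderiv_extChartAt_symm_apply hy]
  have h2 := mfderiv_comp y hf h1
  rw [mfderiv_eq_fderiv] at h2
  exact (DFunLike.congr_fun h2 a).symm

theorem SmoothFun.contDiffAt_comp_symm {p : M} {y : EuclideanSpace ℝ (Fin n)} {f : M → ℝ}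
    (hy : y ∈ (extChartAt (𝓡 n) p).target)
    (hf : SmoothFun n ((extChartAt (𝓡 n) p).symm y) f) :
    ContDiffAt ℝ ∞ (fun z ↦ f ((extChartAt (𝓡 n) p).symm z)) y := by
  rw [← contMDiffAt_iff_contDiffAt]
  exact hf.contMDiffAt.comp y ((contMDiffOn_extChartAt_symm p).contMDiffAt
    ((isOpen_extChartAt_target p).mem_nhds hy))

theorem SmoothFun.prod {ι : Type*} {s : Finset ι} {f : ι → M → ℝ} {x : M}
    (hf : ∀ i ∈ s, SmoothFun n x (f i)) : SmoothFun n x (fun y ↦ ∏ i ∈ s, f i y) := by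
  classical
  induction s using Finset.induction_on with
  | empty => simpa using SmoothFun.const 1
  | insert a s ha ih =>
    simp only [Finset.prod_insert ha]
    exact (hf a (by simp)).mul (ih fun i hi ↦ hf i (by simp [hi]))

theorem SmoothFun.det {G : M → Matrix (Fin n) (Fin n) ℝ} {x : M}
    (hG : ∀ i j, SmoothFun n x fun y ↦ G y i j) : SmoothFun n x (fun y ↦ (G y).det) := by
  simp only [Matrix.det_apply']
  exact SmoothFun.sum fun σ _ ↦ (SmoothFun.const _).mul (SmoothFun.prod fun i _ ↦ hG _ _)

/-- The derivative of a determinant. -/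
theorem mvfderiv_det {p q : M} {G : M → Matrix (Fin n) (Fin n) ℝ}
    (hq : q ∈ (extChartAt (𝓡 n) p).source) (hG : ∀ i j, SmoothFun n q fun y ↦ G y i j)
    (a : EuclideanSpace ℝ (Fin n)) :
    mvfderiv (𝓡 n) (fun y ↦ (G y).det) q (coordField p a q)
      = ∑ i, ((G q).updateRow i
        fun j ↦ mvfderiv (𝓡 n) (fun y ↦ G y i j) q (coordField p a q)).det := by
  obtain ⟨y, hy, rfl⟩ : ∃ y ∈ (extChartAt (𝓡 n) p).target, (extChartAt (𝓡 n) p).symm y = q :=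
    ⟨_, (extChartAt (𝓡 n) p).map_source hq, (extChartAt (𝓡 n) p).left_inv hq⟩
  simp only [mvfderiv_coordField hy (hG _ _).mdifferentiableAt,
    mvfderiv_coordField hy (SmoothFun.det hG).mdifferentiableAt]
  have h1 : ∀ i j, HasFDerivAt (fun z ↦ G ((extChartAt (𝓡 n) p).symm z) i j)
      (fderiv ℝ (fun z ↦ G ((extChartAt (𝓡 n) p).symm z) i j) y) y := fun i j ↦
    (((hG i j).contDiffAt_comp_symm hy).differentiableAt (by simp)).hasFDerivAt
  let f : ContinuousMultilinearMap ℝ (fun _ : Fin n ↦ Fin n → ℝ) ℝ :=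
    { toMultilinearMap := (Matrix.detRowAlternating (n := Fin n) (R := ℝ)).toMultilinearMap
      cont := Continuous.matrix_det continuous_id }
  have h2 := HasFDerivAt.multilinear_comp (f := f) fun i ↦ hasFDerivAt_pi.2 (h1 i)
  have h3 : (fun z ↦ (G ((extChartAt (𝓡 n) p).symm z)).det)
      = fun z ↦ f fun i j ↦ G ((extChartAt (𝓡 n) p).symm z) i j := rfl
  rw [h3, h2.fderiv]
  simp only [sum_apply, ContinuousLinearMap.comp_apply]
  rfl

/-- Jacobi's formula: the sum is tr(adj(G) B) with B = ΓG + GΓᵀ, and each of the two products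
contributes det G · tr Γ. -/
theorem sum_det_updateRow (G Γ : Matrix (Fin n) (Fin n) ℝ) :
    ∑ i, (G.updateRow i ((Γ * G + G * Γ.transpose) i)).det = 2 * G.det * Γ.trace := by
  have h1 : ∀ B : Matrix (Fin n) (Fin n) ℝ, ∑ i, (G.updateRow i (B i)).det
      = (G.adjugate * B).trace := by
    intro B
    rw [Matrix.trace_mul_comm]
    refine Finset.sum_congr rfl fun i _ ↦ ?_
    rw [← Matrix.cramer_transpose_apply, Matrix.cramer_eq_adjugate_mulVec,
      ← Matrix.adjugate_transpose, Matrix.mulVec_transpose]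
    rfl
  rw [h1, mul_add, Matrix.trace_add, ← mul_assoc, ← mul_assoc, Matrix.trace_mul_cycle,
    Matrix.mul_adjugate, Matrix.adjugate_mul, Matrix.smul_mul, Matrix.smul_mul, one_mul, one_mul,
    Matrix.trace_smul, Matrix.trace_smul, Matrix.trace_transpose]
  simp only [smul_eq_mul]
  ring

/-- The basis of `T_q M` given by the preferred chart at `p`. -/
theorem exists_coordBasis {p q : M} (hq : q ∈ (extChartAt (𝓡 n) p).source) :
    ∃ b : Module.Basis (Fin n) ℝ (TangentSpace (𝓡 n) q),
      ∀ i, b i = coordField p (EuclideanSpace.single i (1 : ℝ)) q := by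
  obtain ⟨f, hf⟩ := isInvertible_mfderiv_extChartAt (I := 𝓡 n) hq
  let g : EuclideanSpace ℝ (Fin n) ≃L[ℝ] TangentSpace (𝓡 n) q := f.symm
  refine ⟨(EuclideanSpace.basisFun (Fin n) ℝ).toBasis.map g.toLinearEquiv, fun i ↦ ?_⟩
  rw [coordField_eq_inverse, ← hf, ContinuousLinearMap.inverse_equiv, Module.Basis.map_apply,
    OrthonormalBasis.coe_toBasis, EuclideanSpace.basisFun_apply]
  rfl

variable [RiemannianBundle (fun x : M ↦ TangentSpace (𝓡 n) x)]

/-- The Gram matrix of the coordinate fields of the preferred chart at `p`. -/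
def coordGram (p q : M) : Matrix (Fin n) (Fin n) ℝ := Matrix.of fun i j ↦
  inner ℝ (coordField p (EuclideanSpace.single i (1 : ℝ)) q)
    (coordField p (EuclideanSpace.single j (1 : ℝ)) q)

variable (n) in
/-- The density of the Riemannian volume in the preferred chart at `p`. -/
def volDensity (p q : M) : ℝ := √(coordGram (n := n) p q).det

theorem chartDensity_eq {p : M} {y : EuclideanSpace ℝ (Fin n)}
    (hy : y ∈ (extChartAt (𝓡 n) p).target) :
    chartDensity p y = volDensity n p ((extChartAt (𝓡 n) p).symm y) := by
  simp only [chartDensity, volDensity, coordGram, mfderiv_extChartAt_symm_apply hy]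

theorem coordGram_det_pos {p q : M} (hq : q ∈ (extChartAt (𝓡 n) p).source) :
    0 < (coordGram (n := n) p q).det := by
  obtain ⟨b, hb⟩ := exists_coordBasis hq
  have h := (Matrix.posDef_gram_of_linearIndependent (𝕜 := ℝ) b.linearIndependent).det_pos
  have h1 : coordGram p q = Matrix.gram ℝ b := by
    ext i j
    simp [coordGram, Matrix.gram, hb]
  rwa [h1]

theorem volDensity_pos {p q : M} (hq : q ∈ (extChartAt (𝓡 n) p).source) :
    0 < volDensity n p q := Real.sqrt_pos.2 (coordGram_det_pos hq)

variable [IsContMDiffRiemannianBundle (𝓡 n) ∞ (EuclideanSpace ℝ (Fin n))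
    (fun x : M ↦ TangentSpace (𝓡 n) x)]

theorem smoothFun_coordGram {p q : M} (hq : q ∈ (extChartAt (𝓡 n) p).source) (i j : Fin n) :
    SmoothFun n q fun y ↦ coordGram (n := n) p y i j :=
  (smoothVec_coordField hq _).inner (smoothVec_coordField hq _)

theorem smoothFun_volDensity {p q : M} (hq : q ∈ (extChartAt (𝓡 n) p).source) :
    SmoothFun n q (volDensity n p) := by
  filter_upwards [SmoothFun.det (smoothFun_coordGram hq),
    (isOpen_extChartAt_source p).mem_nhds hq] with x h1 h2
  exact (Real.contDiffAt_sqrt (coordGram_det_pos h2).ne').contMDiffAt.comp x h1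

theorem trace_eq_sum_repr {A : EndField n M} {q : M} (hA : IsLinearMap ℝ (A q))
    (b : Module.Basis (Fin n) ℝ (TangentSpace (𝓡 n) q)) :
    trace A q = ∑ i, b.repr (A q (b i)) i := by
  have := finiteDimensional_tangentSpace (n := n) q
  have h := LinearMap.trace_eq_sum_inner (hA.mk' (A q)) (frame q)
  rw [LinearMap.trace_eq_matrix_trace ℝ b] at h
  simp only [trace]
  refine Eq.trans (Finset.sum_congr rfl fun i _ ↦ real_inner_comm _ _) (h.symm.trans ?_)
  simp [Matrix.trace, LinearMap.toMatrix_apply]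

/-- The logarithmic derivative of the volume density is the divergence of the coordinate field. -/
theorem mvfderiv_volDensity {p q : M} (hq : q ∈ (extChartAt (𝓡 n) p).source) (k : Fin n) :
    mvfderiv (𝓡 n) (volDensity n p) q (coordField p (EuclideanSpace.single k (1 : ℝ)) q)
      = volDensity n p q * trace (nabla (coordField p (EuclideanSpace.single k (1 : ℝ)))) q := by
  obtain ⟨b, hb⟩ := exists_coordBasis hq
  set X : Fin n → VField n M := fun i ↦ coordField p (EuclideanSpace.single i (1 : ℝ))
  have hX : ∀ i, SmoothVec q (X i) := fun i ↦ smoothVec_coordField hq _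
  replace hb : ∀ i, b i = X i q := hb
  -- Row i holds the components of the derivative of the i-th coordinate field along the k-th, so
  -- that metric compatibility reads ∂ₖG = ΓG + GΓᵀ.
  set Γ : Matrix (Fin n) (Fin n) ℝ := Matrix.of fun i j ↦ b.repr (nabla (X i) q (X k q)) j
  have hΓ : ∀ i, nabla (X i) q (X k q) = ∑ j, Γ i j • X j q := fun i ↦ by
    conv_lhs => rw [← b.sum_repr (nabla (X i) q (X k q))]
    simp [hb, Γ]
  have htr : trace (nabla (X k)) q = Γ.trace := by
    rw [trace_eq_sum_repr (hX k).smoothEndAt_nabla.isLinearMap b]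
    refine Finset.sum_congr rfl fun i _ ↦ ?_
    -- Coordinate fields commute, so the lower indices of the Christoffel symbols may be exchanged
    -- and tr Γ is the divergence of the k-th field.
    have h := nabla_torsion (hX k).mdifferentiableAt (hX i).mdifferentiableAt
    rw [mlieBracket_coordField hq, sub_eq_zero] at h
    rw [hb, ← h]
    rfl
  have hdG : ∀ i j, mvfderiv (𝓡 n) (fun y ↦ coordGram (n := n) p y i j) q (X k q)
      = (Γ * coordGram p q + coordGram p q * Γ.transpose : Matrix (Fin n) (Fin n) ℝ) i j :=
    fun i j ↦ by
    have h := nabla_inner (hX i).mdifferentiableAt (hX j).mdifferentiableAt (X k q)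
    refine Eq.trans h ?_
    rw [hΓ, hΓ, sum_inner, inner_sum, Matrix.add_apply, Matrix.mul_apply, Matrix.mul_apply]
    simp only [real_inner_smul_left, real_inner_smul_right, Matrix.transpose_apply, coordGram,
      Matrix.of_apply, X, mul_comm]
  have hdet := mvfderiv_det hq (smoothFun_coordGram hq) (EuclideanSpace.single k (1 : ℝ))
  have h1 : ∀ i, (fun j ↦ mvfderiv (𝓡 n) (fun y ↦ coordGram (n := n) p y i j) q
      (coordField p (EuclideanSpace.single k (1 : ℝ)) q))
        = (Γ * coordGram p q + coordGram p q * Γ.transpose : Matrix (Fin n) (Fin n) ℝ) i :=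
      fun i ↦ funext (hdG i)
  simp only [h1] at hdet
  rw [sum_det_updateRow] at hdet
  -- Differentiating the square of the density avoids the derivative of the square root; the
  -- positive factor is cancelled at the end.
  have hsq : (fun y ↦ (coordGram (n := n) p y).det) =ᶠ[𝓝 q]
      volDensity n p * volDensity n p := by
    filter_upwards [(isOpen_extChartAt_source p).mem_nhds hq] with x hx
    exact (Real.mul_self_sqrt (coordGram_det_pos hx).le).symm
  have hD := (smoothFun_volDensity hq).mdifferentiableAt
  rw [mvfderiv_congr hsq, mvfderiv_mul hD hD, show (coordGram (n := n) p q).det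
    = volDensity n p q * volDensity n p q from hsq.self_of_nhds, ← htr] at hdet
  simp only [add_apply, smul_apply, smul_eq_mul] at hdet
  have hpos := volDensity_pos hq
  have h2 : volDensity n p q * (mvfderiv (𝓡 n) (volDensity n p) q
      (coordField p (EuclideanSpace.single k (1 : ℝ)) q)
      - volDensity n p q * trace (nabla (X k)) q) = 0 := by linarith
  exact sub_eq_zero.1 ((mul_eq_zero.1 h2).resolve_left hpos.ne')

end Coordinates

/-! ### Integration in charts -/

section ChartIntegrals

variable {n : ℕ} {M : Type*} [TopologicalSpace M] [ChartedSpace (EuclideanSpace ℝ (Fin n)) M]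
  [IsManifold (𝓡 n) ∞ M]

/-- The `k`-th component of a vector field in the preferred chart at `p`. -/
def coordComp (p : M) (k : Fin n) (V : VField n M) (q : M) : ℝ :=
  mvfderiv (𝓡 n) (fun x ↦ extChartAt (𝓡 n) p x k) q (V q)

theorem coordComp_eq {p q : M} (hq : q ∈ (extChartAt (𝓡 n) p).source) (k : Fin n)
    (V : VField n M) :
    coordComp p k V q
      = (EuclideanSpace.proj k : EuclideanSpace ℝ (Fin n) →L[ℝ] ℝ)
        (mfderiv (𝓡 n) (𝓡 n) (extChartAt (𝓡 n) p) q (V q)) := by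
  have h1 : MDifferentiableAt (𝓡 n) (𝓡 n) (extChartAt (𝓡 n) p) q :=
    mdifferentiableAt_extChartAt (by simpa using hq)
  have h2 : MDifferentiableAt (𝓡 n) 𝓘(ℝ, ℝ)
      (EuclideanSpace.proj k : EuclideanSpace ℝ (Fin n) →L[ℝ] ℝ) (extChartAt (𝓡 n) p q) :=
    (EuclideanSpace.proj k : EuclideanSpace ℝ (Fin n) →L[ℝ] ℝ).mdifferentiableAt
  have h3 := mfderiv_comp q h2 h1
  rw [ContinuousLinearMap.mfderiv_eq] at h3
  exact DFunLike.congr_fun h3 (V q)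

theorem sum_coordComp_smul {p q : M} (hq : q ∈ (extChartAt (𝓡 n) p).source) (V : VField n M) :
    V q = ∑ k, coordComp p k V q • coordField p (EuclideanSpace.single k (1 : ℝ)) q := by
  have h : ∀ a : EuclideanSpace ℝ (Fin n),
      coordField p a q = ∑ k, (EuclideanSpace.proj k : EuclideanSpace ℝ (Fin n) →L[ℝ] ℝ) a
        • coordField p (EuclideanSpace.single k (1 : ℝ)) q := fun a ↦ by
    have h1 : a = ∑ k, a k • EuclideanSpace.single k (1 : ℝ) := by
      ext j
      simp [Pi.single_apply]
    have h2 := congrArg (mfderiv (𝓡 n) (𝓡 n) (extChartAt (𝓡 n) p) q).inverse h1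
    exact h2.trans ((map_sum _ _ _).trans (Finset.sum_congr rfl fun k _ ↦ map_smul _ _ _))
  refine (coordField_mfderiv hq (V q)).symm.trans ((h _).trans ?_)
  exact Finset.sum_congr rfl fun k _ ↦ by rw [coordComp_eq hq]

theorem smoothFun_coordComp {p q : M} {V : VField n M}
    [RiemannianBundle (fun x : M ↦ TangentSpace (𝓡 n) x)]
    [IsContMDiffRiemannianBundle (𝓡 n) ∞ (EuclideanSpace ℝ (Fin n))
      (fun x : M ↦ TangentSpace (𝓡 n) x)] (hq : q ∈ (extChartAt (𝓡 n) p).source)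
    (hV : SmoothVec q V) (k : Fin n) : SmoothFun n q (coordComp p k V) := by
  refine SmoothFun.mvfderiv ?_ hV
  filter_upwards [(isOpen_extChartAt_source p).mem_nhds hq] with x hx
  exact (EuclideanSpace.proj k : EuclideanSpace ℝ (Fin n) →L[ℝ] ℝ).contMDiff.contMDiffAt.comp x
    (contMDiffAt_extChartAt' (by simpa using hx))

/-- In the chart the integrand is a directional derivative of a compactly supported smooth function.
-/
theorem integral_mvfderiv_coordField {p : M} {k : M → ℝ} {K : Set M} (hK : IsCompact K)
    (hKs : K ⊆ (extChartAt (𝓡 n) p).source)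
    (hk : ∀ q ∈ (extChartAt (𝓡 n) p).source, SmoothFun n q k) (hk0 : ∀ q ∉ K, k q = 0)
    (a : EuclideanSpace ℝ (Fin n)) :
    IntegrableOn (fun y ↦ mvfderiv (𝓡 n) k ((extChartAt (𝓡 n) p).symm y)
        (coordField p a ((extChartAt (𝓡 n) p).symm y))) (extChartAt (𝓡 n) p).target ∧
      ∫ y in (extChartAt (𝓡 n) p).target, mvfderiv (𝓡 n) k ((extChartAt (𝓡 n) p).symm y)
        (coordField p a ((extChartAt (𝓡 n) p).symm y)) = 0 := by
  set φ := extChartAt (𝓡 n) p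
  have hopen : IsOpen φ.target := isOpen_extChartAt_target p
  -- Extension by zero off the chart target. It is smooth because the image of K is compact, hence
  -- closed, in the whole Euclidean space.
  set F : EuclideanSpace ℝ (Fin n) → ℝ := φ.target.indicator fun y ↦ k (φ.symm y)
  have hK' : IsCompact (φ '' K) :=
    hK.image_of_continuousOn ((continuousOn_extChartAt p).mono hKs)
  have hF0 : ∀ y ∉ φ '' K, F y = 0 := fun y hy ↦ by
    by_cases hyt : y ∈ φ.target
    · exact (Set.indicator_of_mem hyt _).trans (hk0 _ fun h ↦ hy ⟨_, h, φ.right_inv hyt⟩)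
    · exact Set.indicator_of_notMem hyt _
  have hFt : ∀ y ∈ φ.target, F =ᶠ[𝓝 y] fun y ↦ k (φ.symm y) := fun y hy ↦ by
    filter_upwards [hopen.mem_nhds hy] with z hz using Set.indicator_of_mem hz _
  have hFn : ∀ y ∉ φ '' K, F =ᶠ[𝓝 y] fun _ ↦ 0 := fun y hy ↦ by
    filter_upwards [hK'.isClosed.isOpen_compl.mem_nhds hy] with z hz using hF0 z hz
  have hF : ContDiff ℝ ∞ F := contDiff_iff_contDiffAt.2 fun y ↦ by
    by_cases hy : y ∈ φ '' K
    · obtain ⟨x, hx, rfl⟩ := hy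
      have h := φ.map_source (hKs hx)
      exact ((hk _ (φ.map_target h)).contDiffAt_comp_symm h).congr_of_eventuallyEq (hFt _ h)
    · exact contDiffAt_const.congr_of_eventuallyEq (hFn y hy)
  have hFc : HasCompactSupport F := HasCompactSupport.intro hK' hF0
  have h1 : ∀ y ∈ φ.target, mvfderiv (𝓡 n) k (φ.symm y) (coordField p a (φ.symm y))
      = fderiv ℝ F y a := fun y hy ↦ by
    rw [mvfderiv_coordField hy (hk _ (φ.map_target hy)).mdifferentiableAt, (hFt y hy).fderiv_eq]
  have h2 : ∀ y ∉ φ.target, fderiv ℝ F y a = 0 := fun y hy ↦ by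
    have h : y ∉ φ '' K := by
      rintro ⟨x, hx, rfl⟩
      exact hy (φ.map_source (hKs hx))
    rw [(hFn y h).fderiv_eq]
    simp
  have hdF : Continuous fun y ↦ fderiv ℝ F y a :=
    (hF.continuous_fderiv (by simp)).clm_apply continuous_const
  have hdFi : Integrable fun y ↦ fderiv ℝ F y a :=
    hdF.integrable_of_hasCompactSupport
      ((hFc.fderiv ℝ).comp_left (g := fun L : EuclideanSpace ℝ (Fin n) →L[ℝ] ℝ ↦ L a) (by simp))
  constructor
  · exact (integrableOn_congr_fun h1 hopen.measurableSet).2 hdFi.integrableOn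
  · rw [setIntegral_congr_fun hopen.measurableSet h1,
      setIntegral_eq_integral_of_forall_compl_eq_zero h2]
    -- Integration by parts against the constant function 1.
    have h := integral_mul_fderiv_eq_neg_fderiv_mul_of_integrable (μ := volume)
      (f := fun _ : EuclideanSpace ℝ (Fin n) ↦ (1 : ℝ)) (g := F) (v := a) (by simp)
      (by simpa using hdFi) (by simpa using hF.continuous.integrable_of_hasCompactSupport hFc)
      (fun _ _ ↦ differentiableAt_const _) (fun y _ ↦ hF.differentiable (by simp) y)
    simpa using h

variable [RiemannianBundle (fun x : M ↦ TangentSpace (𝓡 n) x)]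
  [IsContMDiffRiemannianBundle (𝓡 n) ∞ (EuclideanSpace ℝ (Fin n))
    (fun x : M ↦ TangentSpace (𝓡 n) x)]

/-- The coordinate formula for the divergence. -/
theorem trace_nabla_mul_volDensity {p q : M} {V : VField n M}
    (hq : q ∈ (extChartAt (𝓡 n) p).source) (hV : SmoothVec q V) :
    trace (nabla V) q * volDensity n p q
      = ∑ k, mvfderiv (𝓡 n) (fun x ↦ volDensity n p x * coordComp p k V x) q
          (coordField p (EuclideanSpace.single k (1 : ℝ)) q) := by
  obtain ⟨b, hb⟩ := exists_coordBasis hq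
  set X : Fin n → VField n M := fun i ↦ coordField p (EuclideanSpace.single i (1 : ℝ))
  have hX : ∀ i, SmoothVec q (X i) := fun i ↦ smoothVec_coordField hq _
  replace hb : ∀ i, b i = X i q := hb
  have hW : ∀ k, SmoothFun n q (coordComp p k V) := smoothFun_coordComp hq hV
  have h1 : ∀ᶠ x in 𝓝 q, V x = ∑ k, coordComp p k V x • X k x := by
    filter_upwards [(isOpen_extChartAt_source p).mem_nhds hq] with x hx
      using sum_coordComp_smul hx V
  have h2 : ∀ v, nabla V q v = ∑ k, (coordComp p k V q • nabla (X k) q v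
      + mvfderiv (𝓡 n) (coordComp p k V) q v • X k q) := fun v ↦ by
    rw [nabla_congr (SmoothVec.sum (s := Finset.univ) fun i _ ↦
      SmoothVec.smul (hW i) (hX i)).mdifferentiableAt h1, nabla_sum_smul hW hX]
  rw [trace_eq_sum_repr hV.smoothEndAt_nabla.isLinearMap b]
  -- div V = ∑ (Vᵏ div ∂ₖ + ∂ₖVᵏ); the first summand is supplied by the logarithmic derivative of
  -- the density.
  have h3 : ∑ i, b.repr (nabla V q (b i)) i = ∑ k, (coordComp p k V q * trace (nabla (X k)) q
      + mvfderiv (𝓡 n) (coordComp p k V) q (X k q)) := by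
    simp only [h2, map_sum, map_add, map_smul, Finsupp.coe_finsetSum, Finset.sum_apply,
      Finsupp.add_apply, Finsupp.smul_apply, smul_eq_mul, Finset.sum_add_distrib]
    congr 1
    · rw [Finset.sum_comm]
      refine Finset.sum_congr rfl fun k _ ↦ ?_
      rw [trace_eq_sum_repr (hX k).smoothEndAt_nabla.isLinearMap b, Finset.mul_sum]
    · simp [← hb, Finsupp.single_apply]
  rw [h3, Finset.sum_mul]
  refine Finset.sum_congr rfl fun k _ ↦ ?_
  have hD := (smoothFun_volDensity hq).mdifferentiableAt
  have h4 : mvfderiv (𝓡 n) (fun x ↦ volDensity n p x * coordComp p k V x) q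
      = mvfderiv (𝓡 n) (volDensity n p * coordComp p k V) q := rfl
  rw [h4, mvfderiv_mul hD (hW k).mdifferentiableAt]
  simp only [add_apply, smul_apply, smul_eq_mul]
  rw [mvfderiv_volDensity hq]
  ring

/-- The divergence of a vector field which is supported in the domain of a chart integrates to
zero. -/
theorem integral_trace_nabla_of_support {p : M} {V : VField n M} {K : Set M} (hK : IsCompact K)
    (hKs : K ⊆ (extChartAt (𝓡 n) p).source)
    (hV : ∀ q ∈ (extChartAt (𝓡 n) p).source, SmoothVec q V) (hV0 : ∀ q ∉ K, V q = 0) :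
    ∫ y in (extChartAt (𝓡 n) p).target,
      trace (nabla V) ((extChartAt (𝓡 n) p).symm y) * chartDensity p y = 0 := by
  have h := fun k : Fin n ↦ integral_mvfderiv_coordField hK hKs
    (k := fun x ↦ volDensity n p x * coordComp p k V x)
    (fun q hq ↦ (smoothFun_volDensity hq).mul (smoothFun_coordComp hq (hV q hq) k))
    (fun q hq ↦ by simp [coordComp, hV0 q hq]) (EuclideanSpace.single k (1 : ℝ))
  rw [setIntegral_congr_fun (isOpen_extChartAt_target p).measurableSet (g := fun y ↦
    ∑ k, mvfderiv (𝓡 n) (fun x ↦ volDensity n p x * coordComp p k V x)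
      ((extChartAt (𝓡 n) p).symm y)
      (coordField p (EuclideanSpace.single k (1 : ℝ)) ((extChartAt (𝓡 n) p).symm y))),
    integral_finsetSum _ fun k _ ↦ (h k).1]
  · exact Finset.sum_eq_zero fun k _ ↦ (h k).2
  · intro y hy
    have hq := (extChartAt (𝓡 n) p).map_target hy
    simp only [chartDensity_eq hy]
    exact trace_nabla_mul_volDensity hq (hV _ hq)

omit [IsContMDiffRiemannianBundle (𝓡 n) ∞ (EuclideanSpace ℝ (Fin n))
    (fun x : M ↦ TangentSpace (𝓡 n) x)] in
theorem coordField_eq_sum (p q : M) (a : EuclideanSpace ℝ (Fin n)) :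
    coordField p a q = ∑ k, a k • coordField p (EuclideanSpace.single k (1 : ℝ)) q := by
  have h1 : a = ∑ k, a k • EuclideanSpace.single k (1 : ℝ) := by
    ext j
    simp [Pi.single_apply]
  have h2 := congrArg (mfderiv (𝓡 n) (𝓡 n) (extChartAt (𝓡 n) p) q).inverse h1
  exact h2.trans ((map_sum _ _ _).trans (Finset.sum_congr rfl fun k _ ↦ map_smul _ _ _))

omit [IsContMDiffRiemannianBundle (𝓡 n) ∞ (EuclideanSpace ℝ (Fin n))
    (fun x : M ↦ TangentSpace (𝓡 n) x)] in
/-- The transformation law of the volume density. -/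
theorem volDensity_eq_abs_det_mul {p q x : M}
    (T : EuclideanSpace ℝ (Fin n) →L[ℝ] EuclideanSpace ℝ (Fin n))
    (hT : ∀ a, coordField q a x = coordField p (T a) x) :
    volDensity n q x = |T.det| * volDensity n p x := by
  set t : Matrix (Fin n) (Fin n) ℝ := Matrix.of fun k i ↦ T (EuclideanSpace.single i (1 : ℝ)) k
  have h1 : coordGram (n := n) q x = t.transpose * coordGram p x * t := by
    ext i j
    simp only [coordGram, Matrix.of_apply, hT]
    rw [coordField_eq_sum p x (T (EuclideanSpace.single i 1)),
      coordField_eq_sum p x (T (EuclideanSpace.single j 1)), inner_sum, Matrix.mul_apply]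
    refine Finset.sum_congr rfl fun l _ ↦ ?_
    rw [sum_inner, Matrix.mul_apply, Finset.sum_mul]
    refine Finset.sum_congr rfl fun k _ ↦ ?_
    simp only [real_inner_smul_left, real_inner_smul_right, Matrix.transpose_apply, t,
      Matrix.of_apply]
    ring
  have h2 : t.det = T.det := by
    rw [ContinuousLinearMap.det, ← LinearMap.det_toMatrix
      (EuclideanSpace.basisFun (Fin n) ℝ).toBasis]
    congr 1
  rw [volDensity, volDensity, h1, Matrix.det_mul, Matrix.det_mul, Matrix.det_transpose, h2,
    show T.det * (coordGram (n := n) p x).det * T.det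
      = T.det ^ 2 * (coordGram (n := n) p x).det by ring,
    Real.sqrt_mul (sq_nonneg _), Real.sqrt_sq_eq_abs]

omit [IsContMDiffRiemannianBundle (𝓡 n) ∞ (EuclideanSpace ℝ (Fin n))
    (fun x : M ↦ TangentSpace (𝓡 n) x)] in
/-- The integral of a function against the Riemannian volume may be computed in any chart. -/
theorem integral_chart_eq {p q : M} {g : M → ℝ}
    (hp : ∀ x ∉ (extChartAt (𝓡 n) p).source, g x = 0)
    (hq : ∀ x ∉ (extChartAt (𝓡 n) q).source, g x = 0) :
    ∫ y in (extChartAt (𝓡 n) p).target, g ((extChartAt (𝓡 n) p).symm y) * chartDensity p y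
      = ∫ y in (extChartAt (𝓡 n) q).target,
        g ((extChartAt (𝓡 n) q).symm y) * chartDensity q y := by
  set φ := extChartAt (𝓡 n) p
  set ψ := extChartAt (𝓡 n) q
  have hopen : ∀ p : M, IsOpen (extChartAt (𝓡 n) p).target := isOpen_extChartAt_target
  set s : Set (EuclideanSpace ℝ (Fin n)) := ψ.target ∩ ψ.symm ⁻¹' φ.source
  have hs : IsOpen s := (continuousOn_extChartAt_symm q).isOpen_inter_preimage
    (isOpen_extChartAt_target q) (isOpen_extChartAt_source p)
  -- The transition map. Its differential relates the two coordinate frames, so its Jacobian is the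
  -- quotient of the two densities.
  set τ : EuclideanSpace ℝ (Fin n) → EuclideanSpace ℝ (Fin n) := fun y ↦ φ (ψ.symm y)
  have hτ : ∀ y ∈ s, HasFDerivAt τ (fderiv ℝ τ y) y ∧ ∀ a,
      coordField q a (ψ.symm y) = coordField p (fderiv ℝ τ y a) (ψ.symm y) := fun y hy ↦ by
    have h1 := mdifferentiableWithinAt_extChartAt_symm (I := 𝓡 n) hy.1
    rw [ModelWithCorners.range_eq_univ, mdifferentiableWithinAt_univ] at h1
    have h2 : MDifferentiableAt (𝓡 n) (𝓡 n) φ (ψ.symm y) :=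
      mdifferentiableAt_extChartAt (by simpa [φ] using hy.2)
    have h3 := h2.comp y h1
    have h4 := mfderiv_comp y h2 h1
    rw [mfderiv_eq_fderiv] at h4
    refine ⟨(mdifferentiableAt_iff_differentiableAt.1 h3).hasFDerivAt, fun a ↦ ?_⟩
    have h5 : fderiv ℝ τ y a = mfderiv (𝓡 n) (𝓡 n) φ (ψ.symm y) (coordField q a (ψ.symm y)) :=
      (DFunLike.congr_fun h4 a).trans (congrArg (mfderiv (𝓡 n) (𝓡 n) φ (ψ.symm y))
        (mfderiv_extChartAt_symm_apply hy.1 a))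
    exact (coordField_mfderiv hy.2 _).symm.trans
      (congrArg (fun z ↦ coordField p z (ψ.symm y)) h5.symm)
  have hinj : Set.InjOn τ s := fun y hy z hz h ↦
    ψ.symm.injOn hy.1 hz.1 (φ.injOn hy.2 hz.2 h)
  have himg : τ '' s = φ.target ∩ φ.symm ⁻¹' ψ.source := by
    ext z
    constructor
    · rintro ⟨y, hy, rfl⟩
      refine ⟨φ.map_source hy.2, ?_⟩
      simp only [Set.mem_preimage, τ, φ.left_inv hy.2]
      exact ψ.map_target hy.1
    · rintro ⟨hz1, hz2⟩
      refine ⟨ψ (φ.symm z), ⟨ψ.map_source hz2, ?_⟩, ?_⟩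
      · simp only [Set.mem_preimage, ψ.left_inv hz2]
        exact φ.map_target hz1
      · simp only [τ, ψ.left_inv hz2, φ.right_inv hz1]
  -- Since g vanishes off each chart domain, both integrals reduce to the overlap.
  have h1 : ∫ y in φ.target, g (φ.symm y) * chartDensity p y
      = ∫ y in τ '' s, g (φ.symm y) * chartDensity p y := by
    rw [himg]
    refine setIntegral_eq_of_subset_of_forall_sdiff_eq_zero (hopen p).measurableSet
      Set.inter_subset_left fun y hy ↦ ?_
    rw [hq _ fun h ↦ hy.2 ⟨hy.1, h⟩, zero_mul]
  have h2 : ∫ y in ψ.target, g (ψ.symm y) * chartDensity q y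
      = ∫ y in s, g (ψ.symm y) * chartDensity q y := by
    refine setIntegral_eq_of_subset_of_forall_sdiff_eq_zero (hopen q).measurableSet
      Set.inter_subset_left fun y hy ↦ ?_
    rw [hp _ fun h ↦ hy.2 ⟨hy.1, h⟩, zero_mul]
  rw [h1, h2, integral_image_eq_integral_abs_det_fderiv_smul volume hs.measurableSet
    (fun y hy ↦ (hτ y hy).1.hasFDerivWithinAt) hinj]
  refine setIntegral_congr_fun hs.measurableSet fun y hy ↦ ?_
  have h3 : φ.symm (τ y) = ψ.symm y := φ.left_inv hy.2
  have h4 : chartDensity p (τ y) = volDensity n p (ψ.symm y) :=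
    (chartDensity_eq (φ.map_source hy.2)).trans (congrArg _ h3)
  simp only [smul_eq_mul, chartDensity_eq hy.1, h3, h4]
  rw [volDensity_eq_abs_det_mul _ (hτ y hy).2]
  ring

theorem integrableOn_chart {p : M} {g : M → ℝ} {K : Set M} (hK : IsCompact K)
    (hKs : K ⊆ (extChartAt (𝓡 n) p).source) (hg : Continuous g) (hg0 : ∀ x ∉ K, g x = 0) :
    IntegrableOn (fun y ↦ g ((extChartAt (𝓡 n) p).symm y) * chartDensity p y)
      (extChartAt (𝓡 n) p).target := by
  set φ := extChartAt (𝓡 n) p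
  have hK' : IsCompact (φ '' K) :=
    hK.image_of_continuousOn ((continuousOn_extChartAt p).mono hKs)
  have hsub : φ '' K ⊆ φ.target := by
    rintro _ ⟨x, hx, rfl⟩
    exact φ.map_source (hKs hx)
  have hD : ContinuousOn (chartDensity (n := n) p) φ.target := by
    refine ContinuousOn.congr (f := fun y ↦ volDensity n p (φ.symm y)) ?_
      fun y hy ↦ chartDensity_eq hy
    exact ContinuousOn.comp (g := volDensity n p) (t := φ.source) (fun x hx ↦
      (smoothFun_volDensity hx).contMDiffAt.continuousAt.continuousWithinAt)
      (continuousOn_extChartAt_symm p) fun y hy ↦ φ.map_target hy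
  have hc : ContinuousOn (fun y ↦ g (φ.symm y) * chartDensity p y) φ.target :=
    (hg.comp_continuousOn (continuousOn_extChartAt_symm p)).mul hD
  refine ((hc.mono hsub).integrableOn_compact hK').of_forall_sdiff_eq_zero
    (isOpen_extChartAt_target p).measurableSet fun y hy ↦ ?_
  rw [hg0 _ fun h ↦ hy.2 ⟨_, h, φ.right_inv hy.1⟩, zero_mul]

end ChartIntegrals

/-! ### Contractions, traces and divergences of tensor fields -/

section Contractions

variable {n : ℕ} {M : Type*} [TopologicalSpace M] [ChartedSpace (EuclideanSpace ℝ (Fin n)) M]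
  [IsManifold (𝓡 n) ∞ M] [RiemannianBundle (fun x : M ↦ TangentSpace (𝓡 n) x)]
  [IsContMDiffRiemannianBundle (𝓡 n) ∞ (EuclideanSpace ℝ (Fin n))
    (fun x : M ↦ TangentSpace (𝓡 n) x)]

theorem isBilinearMap_inner_apply {V : Type*} [NormedAddCommGroup V] [InnerProductSpace ℝ V]
    {A B : V → V} (hA : IsLinearMap ℝ A) (hB : IsLinearMap ℝ B) :
    IsBilinearMap ℝ fun u v ↦ inner ℝ (A u) (B v) := by
  constructor <;> intros <;>
    simp [hA.map_add, hA.map_smul, hB.map_add, hB.map_smul, inner_add_left, inner_add_right,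
      real_inner_smul_left, real_inner_smul_right]

theorem isLinearMap_id' {V : Type*} [AddCommGroup V] [Module ℝ V] :
    IsLinearMap ℝ fun v : V ↦ v := ⟨fun _ _ ↦ rfl, fun _ _ ↦ rfl⟩

theorem _root_.IsBilinearMap.isLinearMap_right {V W : Type*} [AddCommGroup V] [Module ℝ V]
    [AddCommGroup W] [Module ℝ W] {Φ : V → V → W} (h : IsBilinearMap ℝ Φ) (u : V) :
    IsLinearMap ℝ (Φ u) := ⟨fun _ _ ↦ h.add_right _ _ _, fun _ _ ↦ h.smul_right _ _ _⟩

theorem _root_.IsBilinearMap.isLinearMap_left {V W : Type*} [AddCommGroup V] [Module ℝ V]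
    [AddCommGroup W] [Module ℝ W] {Φ : V → V → W} (h : IsBilinearMap ℝ Φ) (v : V) :
    IsLinearMap ℝ (fun u ↦ Φ u v) := ⟨fun _ _ ↦ h.add_left _ _ _, fun _ _ ↦ h.smul_left _ _ _⟩

/-- A contraction of a smooth tensor field is smooth. -/
theorem SmoothBiAt.contract {α : BiField n M} {x : M} (hα : SmoothBiAt x α) :
    SmoothVec x fun y ↦ ∑ i, α y (frame y i) (frame y i) := by
  obtain ⟨e, he, hb⟩ := exists_orthonormal_frame (n := n) x
  refine (SmoothVec.sum (s := Finset.univ) fun i _ ↦ hα.apply (he i) (he i)).congr ?_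
  filter_upwards [hα, hb] with y h1 ⟨b, hb⟩
  rw [sum_eq_of_isBilinearMap _ b h1.1]
  simp only [hb]

theorem SmoothEndAt.innerEnd {A B : EndField n M} {x : M} (hA : SmoothEndAt x A)
    (hB : SmoothEndAt x B) : SmoothFun n x (innerEnd A B) := by
  obtain ⟨e, he, hb⟩ := exists_orthonormal_frame (n := n) x
  refine (SmoothFun.sum (s := Finset.univ)
    fun i _ ↦ (hA.apply (he i)).inner (hB.apply (he i))).congr ?_
  filter_upwards [hA, hB, hb] with y h1 h2 ⟨b, hb⟩
  rw [KaehlerEinstein.innerEnd, sum_eq_of_isBilinearMap _ b (isBilinearMap_inner_apply h1.1 h2.1)]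
  simp only [hb]

theorem smoothEndAt_id (x : M) : SmoothEndAt x (fun (y : M) (v : TangentSpace (𝓡 n) y) ↦ v) :=
  Eventually.of_forall fun _ ↦ ⟨isLinearMap_id', fun _ hY ↦ hY⟩

theorem SmoothEndAt.trace {A : EndField n M} {x : M} (hA : SmoothEndAt x A) :
    SmoothFun n x (trace A) := hA.innerEnd (smoothEndAt_id x)

theorem sum_sum_eq_of_isBilinearMap {V : Type*} [NormedAddCommGroup V] [InnerProductSpace ℝ V]
    {ι κ : Type*} [Fintype ι] [Fintype κ] (e : OrthonormalBasis ι ℝ V)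
    (f : OrthonormalBasis κ ℝ V) {α β : V → V → V}
    (hα : IsBilinearMap ℝ α) (hβ : IsBilinearMap ℝ β) :
    ∑ i, ∑ j, inner ℝ (α (e i) (e j)) (β (e i) (e j))
      = ∑ i, ∑ j, inner ℝ (α (f i) (f j)) (β (f i) (f j)) := by
  have h1 : ∀ u, ∑ j, inner ℝ (α u (e j)) (β u (e j)) = ∑ j, inner ℝ (α u (f j)) (β u (f j)) :=
    fun u ↦ sum_eq_of_isBilinearMap e f (isBilinearMap_inner_apply
      (hα.isLinearMap_right u) (hβ.isLinearMap_right u))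
  simp only [h1]
  rw [Finset.sum_comm]
  refine Eq.trans ?_ Finset.sum_comm
  exact Finset.sum_congr rfl fun j _ ↦ sum_eq_of_isBilinearMap e f (isBilinearMap_inner_apply
    (hα.isLinearMap_left _) (hβ.isLinearMap_left _))

theorem SmoothBiAt.innerForm {α β : BiField n M} {x : M} (hα : SmoothBiAt x α)
    (hβ : SmoothBiAt x β) : SmoothFun n x (innerForm α β) := by
  obtain ⟨e, he, hb⟩ := exists_orthonormal_frame (n := n) x
  refine ((SmoothFun.const (1 / 2)).mul (SmoothFun.sum (s := Finset.univ)
    fun i _ ↦ SmoothFun.sum (s := Finset.univ)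
    fun j _ ↦ (hα.apply (he i) (he j)).inner (hβ.apply (he i) (he j)))).congr ?_
  filter_upwards [hα, hβ, hb] with y h1 h2 ⟨b, hb⟩
  rw [KaehlerEinstein.innerForm, sum_sum_eq_of_isBilinearMap _ b h1.1 h2.1]
  simp only [hb]

/-- The connection form of an orthonormal frame is skew-symmetric. -/
theorem sum_nabla_orthonormal {W : Type*} [AddCommGroup W] [Module ℝ W] {x : M}
    {e : Fin n → VField n M} (he : ∀ i, SmoothVec x (e i))
    (hb : ∀ᶠ y in 𝓝 x, ∃ b : OrthonormalBasis (Fin n) ℝ (TangentSpace (𝓡 n) y), ∀ i, b i = e i y)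
    {Φ : TangentSpace (𝓡 n) x → TangentSpace (𝓡 n) x → W} (hΦ : IsBilinearMap ℝ Φ)
    (u : TangentSpace (𝓡 n) x) :
    ∑ i, (Φ (nabla (e i) x u) (e i x) + Φ (e i x) (nabla (e i) x u)) = 0 := by
  obtain ⟨b, hb'⟩ := hb.self_of_nhds
  -- Differentiate g(eᵢ, eⱼ) = δᵢⱼ.
  have hskew : ∀ i j, inner ℝ (e j x) (nabla (e i) x u) = -inner ℝ (e i x) (nabla (e j) x u) := by
    intro i j
    have h1 := nabla_inner (he i).mdifferentiableAt (he j).mdifferentiableAt u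
    have h2 : (fun y ↦ inner ℝ (e i y) (e j y)) =ᶠ[𝓝 x] fun _ ↦ (if i = j then 1 else 0 : ℝ) := by
      filter_upwards [hb] with y ⟨b, hb⟩
      rw [← hb, ← hb]
      exact orthonormal_iff_ite.1 b.orthonormal i j
    rw [mvfderiv_congr h2, mvfderiv_const, real_inner_comm] at h1
    simp only [zero_apply] at h1
    linarith
  have h3 : ∀ i, nabla (e i) x u = ∑ j, inner ℝ (e j x) (nabla (e i) x u) • e j x := fun i ↦ by
    conv_lhs => rw [← b.sum_repr' (nabla (e i) x u)]
    simp [hb']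
  let L : TangentSpace (𝓡 n) x →ₗ[ℝ] TangentSpace (𝓡 n) x →ₗ[ℝ] W := hΦ.toLinearMap
  have hL : ∀ u v, Φ u v = L u v := fun _ _ ↦ rfl
  rw [Finset.sum_add_distrib]
  have h4 : ∑ i, Φ (nabla (e i) x u) (e i x)
      = ∑ i, ∑ j, inner ℝ (e j x) (nabla (e i) x u) • Φ (e j x) (e i x) := by
    refine Finset.sum_congr rfl fun i _ ↦ ?_
    conv_lhs => rw [h3]
    simp only [hL, map_sum, map_smul, LinearMap.sum_apply, LinearMap.smul_apply]
  have h5 : ∑ i, Φ (e i x) (nabla (e i) x u)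
      = ∑ i, ∑ j, inner ℝ (e j x) (nabla (e i) x u) • Φ (e i x) (e j x) := by
    refine Finset.sum_congr rfl fun i _ ↦ ?_
    conv_lhs => rw [h3]
    simp only [hL, map_sum, map_smul]
  rw [h4, h5, Finset.sum_comm, ← Finset.sum_add_distrib]
  refine Finset.sum_eq_zero fun i _ ↦ ?_
  rw [← Finset.sum_add_distrib]
  refine Finset.sum_eq_zero fun j _ ↦ ?_
  rw [hskew, neg_smul, neg_add_cancel]

/-- Contractions commute with covariant derivatives. -/
theorem nabla_contract {α : BiField n M} {x : M} (hα : SmoothBiAt x α)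
    (u : TangentSpace (𝓡 n) x) :
    nabla (fun y ↦ ∑ i, α y (frame y i) (frame y i)) x u
      = ∑ i, nablaBi α x u (frame x i) (frame x i) := by
  obtain ⟨e, he, hb⟩ := exists_orthonormal_frame (n := n) x
  -- `frame` is chosen point by point and need not be continuous, so a smooth frame is substituted
  -- before differentiating.
  have h1 : ∀ᶠ y in 𝓝 x, ∑ i, α y (frame y i) (frame y i)
      = ∑ i, (fun _ ↦ (1 : ℝ)) y • α y (e i y) (e i y) := by
    filter_upwards [hα, hb] with y h1 ⟨b, hb⟩
    rw [sum_eq_of_isBilinearMap _ b h1.1]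
    simp only [hb, one_smul]
  have hs : ∀ i, SmoothVec x fun y ↦ α y (e i y) (e i y) := fun i ↦ hα.apply (he i) (he i)
  rw [nabla_congr (SmoothVec.sum (s := Finset.univ) fun i _ ↦
      SmoothVec.smul (SmoothFun.const 1) (hs i)).mdifferentiableAt h1,
    nabla_sum_smul (fun _ ↦ SmoothFun.const 1) hs]
  obtain ⟨b, hb'⟩ := hb.self_of_nhds
  rw [sum_eq_of_isBilinearMap _ b (isBilinearMap_nablaBi hα u)]
  simp only [mvfderiv_const, zero_apply, zero_smul, add_zero, one_smul,
    nabla_applyBi hα (he _) (he _), hb', add_assoc]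
  rw [Finset.sum_add_distrib, sum_nabla_orthonormal he hb hα.isBilinearMap, add_zero]

theorem mvfderiv_sum {ι : Type*} {s : Finset ι} {f : ι → M → ℝ} {x : M}
    (hf : ∀ i, SmoothFun n x (f i)) (u : TangentSpace (𝓡 n) x) :
    mvfderiv (𝓡 n) (fun y ↦ ∑ i ∈ s, f i y) x u = ∑ i ∈ s, mvfderiv (𝓡 n) (f i) x u := by
  classical
  induction s using Finset.induction_on with
  | empty => simp [mvfderiv_const]
  | insert a s ha ih =>
    simp only [Finset.sum_insert ha, ← ih]
    have h : (fun y ↦ f a y + ∑ i ∈ s, f i y) = f a + fun y ↦ ∑ i ∈ s, f i y := rfl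
    rw [h, mvfderiv_add (hf a).mdifferentiableAt
      (SmoothFun.sum fun i _ ↦ hf i).mdifferentiableAt]
    rfl

/-- The derivative of a trace. -/
theorem mvfderiv_trace {A : EndField n M} {x : M} (hA : SmoothEndAt x A)
    (u : TangentSpace (𝓡 n) x) :
    mvfderiv (𝓡 n) (trace A) x u = ∑ i, inner ℝ (nablaEnd A x u (frame x i)) (frame x i) := by
  obtain ⟨e, he, hb⟩ := exists_orthonormal_frame (n := n) x
  have h1 : trace A =ᶠ[𝓝 x] fun y ↦ ∑ i, inner ℝ (A y (e i y)) (e i y) := by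
    filter_upwards [hA, hb] with y h1 ⟨b, hb⟩
    rw [trace, sum_eq_of_isBilinearMap _ b (isBilinearMap_inner_apply h1.1 isLinearMap_id')]
    simp only [hb]
  have hs : ∀ i, SmoothVec x fun y ↦ A y (e i y) := fun i ↦ hA.apply (he i)
  rw [mvfderiv_congr h1, mvfderiv_sum fun i ↦ (hs i).inner (he i)]
  obtain ⟨b, hb'⟩ := hb.self_of_nhds
  rw [sum_eq_of_isBilinearMap _ b (isBilinearMap_inner_apply
    ((isBilinearMap_nablaEnd hA).isLinearMap_right u) isLinearMap_id')]
  simp only [nabla_inner (hs _).mdifferentiableAt (he _).mdifferentiableAt,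
    nabla_applyField hA (he _), hb', inner_add_left, add_assoc]
  rw [Finset.sum_add_distrib, sum_nabla_orthonormal he hb
    (isBilinearMap_inner_apply hA.isLinearMap isLinearMap_id'), add_zero]

/-- The vector field `V` with `g(V, u) = ∑ k, g(α(u, e_k), e_k)`. -/
def traceField (α : BiField n M) : VField n M :=
  fun x ↦ ∑ j, trace (fun y v ↦ α y (extendVec (frame x j) y) v) x • frame x j

theorem trace_extendVec (α : BiField n M) (x : M) (u : TangentSpace (𝓡 n) x) :
    trace (fun y v ↦ α y (extendVec u y) v) x
      = ∑ k, inner ℝ (α x u (frame x k)) (frame x k) := by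
  simp [trace]

theorem isLinearMap_sum_inner {α : BiField n M} {x : M} (hα : IsBilinearMap ℝ (α x)) :
    IsLinearMap ℝ fun u ↦ ∑ k, inner ℝ (α x u (frame x k)) (frame x k) where
  map_add u v := by simp only [hα.add_left, inner_add_left, Finset.sum_add_distrib]
  map_smul c u := by simp only [hα.smul_left, real_inner_smul_left, Finset.mul_sum, smul_eq_mul]

theorem inner_traceField {α : BiField n M} {x : M} (hα : IsBilinearMap ℝ (α x))
    (u : TangentSpace (𝓡 n) x) :
    inner ℝ (traceField α x) u = ∑ k, inner ℝ (α x u (frame x k)) (frame x k) := by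
  have h := sum_inner_smul_eq (frame x) ((isLinearMap_sum_inner hα).mk' _) u
  refine Eq.trans ?_ h
  simp only [traceField, trace_extendVec, sum_inner, real_inner_smul_left, smul_eq_mul]
  refine Finset.sum_congr rfl fun j _ ↦ ?_
  rw [mul_comm, real_inner_comm]
  rfl

theorem SmoothVec.traceField {α : BiField n M} {x : M} (hα : SmoothBiAt x α) :
    SmoothVec x (traceField α) := by
  obtain ⟨e, he, hb⟩ := exists_orthonormal_frame (n := n) x
  refine (SmoothVec.sum (s := Finset.univ) fun i _ ↦
    SmoothVec.smul (hα.applyLeft (he i)).trace (he i)).congr ?_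
  filter_upwards [hα, hb] with y h1 ⟨b, hb⟩
  conv_lhs => rw [← b.sum_repr' (KaehlerEinstein.traceField α y)]
  refine Finset.sum_congr rfl fun i _ ↦ ?_
  rw [real_inner_comm, inner_traceField h1.1, hb]
  rfl

/-- Differentiate g(V, W) = tr α(W, ·) for an extension W of a frame vector; the terms in ∇W cancel.
This formula underlies every integration by parts below. -/
theorem trace_nabla_traceField {α : BiField n M} {x : M} (hα : SmoothBiAt x α) :
    trace (nabla (traceField α)) x
      = ∑ i, ∑ k, inner ℝ (nablaBi α x (frame x i) (frame x i) (frame x k)) (frame x k) := by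
  refine Finset.sum_congr rfl fun i _ ↦ ?_
  set w := frame x i
  have hV := SmoothVec.traceField hα
  have hW := smoothVec_extendVec w
  have h1 := nabla_inner hV.mdifferentiableAt hW.mdifferentiableAt w
  have h2 : (fun y ↦ inner ℝ (traceField α y) (extendVec w y))
      =ᶠ[𝓝 x] trace (fun y v ↦ α y (extendVec w y) v) := by
    filter_upwards [hα] with y hy using inner_traceField hy.1 _
  rw [mvfderiv_congr h2, mvfderiv_trace (hα.applyLeft hW), inner_traceField hα.isBilinearMap,
    extendVec_self] at h1
  rw [← sub_eq_iff_eq_add] at h1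
  refine h1.symm.trans ?_
  rw [← Finset.sum_sub_distrib]
  refine Finset.sum_congr rfl fun k _ ↦ ?_
  rw [nablaBi_eq_nablaEnd_left, inner_sub_left]

theorem SmoothVec.divEnd {A : EndField n M} {x : M} (hA : SmoothEndAt x A) :
    SmoothVec x (divEnd A) := hA.nablaEnd.contract.neg

theorem nabla_divEnd {A : EndField n M} {x : M} (hA : SmoothEndAt x A)
    (u : TangentSpace (𝓡 n) x) :
    nabla (divEnd A) x u = -∑ i, nablaBi (nablaEnd A) x u (frame x i) (frame x i) := by
  have h := nabla_smul (mdifferentiableAt_const (c := (-1 : ℝ)))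
    hA.nablaEnd.contract.mdifferentiableAt u
  rw [nabla_contract hA.nablaEnd, mvfderiv_const] at h
  simp only [zero_apply, zero_smul, add_zero, neg_one_smul] at h
  exact h

theorem inner_gradient (f : M → ℝ) (x : M) (u : TangentSpace (𝓡 n) x) :
    inner ℝ (gradient f x) u = mvfderiv (𝓡 n) f x u := by
  have h := sum_inner_smul_eq (frame x) (mvfderiv (𝓡 n) f x).toLinearMap u
  refine Eq.trans ?_ h
  simp only [gradient, sum_inner, real_inner_smul_left, smul_eq_mul]
  refine Finset.sum_congr rfl fun j _ ↦ ?_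
  rw [mul_comm, real_inner_comm]
  rfl

theorem SmoothVec.gradient {f : M → ℝ} {x : M} (hf : SmoothFun n x f) :
    SmoothVec x (gradient (n := n) f) := by
  obtain ⟨e, he, hb⟩ := exists_orthonormal_frame (n := n) x
  refine (SmoothVec.sum (s := Finset.univ) fun i _ ↦
    SmoothVec.smul (hf.mvfderiv (he i)) (he i)).congr ?_
  filter_upwards [hb] with y ⟨b, hb⟩
  conv_lhs => rw [← b.sum_repr' (KaehlerEinstein.gradient (n := n) f y)]
  refine Finset.sum_congr rfl fun i _ ↦ ?_
  rw [real_inner_comm, inner_gradient, hb]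

theorem inner_transp {A : EndField n M} {x : M} (hA : IsLinearMap ℝ (A x))
    (u v : TangentSpace (𝓡 n) x) : inner ℝ (transp A x u) v = inner ℝ u (A x v) := by
  have h := sum_inner_smul_eq (frame x)
    ((innerₗ (TangentSpace (𝓡 n) x) u).comp (hA.mk' (A x))) v
  refine Eq.trans ?_ h
  simp only [transp, sum_inner, real_inner_smul_left, smul_eq_mul]
  refine Finset.sum_congr rfl fun j _ ↦ ?_
  rw [mul_comm, real_inner_comm, real_inner_comm u]
  rfl

theorem SmoothBiAt.divForm {α : BiField n M} {x : M} (hα : SmoothBiAt x α) :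
    SmoothEndAt x (divForm α) := by
  -- With the last argument frozen along Z, the divergence becomes a contraction of a smooth tensor
  -- in two slots.
  have key : ∀ (Z : VField n M) (y : M), SmoothBiAt y α → SmoothVec y Z →
      SmoothBiAt y (fun z u v ↦ nablaBi α z u v (Z z)) := by
    intro Z y hy hZ
    filter_upwards [hy.eventually, hZ.eventually] with z h1 h2
    refine ⟨⟨fun _ _ _ ↦ (isLinearMap_nablaBi h1 _ _).map_add _ _,
      fun _ _ _ ↦ (isLinearMap_nablaBi h1 _ _).map_smul _ _,
      fun _ _ _ ↦ (isBilinearMap_nablaBi h1 _).add_left _ _ _,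
      fun _ _ _ ↦ (isBilinearMap_nablaBi h1 _).smul_left _ _ _⟩, fun X Y hX hY ↦ ?_⟩
    refine ((((h1.apply hY h2).nabla hX).sub (h1.apply (hY.nabla hX) h2)).sub
      (h1.apply hY (h2.nabla hX))).congr ?_
    filter_upwards [h1.eventually, h2.eventually, hY.eventually] with w k1 k2 k3
    exact nablaBi_apply k1 k3 k2 _
  filter_upwards [hα.eventually] with y hy
  refine ⟨⟨fun u v ↦ ?_, fun c u ↦ ?_⟩, fun Z hZ ↦ ?_⟩
  · simp only [KaehlerEinstein.divForm, (isBilinearMap_nablaBi hy _).add_right,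
      Finset.sum_add_distrib, neg_add]
  · simp only [KaehlerEinstein.divForm, (isBilinearMap_nablaBi hy _).smul_right,
      ← Finset.smul_sum, smul_neg]
  · exact (key Z y hy hZ).contract.neg

end Contractions

/-! ### The divergence theorem -/

section Divergence

variable {n : ℕ} {M : Type*} [TopologicalSpace M] [ChartedSpace (EuclideanSpace ℝ (Fin n)) M]
  [IsManifold (𝓡 n) ∞ M] [CompactSpace M] [T2Space M]

theorem tsupport_chartPartition (p : M) :
    tsupport (chartPartition n M p) ⊆ (extChartAt (𝓡 n) p).source := by
  rw [extChartAt_source]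
  exact Classical.choose_spec
    (SmoothPartitionOfUnity.exists_isSubordinate_chartAt_source (𝓡 n) M) p

theorem isCompact_tsupport_chartPartition (p : M) : IsCompact (tsupport (chartPartition n M p)) :=
  (isClosed_tsupport _).isCompact

theorem chartPartition_eq_zero {p x : M} (hx : x ∉ tsupport (chartPartition n M p)) :
    chartPartition n M p x = 0 := image_eq_zero_of_notMem_tsupport hx

variable (n M) in
-- Local finiteness and compactness leave only finitely many nonzero functions, so `integralVol` is
-- a finite sum.
theorem exists_finset_chartPartition :
    ∃ S : Finset M, (∀ p ∉ S, ∀ x, chartPartition n M p x = 0) ∧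
      ∀ x, ∑ p ∈ S, chartPartition n M p x = 1 := by
  have h := (chartPartition n M).locallyFinite.finite_nonempty_of_compact
  have h0 : ∀ p ∉ h.toFinset, ∀ x, chartPartition n M p x = 0 := fun p hp x ↦ by
    by_contra hx
    exact hp (h.mem_toFinset.2 ⟨x, hx⟩)
  refine ⟨h.toFinset, h0, fun x ↦ ?_⟩
  rw [← (chartPartition n M).sum_eq_one (Set.mem_univ x)]
  refine (finsum_eq_sum_of_support_subset _ fun p hp ↦ ?_).symm
  by_contra hpS
  exact hp (h0 p hpS x)

theorem smoothFun_chartPartition (p x : M) : SmoothFun n x (chartPartition n M p) :=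
  Eventually.of_forall fun _ ↦ (chartPartition n M p).contMDiff.contMDiffAt

theorem continuous_of_smoothFun {f : M → ℝ} (hf : ∀ x, SmoothFun n x f) : Continuous f :=
  continuous_iff_continuousAt.2 fun x ↦ (hf x).contMDiffAt.continuousAt

variable [RiemannianBundle (fun x : M ↦ TangentSpace (𝓡 n) x)]
  [IsContMDiffRiemannianBundle (𝓡 n) ∞ (EuclideanSpace ℝ (Fin n))
    (fun x : M ↦ TangentSpace (𝓡 n) x)]

omit [IsContMDiffRiemannianBundle (𝓡 n) ∞ (EuclideanSpace ℝ (Fin n))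
    (fun x : M ↦ TangentSpace (𝓡 n) x)] in
theorem integralVol_eq_sum {S : Finset M} (hS : ∀ p ∉ S, ∀ x, chartPartition n M p x = 0)
    (f : M → ℝ) :
    integralVol n f = ∑ p ∈ S, ∫ y in (extChartAt (𝓡 n) p).target,
      (chartPartition n M p ((extChartAt (𝓡 n) p).symm y) * f ((extChartAt (𝓡 n) p).symm y))
        * chartDensity p y := by
  refine finsum_eq_sum_of_support_subset _ fun p hp ↦ ?_
  by_contra hpS
  refine hp ?_
  simp [hS p hpS]

theorem integrableOn_chartPartition_mul (p : M) {f : M → ℝ} (hf : Continuous f) :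
    IntegrableOn (fun y ↦ (chartPartition n M p ((extChartAt (𝓡 n) p).symm y)
      * f ((extChartAt (𝓡 n) p).symm y)) * chartDensity p y) (extChartAt (𝓡 n) p).target :=
  integrableOn_chart (g := fun x ↦ chartPartition n M p x * f x)
    (isCompact_tsupport_chartPartition p) (tsupport_chartPartition p)
    ((chartPartition n M p).contMDiff.continuous.mul hf)
    fun x hx ↦ by rw [chartPartition_eq_zero hx, zero_mul]

theorem integralVol_add {f g : M → ℝ} (hf : Continuous f) (hg : Continuous g) :
    integralVol n (fun x ↦ f x + g x) = integralVol n f + integralVol n g := by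
  obtain ⟨S, hS, -⟩ := exists_finset_chartPartition n M
  rw [integralVol_eq_sum hS, integralVol_eq_sum hS, integralVol_eq_sum hS,
    ← Finset.sum_add_distrib]
  refine Finset.sum_congr rfl fun p _ ↦ ?_
  rw [← integral_add (integrableOn_chartPartition_mul p hf) (integrableOn_chartPartition_mul p hg)]
  congr 1
  ext y
  ring

theorem integralVol_const_mul (c : ℝ) (f : M → ℝ) :
    integralVol n (fun x ↦ c * f x) = c * integralVol n f := by
  obtain ⟨S, hS, -⟩ := exists_finset_chartPartition n M
  rw [integralVol_eq_sum hS, integralVol_eq_sum hS, Finset.mul_sum]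
  refine Finset.sum_congr rfl fun p _ ↦ ?_
  rw [← integral_const_mul]
  congr 1
  ext y
  ring

theorem integralVol_sum {ι : Type*} {s : Finset ι} {f : ι → M → ℝ}
    (hf : ∀ i, Continuous (f i)) :
    integralVol n (fun x ↦ ∑ i ∈ s, f i x) = ∑ i ∈ s, integralVol n (f i) := by
  classical
  induction s using Finset.induction_on with
  | empty => simpa using integralVol_const_mul (n := n) 0 (fun _ : M ↦ 0)
  | insert a s ha ih =>
    simp only [Finset.sum_insert ha]
    rw [integralVol_add (hf a) (continuous_finsetSum s fun i _ ↦ hf i), ih]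

/-- The integral of a function which is supported in the domain of a chart. -/
theorem integralVol_of_support {p : M} {g : M → ℝ} {K : Set M} (hK : IsCompact K)
    (hKs : K ⊆ (extChartAt (𝓡 n) p).source) (hg : Continuous g) (hg0 : ∀ x ∉ K, g x = 0) :
    integralVol n g = ∫ y in (extChartAt (𝓡 n) p).target,
      g ((extChartAt (𝓡 n) p).symm y) * chartDensity p y := by
  obtain ⟨S, hS, hS1⟩ := exists_finset_chartPartition n M
  -- The product of g with the q-th partition function vanishes off both chart domains, so each
  -- summand can be moved to the chart at p.
  have h1 : ∀ q, ∫ y in (extChartAt (𝓡 n) q).target,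
      (chartPartition n M q ((extChartAt (𝓡 n) q).symm y) * g ((extChartAt (𝓡 n) q).symm y))
        * chartDensity q y = ∫ y in (extChartAt (𝓡 n) p).target,
      (chartPartition n M q ((extChartAt (𝓡 n) p).symm y) * g ((extChartAt (𝓡 n) p).symm y))
        * chartDensity p y := fun q ↦ by
    refine integral_chart_eq (g := fun x ↦ chartPartition n M q x * g x) (fun x hx ↦ ?_)
      fun x hx ↦ ?_
    · rw [chartPartition_eq_zero fun h ↦ hx (tsupport_chartPartition q h), zero_mul]
    · rw [hg0 _ fun h ↦ hx (hKs h), mul_zero]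
  rw [integralVol_eq_sum hS]
  simp only [h1]
  rw [← integral_finsetSum]
  · congr 1
    ext y
    rw [← Finset.sum_mul, ← Finset.sum_mul, hS1, one_mul]
  · intro q _
    exact integrableOn_chart (g := fun x ↦ chartPartition n M q x * g x) hK hKs
      ((chartPartition n M q).contMDiff.continuous.mul hg) fun x hx ↦ by rw [hg0 x hx, mul_zero]

/-- The divergence theorem. -/
theorem integralVol_trace_nabla {V : VField n M} (hV : ∀ x, SmoothVec x V) :
    integralVol n (trace (nabla V)) = 0 := by
  obtain ⟨S, hS, hS1⟩ := exists_finset_chartPartition n M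
  -- V is cut into pieces supported in charts. The derivatives of the cutoffs need no attention,
  -- since div V is the sum of the divergences of the pieces.
  set W : M → VField n M := fun p x ↦ chartPartition n M p x • V x
  have hW : ∀ p x, SmoothVec x (W p) := fun p x ↦
    SmoothVec.smul (smoothFun_chartPartition p x) (hV x)
  have hc : ∀ p, Continuous (trace (nabla (W p))) := fun p ↦
    continuous_of_smoothFun fun x ↦ (hW p x).smoothEndAt_nabla.trace
  have h1 : trace (nabla V) = fun x ↦ ∑ p ∈ S, trace (nabla (W p)) x := by
    ext x
    have h2 : V = fun y ↦ ∑ p ∈ S, (fun _ ↦ (1 : ℝ)) y • W p y := by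
      ext1 y
      simp only [W, one_smul, ← Finset.sum_smul, hS1]
    have h3 : ∀ v, nabla V x v = ∑ p ∈ S, nabla (W p) x v := fun v ↦ by
      conv_lhs => rw [h2]
      rw [nabla_sum_smul (fun _ ↦ SmoothFun.const 1) fun p ↦ hW p x]
      simp [mvfderiv_const]
    simp only [trace, h3, sum_inner]
    exact Finset.sum_comm
  rw [h1, integralVol_sum hc]
  refine Finset.sum_eq_zero fun p _ ↦ ?_
  have h0 : ∀ x ∉ tsupport (chartPartition n M p), W p x = 0 := fun x hx ↦ by
    simp only [W, chartPartition_eq_zero hx, zero_smul]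
  rw [integralVol_of_support (isCompact_tsupport_chartPartition p) (tsupport_chartPartition p)
    (hc p) fun x hx ↦ ?_]
  · exact integral_trace_nabla_of_support (isCompact_tsupport_chartPartition p)
      (tsupport_chartPartition p) (fun q _ ↦ hW p q) h0
  · have h2 : ∀ᶠ y in 𝓝 x, W p y = (fun _ ↦ (0 : ℝ)) y • V y := by
      filter_upwards [(isClosed_tsupport _).isOpen_compl.mem_nhds hx] with y hy
      rw [h0 y hy, zero_smul]
    have h3 : ∀ v, nabla (W p) x v = 0 := fun v ↦ by
      rw [nabla_congr (SmoothVec.smul (SmoothFun.const 0) (hV x)).mdifferentiableAt h2,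
        nabla_smul (SmoothFun.const 0).mdifferentiableAt (hV x).mdifferentiableAt,
        mvfderiv_const]
      simp
    simp [trace, h3]

end Divergence

/-! ### Sections of Sym^{2,±} on a Kähler–Einstein manifold -/

section KaehlerTriples

variable {n : ℕ} {M : Type*} [TopologicalSpace M] [ChartedSpace (EuclideanSpace ℝ (Fin n)) M]
  [IsManifold (𝓡 n) ∞ M] [RiemannianBundle (fun x : M ↦ TangentSpace (𝓡 n) x)]
  [IsContMDiffRiemannianBundle (𝓡 n) ∞ (EuclideanSpace ℝ (Fin n))
    (fun x : M ↦ TangentSpace (𝓡 n) x)]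

/-- Smooth sections `h` of `Sym^{2,-} TM` and `H` of `Sym^{2,+} TM` on a Kähler–Einstein
manifold. -/
structure IsKaehlerTriple (E : ℝ) (J h H : EndField n M) : Prop where
  kaehler : IsKaehler J
  einstein : IsEinstein n M E
  smooth_J : ∀ x, SmoothEndAt x J
  smooth_h : ∀ x, SmoothEndAt x h
  smooth_H : ∀ x, SmoothEndAt x H
  symMinus : IsSymMinus J h
  symPlus : IsSymPlus J H

/-- A trilinear map as an iterated linear map. -/
def trilinearMap {V : Type*} [AddCommGroup V] [Module ℝ V] (T : V → V → V → V)
    (h1 : ∀ v w, IsLinearMap ℝ fun u ↦ T u v w) (h2 : ∀ u, IsBilinearMap ℝ (T u)) :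
    V →ₗ[ℝ] V →ₗ[ℝ] V →ₗ[ℝ] V where
  toFun u := (h2 u).toLinearMap
  map_add' u u' := by
    ext v w
    exact (h1 v w).map_add u u'
  map_smul' c u := by
    ext v w
    exact (h1 v w).map_smul c u

theorem isBilinearMap_curv {x : M} (u : TangentSpace (𝓡 n) x) : IsBilinearMap ℝ (curv x u) where
  add_left v v' w := by
    rw [curv_skew, curv_add_left, neg_add, ← curv_skew, ← curv_skew]
  smul_left c v w := by
    rw [curv_skew, curv_smul_left, ← smul_neg, ← curv_skew]
  add_right := curv_add_right u
  smul_right c v w := curv_smul_right c u v w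

/-- The curvature as a trilinear map. -/
def curvMap (x : M) : TangentSpace (𝓡 n) x →ₗ[ℝ] TangentSpace (𝓡 n) x →ₗ[ℝ]
    TangentSpace (𝓡 n) x →ₗ[ℝ] TangentSpace (𝓡 n) x :=
  trilinearMap (curv x) (fun v w ↦ ⟨fun u u' ↦ curv_add_left u u' v w,
    fun c u ↦ curv_smul_left c u v w⟩) isBilinearMap_curv

/-- The covariant derivative of a tensor as a trilinear map. -/
def SmoothBiAt.nablaMap {α : BiField n M} {x : M} (hα : SmoothBiAt x α) :
    TangentSpace (𝓡 n) x →ₗ[ℝ] TangentSpace (𝓡 n) x →ₗ[ℝ]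
    TangentSpace (𝓡 n) x →ₗ[ℝ] TangentSpace (𝓡 n) x :=
  trilinearMap (nablaBi α x) (isLinearMap_nablaBi hα) (isBilinearMap_nablaBi hα)

/-- The value of an endomorphism field at `x` as a linear map. -/
def SmoothEndAt.linearMap {A : EndField n M} {x : M} (hA : SmoothEndAt x A) :
    TangentSpace (𝓡 n) x →ₗ[ℝ] TangentSpace (𝓡 n) x := hA.isLinearMap.mk' (A x)

/-- The value of a tensor at `x` as a bilinear map. -/
def SmoothBiAt.linearMap₂ {α : BiField n M} {x : M} (hα : SmoothBiAt x α) :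
    TangentSpace (𝓡 n) x →ₗ[ℝ] TangentSpace (𝓡 n) x →ₗ[ℝ] TangentSpace (𝓡 n) x :=
  hα.isBilinearMap.toLinearMap

namespace IsKaehlerTriple

variable {E : ℝ} {J h H : EndField n M}

theorem J_skew (K : IsKaehlerTriple E J h H) {x : M} (u v : TangentSpace (𝓡 n) x) :
    inner ℝ (J x u) v = -inner ℝ u (J x v) := by
  rw [← K.kaehler.orthogonal x (J x u) v, K.kaehler.sq, inner_neg_left]

/-- Differentiate h = JhJ with ∇J = 0. -/
theorem nablaEnd_h_J (K : IsKaehlerTriple E J h H) {x : M} (u v : TangentSpace (𝓡 n) x) :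
    nablaEnd h x u (J x v) = -J x (nablaEnd h x u v) := by
  have h1 : comp J (comp h J) = h := by
    ext1 y; ext1 w
    have hJ : ∀ w : TangentSpace (𝓡 n) y, J y (-w) = -J y w := fun w ↦
      map_neg (K.smooth_J y).linearMap w
    simp only [comp, K.symMinus.2, hJ, K.kaehler.sq, neg_neg]
  have h2 := nablaEnd_comp (K.smooth_J x) ((K.smooth_h x).comp (K.smooth_J x)) u v
  rw [h1, K.kaehler.parallel, zero_add, nablaEnd_comp (K.smooth_h x) (K.smooth_J x),
    K.kaehler.parallel, (K.smooth_h x).isLinearMap.map_zero, add_zero] at h2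
  rw [h2, K.kaehler.sq, neg_neg]

theorem nablaEnd_H_J (K : IsKaehlerTriple E J h H) {x : M} (u v : TangentSpace (𝓡 n) x) :
    nablaEnd H x u (J x v) = J x (nablaEnd H x u v) := by
  have h1 : comp H J = comp J H := by
    ext1 y; ext1 w
    exact K.symPlus.2 y w
  have h2 := nablaEnd_comp (K.smooth_H x) (K.smooth_J x) u v
  rw [h1, nablaEnd_comp (K.smooth_J x) (K.smooth_H x), K.kaehler.parallel,
    K.kaehler.parallel, (K.smooth_H x).isLinearMap.map_zero, add_zero, zero_add] at h2
  exact h2.symm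

/-- The algebraic relations between the tensors at a point. -/
theorem jet (K : IsKaehlerTriple E J h H) (x : M) :
    KaehlerJet (frame x) E (K.smooth_J x).linearMap (K.smooth_h x).linearMap
      (K.smooth_H x).linearMap (K.smooth_h x).nablaEnd.linearMap₂
      (K.smooth_H x).nablaEnd.linearMap₂ (K.smooth_h x).nablaEnd.nablaMap (curvMap x) where
  J_sq := K.kaehler.sq x
  J_skew := K.J_skew
  h_symm := K.symMinus.1 x
  H_symm := K.symPlus.1 x
  h_J := K.symMinus.2 x
  H_J := K.symPlus.2 x
  A_symm := nablaEnd_symm (K.smooth_h x) K.symMinus.1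
  B_symm := nablaEnd_symm (K.smooth_H x) K.symPlus.1
  A_J := K.nablaEnd_h_J
  B_J := K.nablaEnd_H_J
  ricci_identity := ricci_identity (K.smooth_h x)
  R_skew := curv_skew
  R_metric := curv_metric
  R_bianchi := curv_bianchi
  R_J := curv_comm_of_parallel (K.smooth_J x) K.kaehler.parallel
  einstein := sum_curv_of_isEinstein K.einstein x

end IsKaehlerTriple

end KaehlerTriples

/-! ### The vector fields used for integration by parts -/

section Divergences

variable {n : ℕ} {M : Type*} [TopologicalSpace M] [ChartedSpace (EuclideanSpace ℝ (Fin n)) M]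
  [IsManifold (𝓡 n) ∞ M] [RiemannianBundle (fun x : M ↦ TangentSpace (𝓡 n) x)]
  [IsContMDiffRiemannianBundle (𝓡 n) ∞ (EuclideanSpace ℝ (Fin n))
    (fun x : M ↦ TangentSpace (𝓡 n) x)]

/-- The divergence of the vector field dual to `u ↦ tr (α(u, ·))`. -/
def traceDiv (α : BiField n M) (x : M) : ℝ := trace (nabla (traceField α)) x

namespace IsKaehlerTriple

variable {E : ℝ} {J h H : EndField n M}

theorem smooth_dNabla (K : IsKaehlerTriple E J h H) (x : M) : SmoothBiAt x (dNabla h) :=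
  (K.smooth_h x).nablaEnd.sub (K.smooth_h x).nablaEnd.swap

theorem smooth_sharp {A : EndField n M} {α : BiField n M} {x : M} (hA : SmoothEndAt x A)
    (hα : SmoothBiAt x α) : SmoothBiAt x (sharp A α) :=
  (hα.precomp hA).add (hα.swap.precomp hA).swap

theorem smooth_dbar (K : IsKaehlerTriple E J h H) (x : M) : SmoothBiAt x (dbar J h) := by
  have h1 := K.smooth_dNabla x
  exact (h1.sub (((h1.precomp (K.smooth_J x)).swap.precomp (K.smooth_J x)).swap)).smul (1 / 2)

/-- Integrates X by parts: the derivative falls on h (giving X), on ∇h, or on H, where the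
contraction produces -δH; J is parallel. -/
theorem traceDiv_hJJH (K : IsKaehlerTriple E J h H) (x : M) :
    traceDiv (compForm h (compForm J fun y u v ↦ nablaEnd h y (J y (H y u)) v)) x
      = ∑ i, ∑ j, inner ℝ (nablaEnd h x (frame x i) (frame x j))
          (J x (nablaEnd h x (J x (H x (frame x i))) (frame x j)))
        + ∑ i, ∑ k, inner ℝ (h x (J x (nablaBi (nablaEnd h) x (frame x i)
          (J x (H x (frame x i))) (frame x k)))) (frame x k)
        + ∑ k, inner ℝ (h x (J x (nablaEnd h x (J x (-divEnd H x)) (frame x k)))) (frame x k) := by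
  have hJ := K.smooth_J x
  have hh := K.smooth_h x
  have hH := K.smooth_H x
  have hA := hh.nablaEnd
  have h1 : SmoothBiAt x fun y u v ↦ nablaEnd h y (J y (H y u)) v := hA.precomp (hJ.comp hH)
  have h2 : ∀ i k, inner ℝ (nablaBi (compForm h (compForm J fun y u v ↦
        nablaEnd h y (J y (H y u)) v)) x (frame x i) (frame x i) (frame x k)) (frame x k)
      = inner ℝ (nablaEnd h x (frame x i) (frame x k))
          (J x (nablaEnd h x (J x (H x (frame x i))) (frame x k)))
        + inner ℝ (h x (J x (nablaBi (nablaEnd h) x (frame x i)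
          (J x (H x (frame x i))) (frame x k)))) (frame x k)
        + inner ℝ (h x (J x (nablaEnd h x (J x (nablaEnd H x (frame x i) (frame x i)))
          (frame x k)))) (frame x k) := fun i k ↦ by
    have h3 := nablaBi_compForm hh (h1.compForm hJ) (frame x i) (frame x i) (frame x k)
    rw [nablaBi_compForm hJ h1, show nablaBi (fun y u v ↦ nablaEnd h y (J y (H y u)) v) x _ _ _ = _
      from nablaBi_precomp (hJ.comp hH) hA _ _ _, nablaEnd_comp hJ hH] at h3
    refine (congrArg (fun z ↦ inner ℝ z (frame x k)) h3).trans ?_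
    simp only [K.kaehler.parallel, zero_add, hJ.isLinearMap.map_add, hh.isLinearMap.map_add,
      inner_add_left]
    rw [nablaEnd_symm hh K.symMinus.1, real_inner_comm, add_assoc]
    rfl
  rw [traceDiv, trace_nabla_traceField ((h1.compForm hJ).compForm hh)]
  simp only [h2, Finset.sum_add_distrib]
  congr 1
  rw [Finset.sum_comm]
  refine Finset.sum_congr rfl fun k _ ↦ ?_
  let L : TangentSpace (𝓡 n) x →ₗ[ℝ] TangentSpace (𝓡 n) x :=
    hh.linearMap ∘ₗ hJ.linearMap ∘ₗ hA.linearMap₂.flip (frame x k) ∘ₗ hJ.linearMap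
  have hL : ∀ z, h x (J x (nablaEnd h x (J x z) (frame x k))) = L z := fun _ ↦ rfl
  simp only [hL, divEnd, neg_neg, map_sum, sum_inner]

/-- Integrates X' by parts. Here H stands outside, so its derivative is not contracted to δH. -/
theorem traceDiv_HhJJ (K : IsKaehlerTriple E J h H) (x : M) :
    traceDiv (compForm H (compForm h (compForm J fun y u v ↦ nablaEnd h y (J y u) v))) x
      = ∑ i, ∑ k, inner ℝ (J x (nablaEnd h x (J x (frame x i)) (frame x k)))
          (h x (nablaEnd H x (frame x i) (frame x k)))
        + ∑ i, ∑ j, inner ℝ (nablaEnd h x (frame x j) (frame x i))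
          (J x (nablaEnd h x (J x (frame x j)) (H x (frame x i))))
        + ∑ i, ∑ k, inner ℝ (H x (h x (J x (nablaBi (nablaEnd h) x (frame x i)
          (J x (frame x i)) (frame x k))))) (frame x k) := by
  have hJ := K.smooth_J x
  have hh := K.smooth_h x
  have hH := K.smooth_H x
  have hA := hh.nablaEnd
  have h1 := hA.precomp hJ
  have h2 : ∀ i k, inner ℝ (nablaBi (compForm H (compForm h (compForm J fun y u v ↦
        nablaEnd h y (J y u) v))) x (frame x i) (frame x i) (frame x k)) (frame x k)
      = inner ℝ (J x (nablaEnd h x (J x (frame x i)) (frame x k)))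
          (h x (nablaEnd H x (frame x i) (frame x k)))
        + inner ℝ (nablaEnd h x (frame x i) (H x (frame x k)))
          (J x (nablaEnd h x (J x (frame x i)) (frame x k)))
        + inner ℝ (H x (h x (J x (nablaBi (nablaEnd h) x (frame x i)
          (J x (frame x i)) (frame x k))))) (frame x k) := fun i k ↦ by
    have h3 := nablaBi_compForm hH ((h1.compForm hJ).compForm hh) (frame x i) (frame x i)
      (frame x k)
    rw [nablaBi_compForm hh (h1.compForm hJ), nablaBi_compForm hJ h1, nablaBi_precomp hJ hA] at h3
    refine (congrArg (fun z ↦ inner ℝ z (frame x k)) h3).trans ?_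
    simp only [K.kaehler.parallel, zero_add, hA.isBilinearMap.isLinearMap_left _ |>.map_zero,
      add_zero, hH.isLinearMap.map_add, inner_add_left]
    rw [nablaEnd_symm hH K.symPlus.1, K.symPlus.1 x (nablaEnd h x _ _),
      nablaEnd_symm hh K.symMinus.1, real_inner_comm _ (nablaEnd h x _ (H x _)), ← add_assoc]
    simp only [compForm]
    rw [K.symMinus.1 x _ (nablaEnd H x _ _)]
  rw [traceDiv, trace_nabla_traceField (((h1.compForm hJ).compForm hh).compForm hH)]
  simp only [h2, Finset.sum_add_distrib]
  congr 2
  rw [Finset.sum_comm (f := fun i j ↦ inner ℝ (nablaEnd h x (frame x j) (frame x i)) _)]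
  refine Finset.sum_congr rfl fun i _ ↦ ?_
  exact sum_symm (frame x) (Φ := fun u v ↦ inner ℝ (nablaEnd h x (frame x i) u)
    (J x (nablaEnd h x (J x (frame x i)) v))) (isBilinearMap_inner_apply
      (hA.isBilinearMap.isLinearMap_right _) (hJ.linearMap ∘ₗ hA.linearMap₂ _).isLinear)
    (K.symPlus.1 x)

/-- Integrates T by parts. The slots of ∇h are exchanged so that the second-order term is, up to a
curvature commutator, the derivative of δh. -/
theorem traceDiv_Hh_swap (K : IsKaehlerTriple E J h H) (x : M) :
    traceDiv (compForm H (compForm h fun y u v ↦ nablaEnd h y v u)) x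
      = ∑ i, ∑ k, inner ℝ (nablaEnd h x (frame x k) (frame x i))
          (h x (nablaEnd H x (frame x i) (frame x k)))
        + ∑ i, ∑ j, inner ℝ (nablaEnd h x (frame x i) (frame x j))
          (nablaEnd h x (frame x j) (H x (frame x i)))
        + ∑ i, ∑ k, inner ℝ (nablaBi (nablaEnd h) x (frame x i) (frame x k) (frame x i))
          (h x (H x (frame x k))) := by
  have hh := K.smooth_h x
  have hH := K.smooth_H x
  have hA := hh.nablaEnd
  have h2 : ∀ i k, inner ℝ (nablaBi (compForm H (compForm h fun y u v ↦
        nablaEnd h y v u)) x (frame x i) (frame x i) (frame x k)) (frame x k)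
      = inner ℝ (nablaEnd h x (frame x k) (frame x i))
          (h x (nablaEnd H x (frame x i) (frame x k)))
        + inner ℝ (nablaEnd h x (frame x k) (frame x i))
          (nablaEnd h x (frame x i) (H x (frame x k)))
        + inner ℝ (nablaBi (nablaEnd h) x (frame x i) (frame x k) (frame x i))
          (h x (H x (frame x k))) := fun i k ↦ by
    have h3 := nablaBi_compForm hH (hA.swap.compForm hh) (frame x i) (frame x i) (frame x k)
    rw [nablaBi_compForm hh hA.swap, nablaBi_swap (α := nablaEnd h)] at h3
    refine (congrArg (fun z ↦ inner ℝ z (frame x k)) h3).trans ?_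
    simp only [hH.isLinearMap.map_add, inner_add_left]
    rw [nablaEnd_symm hH K.symPlus.1, K.symPlus.1 x (nablaEnd h x _ _),
      nablaEnd_symm hh K.symMinus.1, K.symPlus.1 x (h x _), K.symMinus.1 x _ (H x _), ← add_assoc]
    simp only [compForm]
    rw [K.symMinus.1 x _ (nablaEnd H x _ _)]
  rw [traceDiv, trace_nabla_traceField ((hA.swap.compForm hh).compForm hH)]
  simp only [h2, Finset.sum_add_distrib]
  congr 2
  exact Finset.sum_comm

/-- Trades the rough Laplacian of h², which occurs in 𝐃, for the first-order sum ∑ g(Aᵢ eₖ, h Bᵢ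
eₖ). -/
theorem traceDiv_comp_self (K : IsKaehlerTriple E J h H) (x : M) :
    traceDiv (compForm H (nablaEnd (comp h h))) x
      = 2 * ∑ i, ∑ k, inner ℝ (nablaEnd h x (frame x i) (frame x k))
          (h x (nablaEnd H x (frame x i) (frame x k)))
        - ∑ k, inner ℝ (roughLaplacian (comp h h) x (frame x k)) (H x (frame x k)) := by
  have hh := K.smooth_h x
  have hH := K.smooth_H x
  have hA := (hh.comp hh).nablaEnd
  have h1 : ∑ i, ∑ k, inner ℝ (nablaEnd H x (frame x i) (nablaEnd h x (frame x i)
      (h x (frame x k)) + h x (nablaEnd h x (frame x i) (frame x k)))) (frame x k)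
        = 2 * ∑ i, ∑ k, inner ℝ (nablaEnd h x (frame x i) (frame x k))
          (h x (nablaEnd H x (frame x i) (frame x k))) := (K.jet x).sum_derivative_sq
  rw [traceDiv, trace_nabla_traceField (hA.compForm hH), ← h1]
  simp only [nablaBi_compForm hH hA, nablaEnd_comp hh hh, inner_add_left, Finset.sum_add_distrib,
    sub_eq_add_neg]
  congr 1
  rw [Finset.sum_comm, ← Finset.sum_neg_distrib]
  refine Finset.sum_congr rfl fun k _ ↦ ?_
  simp only [roughLaplacian, inner_neg_left, neg_neg, sum_inner, K.symPlus.1]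

/-- Adjointness of δ and ∇ before integration: it exposes the pairing of h ∘ ∂̄h with ∇H. -/
theorem traceDiv_Hh_dbar (K : IsKaehlerTriple E J h H) (x : M) :
    traceDiv (compForm H (compForm h (dbar J h))) x
      = ∑ i, ∑ k, inner ℝ (nablaEnd H x (frame x i)
          (h x (dbar J h x (frame x i) (frame x k)))) (frame x k)
        - innerEnd (divForm (compForm h (dbar J h))) H x := by
  have hh := K.smooth_h x
  have hH := K.smooth_H x
  have hA := (K.smooth_dbar x).compForm hh
  rw [traceDiv, trace_nabla_traceField (hA.compForm hH)]
  simp only [nablaBi_compForm hH hA, inner_add_left, Finset.sum_add_distrib, sub_eq_add_neg]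
  congr 1
  rw [Finset.sum_comm, innerEnd, ← Finset.sum_neg_distrib]
  refine Finset.sum_congr rfl fun k _ ↦ ?_
  simp only [divForm, inner_neg_left, neg_neg, sum_inner, K.symPlus.1]

end IsKaehlerTriple

end Divergences

/-! ### The pointwise Weitzenböck identity -/

section Weitzenboeck

variable {n : ℕ} {M : Type*} [TopologicalSpace M] [ChartedSpace (EuclideanSpace ℝ (Fin n)) M]
  [IsManifold (𝓡 n) ∞ M] [RiemannianBundle (fun x : M ↦ TangentSpace (𝓡 n) x)]
  [IsContMDiffRiemannianBundle (𝓡 n) ∞ (EuclideanSpace ℝ (Fin n))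
    (fun x : M ↦ TangentSpace (𝓡 n) x)]

/-- The vector field `2 δ h² + (1/2) d tr h² - 2 h δ h`. -/
def divergenceDefect (h : EndField n M) : VField n M :=
  ((2 : ℝ) • divEnd (comp h h) + (1 / 2 : ℝ) • gradient (trace (comp h h)))
    - (2 : ℝ) • applyField h (divEnd h)

theorem smoothVec_divergenceDefect {h : EndField n M} {x : M} (hh : SmoothEndAt x h) :
    SmoothVec x (divergenceDefect h) :=
  (((SmoothVec.divEnd (hh.comp hh)).const_smul 2).add
    ((SmoothVec.gradient (hh.comp hh).trace).const_smul (1 / 2))).sub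
    ((hh.apply (SmoothVec.divEnd hh)).const_smul 2)

theorem trace_nabla_applyField {A : EndField n M} {ζ : VField n M} {x : M}
    (hA : SmoothEndAt x A) (hζ : SmoothVec x ζ)
    (hs : ∀ (y : M) (v w : TangentSpace (𝓡 n) y), inner ℝ (A y v) w = inner ℝ v (A y w)) :
    trace (nabla (applyField A ζ)) x = inner ℝ (ζ x) (-divEnd A x)
      + ∑ i, inner ℝ (nabla ζ x (frame x i)) (A x (frame x i)) := by
  have h1 : ∀ u, nabla (applyField A ζ) x u = nablaEnd A x u (ζ x) + A x (nabla ζ x u) :=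
    nabla_applyField hA hζ
  simp only [trace, h1, inner_add_left, Finset.sum_add_distrib, divEnd, neg_neg, inner_sum, hs,
    nablaEnd_symm hA hs]

namespace IsKaehlerTriple

variable {E : ℝ} {J h H : EndField n M}

/-- Symmetrization and the J-invariant projection are orthogonal projections that fix H, so the full
∇ζ may be paired with H. -/
theorem innerEnd_deltaStarPlus (K : IsKaehlerTriple E J h H) {ζ : VField n M} {x : M}
    (hζ : SmoothVec x ζ) :
    innerEnd (deltaStarPlus J ζ) H x
      = ∑ i, inner ℝ (nabla ζ x (frame x i)) (H x (frame x i)) := by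
  have hP := hζ.smoothEndAt_nabla
  have hPl := hP.isLinearMap
  have hHl := (K.smooth_H x).isLinearMap
  set S : TangentSpace (𝓡 n) x → TangentSpace (𝓡 n) x := fun v ↦ deltaStar ζ x v
  have hS : ∀ u v, inner ℝ (S u) v
      = (1 / 2) * (inner ℝ (nabla ζ x u) v + inner ℝ u (nabla ζ x v)) := fun u v ↦ by
    have h1 : S u = (1 / 2 : ℝ) • (nabla ζ x u + transp (nabla ζ) x u) := rfl
    rw [h1, real_inner_smul_left, inner_add_left, inner_transp hPl]
  have hSb : IsBilinearMap ℝ fun u v ↦ inner ℝ (S u) (H x v) := by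
    constructor <;> intros <;>
      simp only [hS, hPl.map_add, hPl.map_smul, hHl.map_add, hHl.map_smul, inner_add_left,
        inner_add_right, real_inner_smul_left, real_inner_smul_right, smul_eq_mul] <;> ring
  have h1 : ∀ i, inner ℝ (deltaStarPlus J ζ x (frame x i)) (H x (frame x i))
      = (1 / 2) * (inner ℝ (S (frame x i)) (H x (frame x i))
        + inner ℝ (S (J x (frame x i))) (H x (J x (frame x i)))) := fun i ↦ by
    have h2 : deltaStarPlus J ζ x (frame x i)
        = (1 / 2 : ℝ) • (S (frame x i) - J x (S (J x (frame x i)))) := rfl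
    rw [h2, real_inner_smul_left, inner_sub_left, K.J_skew, sub_neg_eq_add, K.symPlus.2]
  have h2 : ∑ i, inner ℝ (S (J x (frame x i))) (H x (J x (frame x i)))
      = ∑ i, inner ℝ (S (frame x i)) (H x (frame x i)) := (K.jet x).sum_J hSb
  have h3 : ∑ i, inner ℝ (nabla ζ x (H x (frame x i))) (frame x i)
      = ∑ i, inner ℝ (nabla ζ x (frame x i)) (H x (frame x i)) :=
    sum_symm (frame x) (Φ := fun u v ↦ inner ℝ (nabla ζ x u) v)
      (isBilinearMap_inner_apply hPl isLinearMap_id') (K.symPlus.1 x)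
  simp only [innerEnd, h1]
  rw [← Finset.mul_sum, Finset.sum_add_distrib, h2]
  simp only [hS]
  rw [← Finset.mul_sum, Finset.sum_add_distrib]
  have h4 : ∑ i, inner ℝ (frame x i) (nabla ζ x (H x (frame x i)))
      = ∑ i, inner ℝ (nabla ζ x (frame x i)) (H x (frame x i)) := by
    simp_rw [← h3, real_inner_comm]
  rw [h4]
  ring

/-- The term -2hδh cancels half of 2δ(h²), and half the gradient of tr h² is the pairing of ∇_d h
with h. The result matches the untwisted terms of `sum_dbar_wedge`. -/
theorem inner_divergenceDefect (K : IsKaehlerTriple E J h H) {x : M} (d : TangentSpace (𝓡 n) x) :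
    inner ℝ (divergenceDefect h x) d
      = -2 * ∑ i, inner ℝ (nablaEnd h x (frame x i) (h x (frame x i))) d
        + ∑ k, inner ℝ (nablaEnd h x d (frame x k)) (h x (frame x k)) := by
  have hh := K.smooth_h x
  have h1 : divergenceDefect h x = (2 : ℝ) • divEnd (comp h h) x
      + (1 / 2 : ℝ) • gradient (trace (comp h h)) x - (2 : ℝ) • h x (divEnd h x) := rfl
  have h2 : h x (divEnd h x) = -∑ i, h x (nablaEnd h x (frame x i) (frame x i)) := by
    have h3 : ∀ v, h x v = hh.linearMap v := fun _ ↦ rfl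
    rw [divEnd, h3, map_neg, map_sum]
    rfl
  have h4 : ∀ k, inner ℝ (h x (nablaEnd h x d (frame x k))) (frame x k)
      = inner ℝ (nablaEnd h x d (frame x k)) (h x (frame x k)) := fun k ↦ K.symMinus.1 x _ _
  have h5 : ∀ k, inner ℝ (nablaEnd h x d (h x (frame x k))) (frame x k)
      = inner ℝ (nablaEnd h x d (frame x k)) (h x (frame x k)) := fun k ↦ by
    rw [nablaEnd_symm hh K.symMinus.1, real_inner_comm]
  rw [h1, h2, inner_sub_left, inner_add_left, real_inner_smul_left, real_inner_smul_left,
    real_inner_smul_left, inner_gradient, mvfderiv_trace (hh.comp hh)]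
  simp only [divEnd, nablaEnd_comp hh hh, inner_neg_left, inner_add_left, sum_inner,
    Finset.sum_add_distrib, h4, h5]
  ring

theorem innerEnd_bfD (K : IsKaehlerTriple E J h H) (x : M) :
    innerEnd (bfD J h) H x
      = 2 * ∑ k, inner ℝ (curvAction h x (frame x k)) (h x (H x (frame x k)))
        + 2 * ∑ k, inner ℝ (nabla (divEnd h) x (frame x k)) (h x (H x (frame x k)))
        - (1 / 2) * ∑ k, inner ℝ (roughLaplacian (comp h h) x (frame x k)) (H x (frame x k))
        + 2 * ∑ k, inner ℝ (curvAction (comp h h) x (frame x k)) (H x (frame x k))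
        + ∑ i, inner ℝ (nabla (divergenceDefect h) x (frame x i)) (H x (frame x i)) := by
  have hh := K.smooth_h x
  have hξ := (SmoothVec.divEnd hh).smoothEndAt_nabla
  rw [← K.innerEnd_deltaStarPlus (smoothVec_divergenceDefect hh)]
  have h1 : ∀ v, bfD J h x v = (curvAction h x (h x v) + h x (curvAction h x v))
      + (deltaStarMinus J (divEnd h) x (h x v) + h x (deltaStarMinus J (divEnd h) x v))
      - ((1 / 2 : ℝ) • (roughLaplacian (comp h h) x v - (2 : ℝ) • curvAction (comp h h) x v)
        - curvAction (comp h h) x v)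
      + deltaStarPlus J (divergenceDefect h) x v
      + (1 / 2 : ℝ) • (h x (extDerivMinus J (divEnd h) x v)
        - extDerivMinus J (divEnd h) x (h x v)) := fun v ↦ by
    have h2 : bfD J h x v = ((curvAction h x (h x v) + deltaStarMinus J (divEnd h) x (h x v))
      + h x (curvAction h x v + deltaStarMinus J (divEnd h) x v))
      - ((1 / 2 : ℝ) • (roughLaplacian (comp h h) x v - (2 : ℝ) • curvAction (comp h h) x v)
        - curvAction (comp h h) x v)
      + deltaStarPlus J (divergenceDefect h) x v
      + (1 / 2 : ℝ) • (h x (extDerivMinus J (divEnd h) x v)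
        - extDerivMinus J (divEnd h) x (h x v)) := rfl
    rw [h2, hh.isLinearMap.map_add]
    abel
  let S : TangentSpace (𝓡 n) x →ₗ[ℝ] TangentSpace (𝓡 n) x :=
    ∑ i, (curvMap x (frame x i)).flip (h x (frame x i))
  have hS : ∀ v, curvAction h x v = S v := fun v ↦ by
    simp only [S, LinearMap.sum_apply, LinearMap.flip_apply]
    rfl
  -- Only the R̊h half of the anticommutator is treated here; the δ^{*,-} half has to be combined
  -- with the commutator. The coefficient 2 of R̊(h²) arises from -(Δ_E/2 - R̊), as Δ_E itself
  -- contains -2R̊.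
  have h3 : ∑ k, inner ℝ (curvAction h x (h x (frame x k)) + h x (curvAction h x (frame x k)))
      (H x (frame x k))
      = 2 * ∑ k, inner ℝ (curvAction h x (frame x k)) (h x (H x (frame x k))) := by
    simp only [hS]
    exact (K.jet x).sum_anticomm (S := S) fun u v ↦ by
      rw [← hS, ← hS]
      exact (K.jet x).curvAction_symm u v
  have h4 : ∑ k, inner ℝ (deltaStarMinus J (divEnd h) x (h x (frame x k))
        + h x (deltaStarMinus J (divEnd h) x (frame x k))) (H x (frame x k))
      + (1 / 2) * ∑ k, inner ℝ (h x (extDerivMinus J (divEnd h) x (frame x k))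
        - extDerivMinus J (divEnd h) x (h x (frame x k))) (H x (frame x k))
      = 2 * ∑ k, inner ℝ (nabla (divEnd h) x (frame x k)) (h x (H x (frame x k))) :=
    (K.jet x).sum_anticomm_add_comm hξ.linearMap (T := transp (nabla (divEnd h)) x)
      (inner_transp hξ.isLinearMap)
  simp only [innerEnd, h1]
  rw [← h3, ← h4]
  simp only [inner_add_left, inner_sub_left, real_inner_smul_left, Finset.sum_add_distrib,
    Finset.sum_sub_distrib, ← Finset.mul_sum]
  ring

/-- The pointwise form of the identity, up to divergences. -/
theorem innerForm_sharp_dNabla (K : IsKaehlerTriple E J h H) (x : M) :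
    innerForm (sharp H (dNabla h)) (dNabla h) x
      = innerEnd (bfD J h) H x + 2 * innerForm (sharp H (dbar J h)) (dbar J h) x
        + 2 * innerEnd (divForm (compForm h (dbar J h))) H x
        - 2 * innerForm (dbar J h) (wedge (divEnd H) h) x
        + (2 * traceDiv (compForm H (compForm h fun y u v ↦ nablaEnd h y v u)) x
          - traceDiv (compForm h (compForm J fun y u v ↦ nablaEnd h y (J y (H y u)) v)) x
          - traceDiv (compForm H (compForm h (compForm J fun y u v ↦ nablaEnd h y (J y u) v))) x
          - (1 / 2) * traceDiv (compForm H (nablaEnd (comp h h))) x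
          - trace (nabla (applyField H (divergenceDefect h))) x
          + 2 * traceDiv (compForm H (compForm h (dbar J h))) x) := by
  have Q : 2 * innerForm (sharp H (dbar J h)) (dbar J h) x
      = innerForm (sharp H (dNabla h)) (dNabla h) x
        - 2 * ∑ i, ∑ j, inner ℝ (nablaEnd h x (frame x i) (frame x j))
          (nablaEnd h x (frame x j) (H x (frame x i)))
        + ∑ i, ∑ j, inner ℝ (nablaEnd h x (frame x i) (frame x j))
          (J x (nablaEnd h x (J x (H x (frame x i))) (frame x j)))
        + ∑ i, ∑ j, inner ℝ (nablaEnd h x (frame x j) (frame x i))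
          (J x (nablaEnd h x (J x (frame x j)) (H x (frame x i)))) := (K.jet x).sum_sharp_dbar
  have D1 : ∑ i, ∑ k, inner ℝ (h x (J x (nablaBi (nablaEnd h) x (frame x i)
        (J x (H x (frame x i))) (frame x k)))) (frame x k)
      = 2 * ∑ k, inner ℝ (curvAction (comp h h) x (frame x k)) (H x (frame x k)) := by
    simp only [curvAction, sum_inner]
    exact (K.jet x).sum_D_JH
  have D2 : ∑ i, ∑ k, inner ℝ (H x (h x (J x (nablaBi (nablaEnd h) x (frame x i)
        (J x (frame x i)) (frame x k))))) (frame x k)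
      = 2 * E * ∑ k, inner ℝ (h x (frame x k)) (h x (H x (frame x k))) := (K.jet x).sum_D_J
  have D3 : ∑ i, ∑ k, inner ℝ (nablaBi (nablaEnd h) x (frame x k) (frame x i) (frame x i)
        - nablaBi (nablaEnd h) x (frame x i) (frame x k) (frame x i)) (h x (H x (frame x k)))
      = ∑ k, inner ℝ (curvAction h x (frame x k)) (h x (H x (frame x k)))
        - E * ∑ k, inner ℝ (h x (frame x k)) (h x (H x (frame x k))) := (K.jet x).sum_D_sub_sum_D
  have P : ∑ k, inner ℝ (nabla (divEnd h) x (frame x k)) (h x (H x (frame x k)))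
      = -∑ i, ∑ k, inner ℝ (nablaBi (nablaEnd h) x (frame x k) (frame x i) (frame x i))
          (h x (H x (frame x k))) := by
    rw [Finset.sum_comm, ← Finset.sum_neg_distrib]
    refine Finset.sum_congr rfl fun k _ ↦ ?_
    rw [nabla_divEnd (K.smooth_h x), inner_neg_left, sum_inner]
  have B : 2 * ∑ i, ∑ k, inner ℝ (nablaEnd H x (frame x i)
        (h x (dbar J h x (frame x i) (frame x k)))) (frame x k)
      = ∑ i, ∑ k, inner ℝ (nablaEnd h x (frame x i) (frame x k))
          (h x (nablaEnd H x (frame x i) (frame x k)))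
        - 2 * ∑ i, ∑ k, inner ℝ (nablaEnd h x (frame x k) (frame x i))
          (h x (nablaEnd H x (frame x i) (frame x k)))
        + ∑ i, ∑ k, inner ℝ (J x (nablaEnd h x (J x (frame x i)) (frame x k)))
          (h x (nablaEnd H x (frame x i) (frame x k))) := (K.jet x).sum_dbar_B
  have W : -2 * innerForm (dbar J h) (wedge (divEnd H) h) x
      = ∑ k, inner ℝ (nablaEnd h x (-divEnd H x) (frame x k)) (h x (frame x k))
        - 2 * ∑ i, inner ℝ (nablaEnd h x (frame x i) (h x (frame x i))) (-divEnd H x)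
        + ∑ k, inner ℝ (h x (J x (nablaEnd h x (J x (-divEnd H x)) (frame x k)))) (frame x k) := by
    refine Eq.trans ?_ ((K.jet x).sum_dbar_wedge (-divEnd H x))
    rw [neg_neg]
    rfl
  have Z := K.inner_divergenceDefect (-divEnd H x)
  -- What remains is linear in the contractions. The multiples of E from `D2` and `D3` cancel, `B`
  -- collects the terms in ∇H, and `W` with `Z` those in δH.
  rw [K.innerEnd_bfD, K.traceDiv_Hh_swap, K.traceDiv_hJJH, K.traceDiv_HhJJ, K.traceDiv_comp_self,
    K.traceDiv_Hh_dbar, trace_nabla_applyField (K.smooth_H x)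
      (smoothVec_divergenceDefect (K.smooth_h x)) K.symPlus.1, Z, D1, D2, P]
  simp only [inner_sub_left, Finset.sum_sub_distrib] at D3
  linarith

end IsKaehlerTriple

end Weitzenboeck

/-! ### Integration of the pointwise identity -/

section Integration

variable {n : ℕ} {M : Type*} [TopologicalSpace M] [ChartedSpace (EuclideanSpace ℝ (Fin n)) M]
  [IsManifold (𝓡 n) ∞ M] [CompactSpace M] [T2Space M]
  [RiemannianBundle (fun x : M ↦ TangentSpace (𝓡 n) x)]
  [IsContMDiffRiemannianBundle (𝓡 n) ∞ (EuclideanSpace ℝ (Fin n))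
    (fun x : M ↦ TangentSpace (𝓡 n) x)]

theorem integralVol_add_const_mul {f g : M → ℝ} (c : ℝ) (hf : Continuous f) (hg : Continuous g) :
    integralVol n (fun x ↦ f x + c * g x) = integralVol n f + c * integralVol n g := by
  rw [integralVol_add hf (hg.const_mul c), integralVol_const_mul]

theorem smoothBiAt_wedge {ξ : VField n M} {h : EndField n M} {x : M} (hξ : SmoothVec x ξ)
    (hh : SmoothEndAt x h) : SmoothBiAt x (wedge ξ h) := by
  filter_upwards [hξ.eventually, hh] with y h1 h2
  refine ⟨⟨?_, ?_, ?_, ?_⟩, fun X Y hX hY ↦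
    (SmoothVec.smul (h1.inner hX) (h2.2 _ hY)).sub (SmoothVec.smul (h1.inner hY) (h2.2 _ hX))⟩ <;>
    intros <;> simp only [wedge, h2.1.map_add, h2.1.map_smul, inner_add_right,
      real_inner_smul_right] <;> module

theorem continuous_traceDiv {α : BiField n M} (hα : ∀ x, SmoothBiAt x α) :
    Continuous (traceDiv α) :=
  continuous_of_smoothFun fun x ↦ (SmoothVec.traceField (hα x)).smoothEndAt_nabla.trace

theorem integralVol_traceDiv {α : BiField n M} (hα : ∀ x, SmoothBiAt x α) :
    integralVol n (traceDiv α) = 0 :=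
  integralVol_trace_nabla fun x ↦ SmoothVec.traceField (hα x)

/-- The integrated form of the identity. -/
theorem IsKaehlerTriple.l2Form_sharp_dNabla {E : ℝ} {J h H : EndField n M}
    (K : IsKaehlerTriple E J h H) :
    l2Form (sharp H (dNabla h)) (dNabla h)
      = l2End (bfD J h) H + 2 * l2Form (sharp H (dbar J h)) (dbar J h)
        + 2 * l2End (divForm (compForm h (dbar J h))) H
        - 2 * l2Form (dbar J h) (wedge (divEnd H) h) := by
  have hA := fun x ↦ (K.smooth_h x).nablaEnd
  have hβ := K.smooth_dbar
  have hα := K.smooth_dNabla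
  have b1 : ∀ x, SmoothBiAt x (compForm H (compForm h fun y u v ↦ nablaEnd h y v u)) := fun x ↦
    ((hA x).swap.compForm (K.smooth_h x)).compForm (K.smooth_H x)
  have b2 : ∀ x, SmoothBiAt x
      (compForm h (compForm J fun y u v ↦ nablaEnd h y (J y (H y u)) v)) := fun x ↦
    (((hA x).precomp ((K.smooth_J x).comp (K.smooth_H x))).compForm (K.smooth_J x)).compForm
      (K.smooth_h x)
  have b3 : ∀ x, SmoothBiAt x
      (compForm H (compForm h (compForm J fun y u v ↦ nablaEnd h y (J y u) v))) := fun x ↦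
    ((((hA x).precomp (K.smooth_J x)).compForm (K.smooth_J x)).compForm (K.smooth_h x)).compForm
      (K.smooth_H x)
  have b4 : ∀ x, SmoothBiAt x (compForm H (nablaEnd (comp h h))) := fun x ↦
    ((K.smooth_h x).comp (K.smooth_h x)).nablaEnd.compForm (K.smooth_H x)
  have b5 : ∀ x, SmoothBiAt x (compForm H (compForm h (dbar J h))) := fun x ↦
    ((hβ x).compForm (K.smooth_h x)).compForm (K.smooth_H x)
  have v : ∀ x, SmoothVec x (applyField H (divergenceDefect h)) := fun x ↦
    (K.smooth_H x).apply (smoothVec_divergenceDefect (K.smooth_h x))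
  have c1 : Continuous (innerForm (sharp H (dNabla h)) (dNabla h)) := continuous_of_smoothFun
    fun x ↦ (smooth_sharp (K.smooth_H x) (hα x)).innerForm (hα x)
  have c2 : Continuous (innerForm (sharp H (dbar J h)) (dbar J h)) := continuous_of_smoothFun
    fun x ↦ (smooth_sharp (K.smooth_H x) (hβ x)).innerForm (hβ x)
  have c3 : Continuous (innerEnd (divForm (compForm h (dbar J h))) H) := continuous_of_smoothFun
    fun x ↦ ((hβ x).compForm (K.smooth_h x)).divForm.innerEnd (K.smooth_H x)
  have c4 : Continuous (innerForm (dbar J h) (wedge (divEnd H) h)) := continuous_of_smoothFun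
    fun x ↦ (hβ x).innerForm (smoothBiAt_wedge (SmoothVec.divEnd (K.smooth_H x)) (K.smooth_h x))
  have d1 := continuous_traceDiv b1
  have d2 := continuous_traceDiv b2
  have d3 := continuous_traceDiv b3
  have d4 := continuous_traceDiv b4
  have d5 := continuous_traceDiv b5
  have d6 : Continuous (trace (nabla (applyField H (divergenceDefect h)))) :=
    continuous_of_smoothFun fun x ↦ (v x).smoothEndAt_nabla.trace
  -- The identity is solved for the term with 𝐃: additivity of the integral then needs continuity
  -- only of the remaining terms, not of this second-order expression.
  have key : innerEnd (bfD J h) H = fun x ↦ innerForm (sharp H (dNabla h)) (dNabla h) x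
      + (-2) * innerForm (sharp H (dbar J h)) (dbar J h) x
      + (-2) * innerEnd (divForm (compForm h (dbar J h))) H x
      + 2 * innerForm (dbar J h) (wedge (divEnd H) h) x
      + (-2) * traceDiv (compForm H (compForm h fun y u v ↦ nablaEnd h y v u)) x
      + 1 * traceDiv (compForm h (compForm J fun y u v ↦ nablaEnd h y (J y (H y u)) v)) x
      + 1 * traceDiv (compForm H (compForm h (compForm J fun y u v ↦ nablaEnd h y (J y u) v))) x
      + (1 / 2) * traceDiv (compForm H (nablaEnd (comp h h))) x
      + (-2) * traceDiv (compForm H (compForm h (dbar J h))) x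
      + 1 * trace (nabla (applyField H (divergenceDefect h))) x := by
    ext x
    linarith [K.innerForm_sharp_dNabla x]
  have hint := congrArg (integralVol n) key
  have z1 := integralVol_traceDiv b1
  have z2 := integralVol_traceDiv b2
  have z3 := integralVol_traceDiv b3
  have z4 := integralVol_traceDiv b4
  have z5 := integralVol_traceDiv b5
  have z6 := integralVol_trace_nabla v
  simp only [l2Form, l2End]
  clear key
  generalize innerEnd (bfD J h) H = f₀ at *
  generalize innerForm (sharp H (dNabla h)) (dNabla h) = f₁ at *
  generalize innerForm (sharp H (dbar J h)) (dbar J h) = f₂ at *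
  generalize innerEnd (divForm (compForm h (dbar J h))) H = f₃ at *
  generalize innerForm (dbar J h) (wedge (divEnd H) h) = f₄ at *
  generalize traceDiv (compForm H (compForm h fun y u v ↦ nablaEnd h y v u)) = g₁ at *
  generalize traceDiv (compForm h (compForm J fun y u v ↦ nablaEnd h y (J y (H y u)) v)) = g₂ at *
  generalize traceDiv (compForm H (compForm h (compForm J fun y u v ↦
    nablaEnd h y (J y u) v))) = g₃ at *
  generalize traceDiv (compForm H (nablaEnd (comp h h))) = g₄ at *
  generalize traceDiv (compForm H (compForm h (dbar J h))) = g₅ at *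
  generalize trace (nabla (applyField H (divergenceDefect h))) = g₆ at *
  rw [integralVol_add_const_mul (g := g₆), integralVol_add_const_mul (g := g₅),
    integralVol_add_const_mul (g := g₄), integralVol_add_const_mul (g := g₃),
    integralVol_add_const_mul (g := g₂), integralVol_add_const_mul (g := g₁),
    integralVol_add_const_mul (g := f₄), integralVol_add_const_mul (g := f₃),
    integralVol_add_const_mul (g := f₂), z1, z2, z3, z4, z5, z6] at hint
  · linarith
  all_goals fun_prop

end Integration

end KaehlerEinstein

end

theorem mainTheorem8 (m : ℕ) {M : Type*} [TopologicalSpace M]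
    [ChartedSpace (EuclideanSpace ℝ (Fin (2 * m))) M] [IsManifold (𝓡 (2 * m)) ∞ M]
    [CompactSpace M] [T2Space M]
    [RiemannianBundle (fun x : M ↦ TangentSpace (𝓡 (2 * m)) x)]
    [IsContMDiffRiemannianBundle (𝓡 (2 * m)) ∞ (EuclideanSpace ℝ (Fin (2 * m)))
      (fun x : M ↦ TangentSpace (𝓡 (2 * m)) x)]
    (J : KaehlerEinstein.EndField (2 * m) M) (hJ : KaehlerEinstein.IsSmoothEnd J)
    (hKaehler : KaehlerEinstein.IsKaehler J)
    (E : ℝ) (hE : E < 0) (hEinstein : KaehlerEinstein.IsEinstein (2 * m) M E)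
    (h H : KaehlerEinstein.EndField (2 * m) M)
    (hh : KaehlerEinstein.IsSmoothEnd h) (hh' : KaehlerEinstein.IsSymMinus J h)
    (hH : KaehlerEinstein.IsSmoothEnd H) (hH' : KaehlerEinstein.IsSymPlus J H) :
    KaehlerEinstein.l2Form (KaehlerEinstein.sharp H (KaehlerEinstein.dNabla h))
        (KaehlerEinstein.dNabla h)
      = KaehlerEinstein.l2End (KaehlerEinstein.bfD J h) H
        + 2 * KaehlerEinstein.l2Form (KaehlerEinstein.sharp H (KaehlerEinstein.dbar J h))
            (KaehlerEinstein.dbar J h)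
        + 2 * KaehlerEinstein.l2End
            (KaehlerEinstein.divForm (KaehlerEinstein.compForm h (KaehlerEinstein.dbar J h))) H
        - 2 * KaehlerEinstein.l2Form (KaehlerEinstein.dbar J h)
            (KaehlerEinstein.wedge (KaehlerEinstein.divEnd H) h) :=
  KaehlerEinstein.IsKaehlerTriple.l2Form_sharp_dNabla (n := 2 * m) (E := E)
    { kaehler := hKaehler, einstein := hEinstein, smooth_J := hJ.smoothEndAt,
      smooth_h := hh.smoothEndAt, smooth_H := hH.smoothEndAt, symMinus := hh', symPlus := hH' }
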